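/- **Theorem 3.1 (Bias analysis).** Let $(M,g)$ be a closed (compact, without boundary) smooth Riemannian manifold of dimension $d\ge 1$ and let $\iota:M\hookrightarrow\mathbb{R}^D$ be a smooth isometric embedding; write $dV$ for the Riemannian volume, $\nabla$ for the gradient, $\cdot$ for the Riemannian inner product, and $\Delta=\operatorname{div}\nabla$ for the Laplace–Beltrami operator. Let $K:[0,\infty)\to[0,\infty)$ be of class $C^3$ with $K(0)>0$ and $K(t)\le C_K e^{-ct}$ for some $C_K\in\mathbb{R}$, $c>0$ and all $t\ge 0$, normalized by $\int_{\mathbb{R}^d}K(\|u\|)\,du=1$, and put $\mu_{1,2}^{(0)}=\int_{\mathbb{R}^d}\|u\|^2K(\|u\|)\,du$. Let $p_X,p_Y\in C^4(M)$ be everywhere positive probability densities with respect to $dV$. For $\epsilon>0$ let $K_\epsilon(x,y)=K\big(\|\iota(x)-\iota(y)\|_{\mathbb{R}^D}/\sqrt{\epsilon}\big)$, $$K_{\mathrm{ref},\epsilon}(x,y)=\int_M K_\epsilon(x,z)K_\epsilon(z,y)p_Y(z)\,dV(z),\qquad d_{\mathrm{ref},\epsilon}(x)=\int_M K_{\mathrm{ref},\epsilon}(x,y)p_X(y)\,dV(y),$$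 $$T_{\mathrm{ref},\epsilon}f(x)=\int_M\frac{K_{\mathrm{ref},\epsilon}(x,y)}{d_{\mathrm{ref},\epsilon}(x)}f(y)p_X(y)\,dV(y).$$ Then for every $f\in C^4(M)$ and all $x\in M$, as $\epsilon\to0^+$, $$T_{\mathrm{ref},\epsilon}f(x)-f(x)=\frac{\epsilon\mu_{1,2}^{(0)}}{d}\left(\frac{2\nabla p_X(x)}{p_X(x)}+\frac{\nabla p_Y(x)}{p_Y(x)}\right)\cdot\nabla f(x)+\frac{\epsilon\mu_{1,2}^{(0)}}{d}\Delta f(x)+\mathcal{O}(\epsilon^2).$$ In particular, if $p_Y=c\,p_X^{-2}$ for a constant $c$, then $T_{\mathrm{ref},\epsilon}f(x)-f(x)=\frac{\epsilon\mu_{1,2}^{(0)}}{d}\Delta f(x)+\mathcal{O}(\epsilon^2)$. The error terms are uniform: for all $b>0$ and $B$ there are $C$ and $\epsilon_0>0$, depending only on $(M,g,\iota)$, $K$, $b$ and $B$, such that whenever $p_X,p_Y\ge b$ and $\|p_X\|_{C^4},\|p_Y\|_{C^4}\le B$, each error is at most $C\|f\|_{C^4}\,\epsilon^2$ in absolute value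 for all $f\in C^4(M)$, $x\in M$ and $0<\epsilon\le\epsilon_0$. Here $\|f\|_{C^4}$ is the supremum over $M$ of $|f|$ and of all derivatives of $f$ of order at most $4$ along the gradient fields $\nabla\iota_1,\dots,\nabla\iota_D$ of the coordinates of $\iota$ (these span every tangent space, so this is equivalent to any other $C^4$ norm). -/

import Mathlib

open Bundle Manifold MeasureTheory
open scoped ContDiff

noncomputable section RoselandDefs

-- A normed space is a manifold through its identity chart: keep this the instance that is found.
attribute [local instance 2000] chartedSpaceSelf

section Geometry

variable {d D : ℕ} {M : Type*} [TopologicalSpace M] [ChartedSpace (EuclideanSpace ℝ (Fin d)) M]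

/-- The coordinate vector field `∂ᵢ` of the preferred chart around `x₀`, at the point of `M` with
coordinates `u`. -/
def coordVector (x₀ : M) (u : EuclideanSpace ℝ (Fin d)) (i : Fin d) :
    TangentSpace (𝓡 d) ((extChartAt (𝓡 d) x₀).symm u) :=
  (mfderiv 𝓘(ℝ, EuclideanSpace ℝ (Fin d)) (𝓡 d) (extChartAt (𝓡 d) x₀).symm u)
    (EuclideanSpace.single i (1 : ℝ) : EuclideanSpace ℝ (Fin d))

variable [RiemannianBundle (fun x : M => TangentSpace (𝓡 d) x)]

/-- The matrix `gᵢⱼ` of the Riemannian metric in the preferred chart around `x₀`, as a function of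
the coordinates `u`. -/
def metricMatrix (x₀ : M) (u : EuclideanSpace ℝ (Fin d)) : Matrix (Fin d) (Fin d) ℝ :=
  Matrix.of fun i j => inner ℝ (coordVector x₀ u i) (coordVector x₀ u j)

/-- The Riemannian volume density `√(det gᵢⱼ)` in the preferred chart around `x₀`. -/
def volumeDensity (x₀ : M) (u : EuclideanSpace ℝ (Fin d)) : ℝ :=
  Real.sqrt (metricMatrix x₀ u).det

/-- The Riemannian volume `√(det gᵢⱼ) du` of the domain of the preferred chart around `x₀`, as a
measure on `M` that vanishes outside this domain. -/
def chartVolume [MeasurableSpace M] (x₀ : M) : Measure M :=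
  ((volume.restrict (extChartAt (𝓡 d) x₀).target).withDensity
    fun u => ENNReal.ofReal (volumeDensity x₀ u)).map (extChartAt (𝓡 d) x₀).symm

/-- The Riemannian volume measure `dV`. The chart volumes are the restrictions of `dV` to the chart
domains (they agree on overlaps), so `dV` is the least measure that dominates all of them. -/
def riemannianVolume (d : ℕ) (M : Type*) [TopologicalSpace M]
    [ChartedSpace (EuclideanSpace ℝ (Fin d)) M]
    [RiemannianBundle (fun x : M => TangentSpace (𝓡 d) x)] [MeasurableSpace M] : Measure M :=
  ⨆ x₀ : M, chartVolume (d := d) x₀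

/-- The Riemannian gradient `∇f(x)`: the tangent vector with `⟨∇f(x), v⟩ = df(x) v`. -/
def riemannianGradient (d : ℕ) {M : Type*} [TopologicalSpace M]
    [ChartedSpace (EuclideanSpace ℝ (Fin d)) M]
    [RiemannianBundle (fun x : M => TangentSpace (𝓡 d) x)] (f : M → ℝ) (x : M) :
    TangentSpace (𝓡 d) x :=
  haveI : FiniteDimensional ℝ (TangentSpace (𝓡 d) x) :=
    inferInstanceAs (FiniteDimensional ℝ (EuclideanSpace ℝ (Fin d)))
  haveI : CompleteSpace (TangentSpace (𝓡 d) x) := FiniteDimensional.complete ℝ _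
  (InnerProductSpace.toDual ℝ (TangentSpace (𝓡 d) x)).symm (mfderiv (𝓡 d) 𝓘(ℝ, ℝ) f x)

/-- The Laplace–Beltrami operator `Δ = div ∇` (a nonpositive operator), computed in the preferred
chart around `x`: `Δf = |g|^{-1/2} ∑ᵢ ∂ᵢ (|g|^{1/2} ∑ⱼ gⁱʲ ∂ⱼ f)`. -/
def laplaceBeltrami (d : ℕ) {M : Type*} [TopologicalSpace M]
    [ChartedSpace (EuclideanSpace ℝ (Fin d)) M]
    [RiemannianBundle (fun x : M => TangentSpace (𝓡 d) x)] (f : M → ℝ) (x : M) : ℝ :=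
  (volumeDensity x (extChartAt (𝓡 d) x x))⁻¹ *
    ∑ i : Fin d,
      fderiv ℝ (fun u : EuclideanSpace ℝ (Fin d) => volumeDensity x u *
          ∑ j : Fin d, (metricMatrix x u)⁻¹ i j *
            fderiv ℝ (f ∘ (extChartAt (𝓡 d) x).symm) u (EuclideanSpace.single j (1 : ℝ)))
        (extChartAt (𝓡 d) x x) (EuclideanSpace.single i (1 : ℝ))

/-- `ι` is a smooth isometric embedding of the Riemannian manifold `M` into `ℝᴰ`: a smooth
topological embedding whose differential preserves the inner products of tangent vectors. -/
structure IsIsometricEmbedding (ι : M → EuclideanSpace ℝ (Fin D)) : Prop where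
  contMDiff : ContMDiff (𝓡 d) 𝓘(ℝ, EuclideanSpace ℝ (Fin D)) ∞ ι
  isEmbedding : Topology.IsEmbedding ι
  inner_mfderiv : ∀ (x : M) (v w : TangentSpace (𝓡 d) x),
    inner ℝ (mfderiv (𝓡 d) 𝓘(ℝ, EuclideanSpace ℝ (Fin D)) ι x v : EuclideanSpace ℝ (Fin D))
      (mfderiv (𝓡 d) 𝓘(ℝ, EuclideanSpace ℝ (Fin D)) ι x w : EuclideanSpace ℝ (Fin D)) =
    inner ℝ v w

/-- The derivative of `f` along the vector field `∇ιₐ` (the tangential part of the `a`-th coordinate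
vector field of `ℝᴰ`). -/
def tangentialDeriv (d : ℕ) {D : ℕ} {M : Type*} [TopologicalSpace M]
    [ChartedSpace (EuclideanSpace ℝ (Fin d)) M]
    [RiemannianBundle (fun x : M => TangentSpace (𝓡 d) x)]
    (ι : M → EuclideanSpace ℝ (Fin D)) (a : Fin D) (f : M → ℝ) (x : M) : ℝ :=
  inner ℝ (riemannianGradient d (fun y => ι y a) x) (riemannianGradient d f x)

/-- Iterated tangential derivatives along a list of coordinate directions of `ℝᴰ`. -/
def iteratedTangentialDeriv (d : ℕ) {D : ℕ} {M : Type*} [TopologicalSpace M]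
    [ChartedSpace (EuclideanSpace ℝ (Fin d)) M]
    [RiemannianBundle (fun x : M => TangentSpace (𝓡 d) x)]
    (ι : M → EuclideanSpace ℝ (Fin D)) : List (Fin D) → (M → ℝ) → M → ℝ
  | [], f => f
  | a :: l, f => tangentialDeriv d ι a (iteratedTangentialDeriv d ι l f)

/-- `‖f‖_{Cᵏ} ≤ A`, where the `Cᵏ` norm of a function on the embedded manifold is the supremum of
the absolute values of all its tangential derivatives of order at most `k`. The fields `∇ιₐ` span
every tangent space, so on a closed manifold this is one of the equivalent `Cᵏ` norms. -/
def CkNormLE (d : ℕ) {D : ℕ} {M : Type*} [TopologicalSpace M]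
    [ChartedSpace (EuclideanSpace ℝ (Fin d)) M]
    [RiemannianBundle (fun x : M => TangentSpace (𝓡 d) x)]
    (ι : M → EuclideanSpace ℝ (Fin D)) (k : ℕ) (f : M → ℝ) (A : ℝ) : Prop :=
  ∀ l : List (Fin D), l.length ≤ k → ∀ x : M, |iteratedTangentialDeriv d ι l f x| ≤ A

/-- `p` is a positive probability density of class `C⁴` with respect to the Riemannian volume. -/
structure IsC4Density (d : ℕ) {M : Type*} [TopologicalSpace M]
    [ChartedSpace (EuclideanSpace ℝ (Fin d)) M]
    [RiemannianBundle (fun x : M => TangentSpace (𝓡 d) x)] [MeasurableSpace M]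
    (p : M → ℝ) : Prop where
  contMDiff : ContMDiff (𝓡 d) 𝓘(ℝ, ℝ) 4 p
  pos : ∀ x, 0 < p x
  integral_eq_one : ∫ x, p x ∂(riemannianVolume d M) = 1

end Geometry

section Kernel

/-- The moments `μ_{r,l}^{(k)} = ∫_{ℝᵈ} ‖x‖ˡ ∂ᵏ(Kʳ)(‖x‖) dx` of a kernel function. -/
def kernelMoment (d : ℕ) (K : ℝ → ℝ) (r l k : ℕ) : ℝ :=
  ∫ x : EuclideanSpace ℝ (Fin d),
    ‖x‖ ^ l * iteratedDerivWithin k (fun t => K t ^ r) (Set.Ici 0) ‖x‖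

/-- Normalized kernel functions in dimension `d`. Only the values of `K` on `[0, ∞)` matter. -/
structure IsKernelFunction (d : ℕ) (K : ℝ → ℝ) : Prop where
  contDiffOn : ContDiffOn ℝ 3 K (Set.Ici 0)
  nonneg : ∀ t, 0 ≤ t → 0 ≤ K t
  pos_zero : 0 < K 0
  exp_decay : ∃ C c : ℝ, 0 < c ∧ ∀ t, 0 ≤ t → K t ≤ C * Real.exp (-c * t)
  normalized : kernelMoment d K 1 0 0 = 1

end Kernel

section Operators

variable {D : ℕ} {M : Type*}

/-- `K_ε(x, y) = K(‖ι(x) - ι(y)‖ / √ε)`. -/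
def scaledKernel (ι : M → EuclideanSpace ℝ (Fin D)) (K : ℝ → ℝ) (ε : ℝ) (x y : M) : ℝ :=
  K (‖ι x - ι y‖ / Real.sqrt ε)

variable [MeasurableSpace M]

/-- The landmark kernel `K_{ref,ε}(x, y) = ∫ K_ε(x, z) K_ε(z, y) p_Y(z) dV(z)`. -/
def landmarkKernel (V : Measure M) (ι : M → EuclideanSpace ℝ (Fin D)) (K : ℝ → ℝ) (pY : M → ℝ)
    (ε : ℝ) (x y : M) : ℝ :=
  ∫ z, scaledKernel ι K ε x z * scaledKernel ι K ε z y * pY z ∂V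

/-- The degree function `d_{ref,ε}(x) = ∫ K_{ref,ε}(x, y) p_X(y) dV(y)`. -/
def landmarkDegree (V : Measure M) (ι : M → EuclideanSpace ℝ (Fin D)) (K : ℝ → ℝ) (pX pY : M → ℝ)
    (ε : ℝ) (x : M) : ℝ :=
  ∫ y, landmarkKernel V ι K pY ε x y * pX y ∂V

/-- The operator `T_{ref,ε} f(x) = ∫ K_{ref,ε}(x, y) / d_{ref,ε}(x) f(y) p_X(y) dV(y)`. -/
def landmarkOperator (V : Measure M) (ι : M → EuclideanSpace ℝ (Fin D)) (K : ℝ → ℝ)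
    (pX pY : M → ℝ) (ε : ℝ) (f : M → ℝ) (x : M) : ℝ :=
  ∫ y, landmarkKernel V ι K pY ε x y / landmarkDegree V ι K pX pY ε x * f y * pX y ∂V

end Operators

end RoselandDefs

/-! By Fubini, `T f(x) - f(x)` is the quotient of two double averages `∫ K_ε(x,z) q(z) ∫ K_ε(z,y)
g(y)` (`doubleAverage`), both with `q = pY`: the numerator has `g = (f - f(x)) pX`, the denominator
`g = pX` (`landmarkOperator_sub_eq`). Everything rests on a second-order expansion of such averages,
uniform in `x`, `g` and `q`.

The expansion becomes transparent in coordinates in which the extrinsic distance to the centre is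
exactly the Euclidean norm. A Morse lemma with parameters (`exists_morse_coordinates`) provides
them, smoothly in the centre. The kernel is then exactly `K(‖v‖/√ε) K(‖v'‖/√ε)`, and all geometry
sits in a `C⁴` function `h(v,v')` built from `g`, `q` and Jacobians `J`. The weight is even, so only
the even part of `h` counts: a value, a Hessian term and a fourth-order remainder. Reflections
reduce the Hessian term to its traces in `v` and in `v'` (`kernel_average_expansion`). Contributions
from beyond a fixed distance are negligible by the decay of `K`.

The geometric core is `laplacian_of_radial`: in such coordinates `∑ ∂ᵢ²f + 2 ∑ ∂ᵢJ ∂ᵢf` is `Δf` at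
the centre. As `J = 1` there, the Hessian of `f J` has trace `Δf + S f`, where `S` is the trace of
the Hessian of `J`. The second-order coefficient of the double average is therefore `2 g q S + Δ(g
q) + q Δg` (`exists_local_expansion`). For `g = (f - f(x)) pX` the curvature term disappears because
`g(x) = 0`, and the product rules turn the rest, divided by `pX pY`, into `2Δf + 2⟪2∇pX/pX + ∇pY/pY,
∇f⟫` (`bias_coefficient_eq`). If `pY pX²` is constant, its gradient vanishes and so does the drift.

For uniformity, all local constants depend on the functions only through `C⁴` bounds in a chart. The
norm given by tangential derivatives controls these, since `df` is the combination of the `dιₐ` with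
coefficients `⟪∇ιₐ, ∇f⟫` (`exists_ckAt_chart`). Compactness of `M` patches the local bounds. -/

noncomputable section RoselandProof

open Filter Topology

/-! ### Gram matrices, volume distortion and their derivatives. -/

section GramMatrix

variable {d : ℕ} {N : Type*} [NormedAddCommGroup N] [InnerProductSpace ℝ N]

/-- The `i`-th standard basis vector of `ℝᵈ`. -/
abbrev stdVec {d : ℕ} (i : Fin d) : EuclideanSpace ℝ (Fin d) := EuclideanSpace.single i (1 : ℝ)

/-- The Gram matrix of the images of the standard basis vectors. -/
def gramMatrix (A : EuclideanSpace ℝ (Fin d) →L[ℝ] N) : Matrix (Fin d) (Fin d) ℝ :=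
  Matrix.of fun i j => inner ℝ (A (stdVec i)) (A (stdVec j))

/-- The volume distortion `√(det (AᵀA))` of a linear map. -/
def jac (A : EuclideanSpace ℝ (Fin d) →L[ℝ] N) : ℝ := Real.sqrt (gramMatrix A).det

lemma gramMatrix_apply (A : EuclideanSpace ℝ (Fin d) →L[ℝ] N) (i j : Fin d) :
    gramMatrix A i j = inner ℝ (A (stdVec i)) (A (stdVec j)) := rfl

lemma sum_smul_stdVec (v : EuclideanSpace ℝ (Fin d)) : ∑ i, v i • stdVec i = v := by
  have := (EuclideanSpace.basisFun (Fin d) ℝ).sum_repr v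
  simpa using this

lemma gramMatrix_comp (A : EuclideanSpace ℝ (Fin d) →L[ℝ] N)
    (B : EuclideanSpace ℝ (Fin d) →L[ℝ] EuclideanSpace ℝ (Fin d)) :
    gramMatrix (A ∘L B) =
      (Matrix.of fun k i => B (stdVec i) k).transpose * gramMatrix A *
        (Matrix.of fun k i => B (stdVec i) k) := by
  ext i j
  have h : ∀ i, A (B (stdVec i)) = ∑ k, B (stdVec i) k • A (stdVec k) := fun i => by
    conv_lhs => rw [← sum_smul_stdVec (B (stdVec i))]
    simp
  simp only [gramMatrix_apply, ContinuousLinearMap.comp_apply, h, sum_inner, inner_sum,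
    Matrix.mul_apply, Matrix.transpose_apply, Matrix.of_apply, inner_smul_left, inner_smul_right,
    Finset.sum_mul]
  refine Finset.sum_congr rfl fun k _ => ?_
  rw [Finset.mul_sum]
  refine Finset.sum_congr rfl fun l _ => ?_
  simp
  ring

lemma det_matrix_stdVec (B : EuclideanSpace ℝ (Fin d) →L[ℝ] EuclideanSpace ℝ (Fin d)) :
    (Matrix.of fun k i => B (stdVec i) k : Matrix (Fin d) (Fin d) ℝ).det = B.det := by
  have h := LinearMap.det_toMatrix (EuclideanSpace.basisFun (Fin d) ℝ).toBasis
    (B : EuclideanSpace ℝ (Fin d) →ₗ[ℝ] EuclideanSpace ℝ (Fin d))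
  rw [ContinuousLinearMap.det, ← h]
  congr 1

/-- This transformation rule makes the chart volumes agree on overlaps and yields the change of
variables for the Riemannian volume. -/
lemma jac_comp (A : EuclideanSpace ℝ (Fin d) →L[ℝ] N)
    (B : EuclideanSpace ℝ (Fin d) →L[ℝ] EuclideanSpace ℝ (Fin d)) :
    jac (A ∘L B) = |B.det| * jac A := by
  rw [jac, gramMatrix_comp, Matrix.det_mul, Matrix.det_mul, Matrix.det_transpose,
    det_matrix_stdVec, jac,
    show B.det * (gramMatrix A).det * B.det = B.det ^ 2 * (gramMatrix A).det by ring,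
    Real.sqrt_mul (sq_nonneg _), Real.sqrt_sq_eq_abs]

lemma gramMatrix_eq_one {A : EuclideanSpace ℝ (Fin d) →L[ℝ] N} (h : ∀ v, ‖A v‖ = ‖v‖) :
    gramMatrix A = 1 := by
  ext i j
  have := LinearIsometry.inner_map_map ({ A with norm_map' := h } :
    EuclideanSpace ℝ (Fin d) →ₗᵢ[ℝ] N) (stdVec i) (stdVec j)
  rw [gramMatrix_apply]
  refine Eq.trans this ?_
  simp [Matrix.one_apply, EuclideanSpace.inner_single_left]

lemma jac_eq_one {A : EuclideanSpace ℝ (Fin d) →L[ℝ] N} (h : ∀ v, ‖A v‖ = ‖v‖) : jac A = 1 := by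
  simp [jac, gramMatrix_eq_one h]

lemma gramMatrix_posDef {A : EuclideanSpace ℝ (Fin d) →L[ℝ] N} (h : Function.Injective A) :
    (gramMatrix A).PosDef := by
  have hli : LinearIndependent ℝ fun i : Fin d => A (stdVec i) := by
    have := (EuclideanSpace.basisFun (Fin d) ℝ).toBasis.linearIndependent.map'
      (A : EuclideanSpace ℝ (Fin d) →ₗ[ℝ] N) (LinearMap.ker_eq_bot.2 h)
    have h2 : (fun i : Fin d => A (stdVec i)) =
        ⇑(A : EuclideanSpace ℝ (Fin d) →ₗ[ℝ] N) ∘ ⇑(EuclideanSpace.basisFun (Fin d) ℝ).toBasis := by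
      ext i
      simp
    rw [h2]
    exact this
  exact Matrix.posDef_gram_of_linearIndependent hli

lemma jac_pos {A : EuclideanSpace ℝ (Fin d) →L[ℝ] N} (h : Function.Injective A) : 0 < jac A :=
  Real.sqrt_pos.2 (gramMatrix_posDef h).det_pos

variable {X : Type*} [NormedAddCommGroup X] [NormedSpace ℝ X]

lemma contDiff_det {n : WithTop ℕ∞} :
    ContDiff ℝ n fun m : Fin d → Fin d → ℝ => (Matrix.of m).det := by
  simp only [Matrix.det_apply, Matrix.of_apply]
  refine ContDiff.sum fun σ _ => ContDiff.const_smul _ (contDiff_prod fun i _ => ?_)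
  exact contDiff_apply_apply ℝ ℝ (σ i) i

lemma ContDiffAt.gramMatrix {n : WithTop ℕ∞} {A : X → EuclideanSpace ℝ (Fin d) →L[ℝ] N} {x : X}
    (hA : ContDiffAt ℝ n A x) :
    ContDiffAt ℝ n (fun y => (fun i j => gramMatrix (A y) i j : Fin d → Fin d → ℝ)) x := by
  refine contDiffAt_pi.2 fun i => contDiffAt_pi.2 fun j => ?_
  simp only [gramMatrix_apply]
  exact (hA.clm_apply contDiffAt_const).inner ℝ (hA.clm_apply contDiffAt_const)

lemma ContDiffAt.jac {n : WithTop ℕ∞} {A : X → EuclideanSpace ℝ (Fin d) →L[ℝ] N} {x : X}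
    (hA : ContDiffAt ℝ n A x) (hinj : Function.Injective (A x)) :
    ContDiffAt ℝ n (fun y => jac (A y)) x := by
  have h : ContDiffAt ℝ n (fun y => (_root_.gramMatrix (A y)).det) x :=
    contDiff_det.contDiffAt.comp x hA.gramMatrix
  exact h.sqrt (gramMatrix_posDef hinj).det_pos.ne'

/-- Jacobi's formula. -/
lemma fderiv_det {m : X → Fin d → Fin d → ℝ} {x : X} (hm : DifferentiableAt ℝ m x)
    (h0 : (Matrix.of (m x)).det ≠ 0) (v : X) :
    fderiv ℝ (fun y => (Matrix.of (m y)).det) x v =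
      (Matrix.of (m x)).det * ((Matrix.of (m x))⁻¹ * Matrix.of (fderiv ℝ m x v)).trace := by
  have hdet : DifferentiableAt ℝ (fun m : Fin d → Fin d → ℝ => (Matrix.of m).det) (m x) :=
    (contDiff_det (n := 1)).differentiable one_ne_zero _
  have h1 := (hdet.hasFDerivAt.comp x hm.hasFDerivAt).fderiv
  have h2 : (fun y => (Matrix.of (m y)).det) =
    (fun m : Fin d → Fin d → ℝ => (Matrix.of m).det) ∘ m := rfl
  rw [h2, h1, ContinuousLinearMap.comp_apply]
  generalize fderiv ℝ m x v = H
  generalize m x = g at *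
  -- Restricting the determinant to the line `g + t H` leaves a derivative in one real variable.
  have h3 : HasDerivAt (fun t : ℝ => (Matrix.of (g + t • H)).det)
      (fderiv ℝ (fun m : Fin d → Fin d → ℝ => (Matrix.of m).det) g H) 0 := by
    have hl : HasDerivAt (fun t : ℝ => g + t • H) H 0 := by
      simpa using ((hasDerivAt_id (0 : ℝ)).smul_const H).const_add g
    have hdet' : HasFDerivAt (fun m : Fin d → Fin d → ℝ => (Matrix.of m).det)
      (fderiv ℝ (fun m : Fin d → Fin d → ℝ => (Matrix.of m).det) g) (g + (0 : ℝ) • H) := by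
      simpa using hdet.hasFDerivAt
    exact hdet'.comp_hasDerivAt (0 : ℝ) hl
  have h4 : HasDerivAt (fun t : ℝ => (Matrix.of (g + t • H)).det)
      ((Matrix.of g).det * ((Matrix.of g)⁻¹ * Matrix.of H).trace) 0 := by
    -- `det (g + t H) = det g · det (1 + t g⁻¹ H)`, and the linear coefficient of `det (1 + t Z)` is
    -- the trace of `Z`.
    have h5 : (fun t : ℝ => (Matrix.of (g + t • H)).det) = fun t : ℝ => (Matrix.of g).det *
        (Matrix.det (1 + (Polynomial.X : Polynomial ℝ) •
          ((Matrix.of g)⁻¹ * Matrix.of H).map Polynomial.C)).eval t := by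
      funext t
      have h6 : (Matrix.det (1 + (Polynomial.X : Polynomial ℝ) •
          ((Matrix.of g)⁻¹ * Matrix.of H).map Polynomial.C)).eval t =
          (1 + t • ((Matrix.of g)⁻¹ * Matrix.of H)).det := by
        rw [← Polynomial.coe_evalRingHom, RingHom.map_det]
        congr 1
        generalize (Matrix.of g)⁻¹ * Matrix.of H = Z
        ext i j
        simp only [RingHom.mapMatrix_apply, Matrix.map_apply, Matrix.add_apply, Matrix.one_apply,
          Matrix.smul_apply, map_add, smul_eq_mul, Polynomial.coe_evalRingHom]
        split_ifs <;> simp <;> exact mul_comm _ _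
      rw [h6, ← Matrix.det_mul, mul_add, mul_one, mul_smul_comm,
        Matrix.mul_nonsing_inv_cancel_left _ _ (isUnit_iff_ne_zero.2 h0)]
      rfl
    rw [h5]
    refine HasDerivAt.const_mul _ ?_
    rw [← Matrix.derivative_det_one_add_X_smul]
    exact Polynomial.hasDerivAt _ _
  exact h3.unique h4

/-- Jacobi's formula for the Gram determinant. The symmetry of the Gram matrix merges the two terms
in the derivative of an inner product, and the resulting factor 2 cancels the 1/2 from the square
root. -/
lemma fderiv_jac {A : X → EuclideanSpace ℝ (Fin d) →L[ℝ] N} {x : X}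
    (hA : DifferentiableAt ℝ A x) (hinj : Function.Injective (A x)) (v : X) :
    fderiv ℝ (fun y => jac (A y)) x v = jac (A x) *
      ∑ i, ∑ j, (gramMatrix (A x))⁻¹ i j *
        inner ℝ (A x (stdVec j)) (fderiv ℝ A x v (stdVec i)) := by
  set g : X → Fin d → Fin d → ℝ := fun y i j => gramMatrix (A y) i j with hg
  have hA' : ∀ i, HasFDerivAt (fun y => A y (stdVec i))
      ((ContinuousLinearMap.apply ℝ N (stdVec i)) ∘L fderiv ℝ A x) x := fun i =>
    (ContinuousLinearMap.apply ℝ N (stdVec i)).hasFDerivAt.comp x hA.hasFDerivAt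
  have hgij : ∀ i j, HasFDerivAt (fun y => g y i j)
      ((fderivInnerCLM ℝ (A x (stdVec i), A x (stdVec j))).comp
        (((ContinuousLinearMap.apply ℝ N (stdVec i)) ∘L fderiv ℝ A x).prod
          ((ContinuousLinearMap.apply ℝ N (stdVec j)) ∘L fderiv ℝ A x))) x := fun i j =>
    (hA' i).inner ℝ (hA' j)
  have hgd : DifferentiableAt ℝ g x :=
    differentiableAt_pi.2 fun i => differentiableAt_pi.2 fun j => (hgij i j).differentiableAt
  have hgv : ∀ i j, fderiv ℝ g x v i j = inner ℝ (A x (stdVec i)) (fderiv ℝ A x v (stdVec j)) +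
      inner ℝ (fderiv ℝ A x v (stdVec i)) (A x (stdVec j)) := fun i j => by
    have h1 : HasFDerivAt (fun y => g y i j) ((ContinuousLinearMap.proj j).comp
        ((ContinuousLinearMap.proj i).comp (fderiv ℝ g x))) x :=
      hasFDerivAt_pi'.1 (hasFDerivAt_pi'.1 hgd.hasFDerivAt i) j
    have h2 := h1.unique (hgij i j)
    have h3 := congrArg (fun l : X →L[ℝ] ℝ => l v) h2
    simpa using h3
  have hdet : 0 < (gramMatrix (A x)).det := (gramMatrix_posDef hinj).det_pos
  have hdd : DifferentiableAt ℝ (fun y => (gramMatrix (A y)).det) x :=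
    ((contDiff_det (n := 1)).differentiable one_ne_zero _).comp x hgd
  have hJ := fderiv_det hgd (show (Matrix.of (g x)).det ≠ 0 from hdet.ne') v
  have hsym : ((gramMatrix (A x))⁻¹).transpose = (gramMatrix (A x))⁻¹ := by
    rw [Matrix.transpose_nonsing_inv]
    congr 1
    ext i j
    exact real_inner_comm _ _
  have hs := (hdd.hasFDerivAt.sqrt hdet.ne').fderiv
  have e1 : fderiv ℝ (fun y => jac (A y)) x v =
      (1 / (2 * jac (A x))) * fderiv ℝ (fun y => (gramMatrix (A y)).det) x v := by
    have := congrArg (fun l : X →L[ℝ] ℝ => l v) hs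
    simpa [jac] using this
  have e2 : (gramMatrix (A x)).det = jac (A x) ^ 2 := (Real.sq_sqrt hdet.le).symm
  have hjp := jac_pos hinj
  have e3 : ((Matrix.of (g x))⁻¹ * Matrix.of (fderiv ℝ g x v)).trace =
      2 * ∑ i, ∑ j, (gramMatrix (A x))⁻¹ i j *
        inner ℝ (A x (stdVec j)) (fderiv ℝ A x v (stdVec i)) := by
    have e4 : ∀ i j, (gramMatrix (A x))⁻¹ i j = (gramMatrix (A x))⁻¹ j i := fun i j =>
      congrFun (congrFun hsym j) i
    have e5 : ∑ i, ∑ j, (gramMatrix (A x))⁻¹ i j *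
        inner ℝ (A x (stdVec j)) (fderiv ℝ A x v (stdVec i)) =
        ∑ i, ∑ j, (gramMatrix (A x))⁻¹ i j *
        inner ℝ (fderiv ℝ A x v (stdVec j)) (A x (stdVec i)) := by
      rw [Finset.sum_comm]
      refine Finset.sum_congr rfl fun i _ => Finset.sum_congr rfl fun j _ => ?_
      rw [e4, real_inner_comm]
    rw [two_mul]
    nth_rw 2 [e5]
    rw [← Finset.sum_add_distrib]
    simp only [Matrix.trace, Matrix.diag, Matrix.mul_apply, Matrix.of_apply, hgv,
      ← Finset.sum_add_distrib, ← mul_add]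
    rfl
  rw [e1]
  refine (congrArg _ hJ).trans ?_
  rw [e3]
  change 1 / (2 * jac (A x)) * ((gramMatrix (A x)).det * _) = _
  rw [e2]
  field_simp

/-- Cramer's rule: the entries of the inverse are minors divided by a nonvanishing determinant. -/
lemma ContDiffAt.gramMatrix_inv {n : WithTop ℕ∞} {A : X → EuclideanSpace ℝ (Fin d) →L[ℝ] N} {x : X}
    (hA : ContDiffAt ℝ n A x) (hinj : Function.Injective (A x)) (i j : Fin d) :
    ContDiffAt ℝ n (fun y => (_root_.gramMatrix (A y))⁻¹ i j) x := by
  simp only [Matrix.inv_def, Matrix.smul_apply, Ring.inverse_eq_inv', Matrix.adjugate_apply,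
    smul_eq_mul]
  refine ContDiffAt.mul (ContDiffAt.inv (contDiff_det.contDiffAt.comp x hA.gramMatrix)
    (gramMatrix_posDef hinj).det_pos.ne') ?_
  refine (contDiff_det (d := d)).contDiffAt.comp x (f := fun y => (fun k l =>
    (_root_.gramMatrix (A y)).updateRow j (Pi.single i 1) k l : Fin d → Fin d → ℝ)) ?_
  refine contDiffAt_pi.2 fun k => contDiffAt_pi.2 fun l => ?_
  simp only [Matrix.updateRow_apply]
  split_ifs
  · exact contDiffAt_const
  · exact contDiffAt_pi.1 (contDiffAt_pi.1 hA.gramMatrix k) l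

end GramMatrix

/-! ### Chain and product rules for second derivatives. -/

section SecondDerivative

variable {X Y Z : Type*} [NormedAddCommGroup X] [NormedSpace ℝ X] [NormedAddCommGroup Y]
  [NormedSpace ℝ Y] [NormedAddCommGroup Z] [NormedSpace ℝ Z]

lemma ContDiffAt.differentiableAt_fderiv {f : X → Y} {x : X} (hf : ContDiffAt ℝ 2 f x) :
    DifferentiableAt ℝ (fderiv ℝ f) x :=
  (hf.fderiv_right (m := 1) (by norm_num)).differentiableAt one_ne_zero

lemma ContDiffAt.eventually_differentiableAt {f : X → Y} {x : X} (hf : ContDiffAt ℝ 2 f x) :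
    ∀ᶠ y in 𝓝 x, DifferentiableAt ℝ f y := by
  filter_upwards [hf.eventually (by simp)] with y hy using hy.differentiableAt two_ne_zero

lemma fderiv_fderiv_comp {f : Y → Z} {g : X → Y} {x : X} (hf : ContDiffAt ℝ 2 f (g x))
    (hg : ContDiffAt ℝ 2 g x) (a b : X) :
    fderiv ℝ (fderiv ℝ (f ∘ g)) x a b =
      fderiv ℝ (fderiv ℝ f) (g x) (fderiv ℝ g x a) (fderiv ℝ g x b) +
        fderiv ℝ f (g x) (fderiv ℝ (fderiv ℝ g) x a b) := by
  have h1 : fderiv ℝ (f ∘ g) =ᶠ[𝓝 x] fun y => (fderiv ℝ f (g y)).comp (fderiv ℝ g y) := by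
    filter_upwards [hg.eventually_differentiableAt,
      hg.continuousAt.eventually hf.eventually_differentiableAt] with y hy1 hy2
    exact fderiv_comp y hy2 hy1
  have h2 : HasFDerivAt (fun y => fderiv ℝ f (g y)) _ x :=
    hf.differentiableAt_fderiv.hasFDerivAt.comp x (hg.differentiableAt two_ne_zero).hasFDerivAt
  rw [h1.fderiv_eq, (h2.clm_comp hg.differentiableAt_fderiv.hasFDerivAt).fderiv]
  simp [add_comm]

lemma fderiv_fderiv_mul {f g : X → ℝ} {x : X} (hf : ContDiffAt ℝ 2 f x)
    (hg : ContDiffAt ℝ 2 g x) (a b : X) :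
    fderiv ℝ (fderiv ℝ fun y => f y * g y) x a b =
      f x * fderiv ℝ (fderiv ℝ g) x a b + g x * fderiv ℝ (fderiv ℝ f) x a b +
        fderiv ℝ f x a * fderiv ℝ g x b + fderiv ℝ g x a * fderiv ℝ f x b := by
  have h1 : fderiv ℝ (fun y => f y * g y) =ᶠ[𝓝 x]
      fun y => f y • fderiv ℝ g y + g y • fderiv ℝ f y := by
    filter_upwards [hf.eventually_differentiableAt, hg.eventually_differentiableAt] with y hy1 hy2
    exact fderiv_fun_mul hy1 hy2
  have h2 := ((hf.differentiableAt two_ne_zero).hasFDerivAt.fun_smul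
    hg.differentiableAt_fderiv.hasFDerivAt).fun_add
    ((hg.differentiableAt two_ne_zero).hasFDerivAt.fun_smul hf.differentiableAt_fderiv.hasFDerivAt)
  rw [h1.fderiv_eq, HasFDerivAt.fderiv h2]
  simp
  ring

end SecondDerivative

/-! ### The Laplace–Beltrami operator in radial coordinates. -/

section Laplacian

variable {d : ℕ} {N : Type*} [NormedAddCommGroup N] [InnerProductSpace ℝ N]

local notation "𝔼" => EuclideanSpace ℝ (Fin d)

/-- Coordinates around `0` in which `‖G v - G 0‖` is the Euclidean norm. -/
lemma inner_fderiv_of_radial {G : 𝔼 → N} (hG : ContDiffAt ℝ 3 G 0)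
    (hr : ∀ᶠ v in 𝓝 0, ‖G v - G 0‖ = ‖v‖) (a b : 𝔼) :
    inner ℝ (fderiv ℝ G 0 a) (fderiv ℝ G 0 b) = inner ℝ a b ∧
    ∀ c : 𝔼, inner ℝ (fderiv ℝ (fderiv ℝ G) 0 a b) (fderiv ℝ G 0 c) +
      inner ℝ (fderiv ℝ (fderiv ℝ G) 0 b c) (fderiv ℝ G 0 a) +
      inner ℝ (fderiv ℝ (fderiv ℝ G) 0 c a) (fderiv ℝ G 0 b) = 0 := by
  have hG2 : ContDiffAt ℝ 2 G 0 := hG.of_le (by norm_num)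
  have hGd : ∀ᶠ v in 𝓝 (0 : 𝔼), ContDiffAt ℝ 2 G v := hG2.eventually (by simp)
  have sym : ∀ x y, fderiv ℝ (fderiv ℝ G) 0 x y = fderiv ℝ (fderiv ℝ G) 0 y x := fun x y =>
    (hG2.isSymmSndFDerivAt (by simp)) x y
  -- first derivative of the identity
  have h1 : ∀ᶠ v in 𝓝 (0 : 𝔼), ∀ a, inner ℝ (G v - G 0) (fderiv ℝ G v a) = inner ℝ v a := by
    filter_upwards [hr.eventually_nhds, hGd] with v hv hd a
    have e1 : (fun w => inner ℝ (G w - G 0) (G w - G 0)) =ᶠ[𝓝 v] fun w : 𝔼 => inner ℝ w w := by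
      filter_upwards [hv] with w hw
      rw [real_inner_self_eq_norm_sq, real_inner_self_eq_norm_sq, hw]
    have d1 : HasFDerivAt (fun w => G w - G 0) (fderiv ℝ G v) v :=
      (hd.differentiableAt two_ne_zero).hasFDerivAt.sub_const _
    have d2 := (d1.inner ℝ d1).fderiv
    have d3 := ((hasFDerivAt_id (𝕜 := ℝ) v).inner ℝ (hasFDerivAt_id (𝕜 := ℝ) v)).fderiv
    have d4 := e1.fderiv_eq (𝕜 := ℝ)
    rw [d2] at d4
    have d5 := congrArg (fun l : 𝔼 →L[ℝ] ℝ => l a) (d4.trans d3)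
    simp at d5
    linarith [real_inner_comm v a, real_inner_comm (G v - G 0) (fderiv ℝ G v a)]
  -- Second derivative of the identity; at `v = 0` the first inner product vanishes.
  have h2 : ∀ a b, ∀ᶠ v in 𝓝 (0 : 𝔼), inner ℝ (G v - G 0) (fderiv ℝ (fderiv ℝ G) v b a) +
      inner ℝ (fderiv ℝ G v b) (fderiv ℝ G v a) = inner ℝ b a := by
    intro a b
    filter_upwards [h1.eventually_nhds, hGd] with v hv hd
    have e1 : (fun w => inner ℝ (G w - G 0) (fderiv ℝ G w a)) =ᶠ[𝓝 v]
        fun w : 𝔼 => inner ℝ w a := by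
      filter_upwards [hv] with w hw using hw a
    have d1 : HasFDerivAt (fun w => G w - G 0) (fderiv ℝ G v) v :=
      (hd.differentiableAt two_ne_zero).hasFDerivAt.sub_const _
    have d1' : HasFDerivAt (fun w => fderiv ℝ G w a) _ v :=
      hd.differentiableAt_fderiv.hasFDerivAt.clm_apply (hasFDerivAt_const a v)
    have d2 := (d1.inner ℝ d1').fderiv
    have d3 := ((hasFDerivAt_id (𝕜 := ℝ) v).inner ℝ (hasFDerivAt_const a v)).fderiv
    have d4 := e1.fderiv_eq (𝕜 := ℝ)
    rw [d2] at d4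
    have d5 := congrArg (fun l : 𝔼 →L[ℝ] ℝ => l b) (d4.trans d3)
    simpa using d5
  refine ⟨?_, fun c => ?_⟩
  · have := (h2 b a).self_of_nhds
    simpa using this
  -- Third derivative at `0`: the third derivative of `G` is paired with `G 0 - G 0 = 0`, which
  -- leaves the cyclic sum.
  · have e1 := h2 b a
    have d1 : HasFDerivAt (fun w => G w - G 0) (fderiv ℝ G 0) 0 :=
      (hG2.differentiableAt two_ne_zero).hasFDerivAt.sub_const _
    have d1' : ∀ a, HasFDerivAt (fun w => fderiv ℝ G w a) _ 0 := fun a =>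
      hG2.differentiableAt_fderiv.hasFDerivAt.clm_apply (hasFDerivAt_const a 0)
    have hD2 : DifferentiableAt ℝ (fun w => fderiv ℝ (fderiv ℝ G) w a b) 0 := by
      have : DifferentiableAt ℝ (fderiv ℝ (fderiv ℝ G)) 0 :=
        (hG.fderiv_right (m := 2) (by norm_num)).differentiableAt_fderiv
      exact (this.clm_apply (differentiableAt_const a)).clm_apply (differentiableAt_const b)
    have d2 := ((d1.inner ℝ hD2.hasFDerivAt).add ((d1' a).inner ℝ (d1' b))).fderiv
    have e2 : (fun w => inner ℝ (G w - G 0) (fderiv ℝ (fderiv ℝ G) w a b) +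
        inner ℝ (fderiv ℝ G w a) (fderiv ℝ G w b)) =ᶠ[𝓝 0] fun _ => inner ℝ a b := e1
    have d4 := e2.fderiv_eq (𝕜 := ℝ)
    have d5 := congrArg (fun l : 𝔼 →L[ℝ] ℝ => l c) (d2.symm.trans d4)
    simp at d5
    rw [sym c b] at d5
    linarith [real_inner_comm (fderiv ℝ (fderiv ℝ G) 0 a b) (fderiv ℝ G 0 c),
      real_inner_comm (fderiv ℝ (fderiv ℝ G) 0 b c) (fderiv ℝ G 0 a)]

lemma norm_fderiv_of_radial {G : 𝔼 → N} (hG : ContDiffAt ℝ 3 G 0)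
    (hr : ∀ᶠ v in 𝓝 0, ‖G v - G 0‖ = ‖v‖) (a : 𝔼) : ‖fderiv ℝ G 0 a‖ = ‖a‖ := by
  have := (inner_fderiv_of_radial hG hr a a).1
  rw [real_inner_self_eq_norm_sq, real_inner_self_eq_norm_sq] at this
  exact (sq_eq_sq₀ (norm_nonneg _) (norm_nonneg _)).1 this

lemma injective_of_norm_map {A : 𝔼 →L[ℝ] N} (h : ∀ v, ‖A v‖ = ‖v‖) : Function.Injective A :=
  (injective_iff_map_eq_zero A).2 fun v hv => by
    have := h v
    rw [hv, norm_zero] at this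
    exact norm_eq_zero.1 this.symm

/-- As `G` is isometric to first order at `0`, its Jacobian has derivative `∑ᵢ ⟪∂ᵢ∂_b G, ∂ᵢ G⟫`
along `b`. The cyclic third-order identity with two equal arguments trades this sum for `⟪∑ᵢ ∂ᵢ² G,
∂_b G⟫`. Thus the term `2 ∇J · ∇` offsets the tangential part of `∑ᵢ ∂ᵢ² G`. -/
lemma inner_sum_fderiv_of_radial {G : 𝔼 → N} (hG : ContDiffAt ℝ 3 G 0)
    (hr : ∀ᶠ v in 𝓝 0, ‖G v - G 0‖ = ‖v‖) (b : 𝔼) :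
    inner ℝ (∑ i, fderiv ℝ (fderiv ℝ G) 0 (stdVec i) (stdVec i)) (fderiv ℝ G 0 b) =
      -2 * fderiv ℝ (fun v => jac (fderiv ℝ G v)) 0 b := by
  have hG2 : ContDiffAt ℝ 2 G 0 := hG.of_le (by norm_num)
  have sym : ∀ x y, fderiv ℝ (fderiv ℝ G) 0 x y = fderiv ℝ (fderiv ℝ G) 0 y x := fun x y =>
    (hG2.isSymmSndFDerivAt (by simp)) x y
  have hiso := norm_fderiv_of_radial hG hr
  rw [fderiv_jac hG2.differentiableAt_fderiv (injective_of_norm_map hiso), jac_eq_one hiso,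
    gramMatrix_eq_one hiso, inv_one, sum_inner, one_mul, Finset.mul_sum]
  refine Finset.sum_congr rfl fun i _ => ?_
  have h := (inner_fderiv_of_radial hG hr (stdVec i) (stdVec i)).2 b
  rw [sym (stdVec i) b, real_inner_comm] at h
  rw [Finset.sum_eq_single i (fun j _ hj => by simp [Matrix.one_apply_ne hj.symm]) (by simp),
    Matrix.one_apply_eq, one_mul]
  rw [real_inner_comm, real_inner_comm _ (fderiv ℝ G 0 (stdVec i))]
  linarith

/-- The mean curvature vector is normal: for a tangent vector `n = dF(c) ξ`, the Laplacian of the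
height function `⟪F, n⟫` vanishes at `c`. -/
lemma sum_fderiv_jac_gramMatrix_inv {F : 𝔼 → N} {c : 𝔼} (hF : ContDiffAt ℝ 3 F c)
    (hinj : Function.Injective (fderiv ℝ F c)) (ξ : 𝔼) :
    ∑ i, fderiv ℝ (fun u => jac (fderiv ℝ F u) * ∑ j, (gramMatrix (fderiv ℝ F u))⁻¹ i j *
      inner ℝ (fderiv ℝ F u (stdVec j)) (fderiv ℝ F c ξ)) c (stdVec i) = 0 := by
  have hF' : ContDiffAt ℝ 2 (fderiv ℝ F) c := hF.fderiv_right (by norm_num)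
  have hFd : DifferentiableAt ℝ (fderiv ℝ F) c := hF'.differentiableAt two_ne_zero
  have hF2 : ContDiffAt ℝ 2 F c := hF.of_le (by norm_num)
  have sym : ∀ x y, fderiv ℝ (fderiv ℝ F) c x y = fderiv ℝ (fderiv ℝ F) c y x := fun x y =>
    (hF2.isSymmSndFDerivAt (by simp)) x y
  have hdet : ∀ᶠ u in 𝓝 c, (gramMatrix (fderiv ℝ F u)).det ≠ 0 :=
    (contDiff_det.contDiffAt.comp c hF'.gramMatrix).continuousAt.eventually_ne
      (gramMatrix_posDef hinj).det_pos.ne'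
  have hgi : ∀ i j, DifferentiableAt ℝ (fun u => (gramMatrix (fderiv ℝ F u))⁻¹ i j) c :=
    fun i j => (hF'.gramMatrix_inv hinj i j).differentiableAt two_ne_zero
  have hjac : DifferentiableAt ℝ (fun u => jac (fderiv ℝ F u)) c :=
    (hF'.jac hinj).differentiableAt two_ne_zero
  -- With `dF(u) ξ` in place of `dF(c) ξ` the inverse Gram matrix returns `ξ` itself. The correction
  -- contains a factor vanishing at `c`, so at `c` only the derivative of that factor survives.
  have key : ∀ i, ∀ᶠ u in 𝓝 c, ∑ j, (gramMatrix (fderiv ℝ F u))⁻¹ i j *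
      inner ℝ (fderiv ℝ F u (stdVec j)) (fderiv ℝ F c ξ) =
      ξ i - ∑ j, (gramMatrix (fderiv ℝ F u))⁻¹ i j *
      inner ℝ (fderiv ℝ F u (stdVec j)) (fderiv ℝ F u ξ - fderiv ℝ F c ξ) := by
    intro i
    filter_upwards [hdet] with u hu
    have h1 : ∑ j, (gramMatrix (fderiv ℝ F u))⁻¹ i j *
        inner ℝ (fderiv ℝ F u (stdVec j)) (fderiv ℝ F u ξ) = ξ i := by
      have h2 : ∀ j, inner ℝ (fderiv ℝ F u (stdVec j)) (fderiv ℝ F u ξ) =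
          (gramMatrix (fderiv ℝ F u)).mulVec ξ j := fun j => by
        conv_lhs => rw [← sum_smul_stdVec ξ]
        simp [inner_sum, inner_smul_right, Matrix.mulVec, dotProduct, gramMatrix_apply, mul_comm]
      have h3 := congrFun (Matrix.mulVec_mulVec (ξ : Fin d → ℝ) (gramMatrix (fderiv ℝ F u))⁻¹
        (gramMatrix (fderiv ℝ F u))) i
      rw [Matrix.nonsing_inv_mul _ (isUnit_iff_ne_zero.2 hu), Matrix.one_mulVec] at h3
      rw [← h3]
      simp only [h2]
      rfl
    simp only [inner_sub_right, mul_sub, Finset.sum_sub_distrib, h1]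
    ring
  have hsum : ∀ i, HasFDerivAt (fun u => ∑ j, (gramMatrix (fderiv ℝ F u))⁻¹ i j *
      inner ℝ (fderiv ℝ F u (stdVec j)) (fderiv ℝ F c ξ))
      (-∑ j, ((gramMatrix (fderiv ℝ F c))⁻¹ i j) •
        ((innerSL ℝ (fderiv ℝ F c (stdVec j))).comp ((fderiv ℝ (fderiv ℝ F) c).flip ξ))) c := by
    intro i
    have hz : HasFDerivAt (fun u => fderiv ℝ F u ξ - fderiv ℝ F c ξ)
        ((fderiv ℝ (fderiv ℝ F) c).flip ξ) c := by
      have := (hFd.hasFDerivAt.clm_apply (hasFDerivAt_const ξ c)).sub_const (fderiv ℝ F c ξ)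
      simpa using this
    have h4 : ∀ j, HasFDerivAt (fun u => (gramMatrix (fderiv ℝ F u))⁻¹ i j *
        inner ℝ (fderiv ℝ F u (stdVec j)) (fderiv ℝ F u ξ - fderiv ℝ F c ξ))
        (((gramMatrix (fderiv ℝ F c))⁻¹ i j) •
        ((innerSL ℝ (fderiv ℝ F c (stdVec j))).comp ((fderiv ℝ (fderiv ℝ F) c).flip ξ))) c := by
      intro j
      have h5 := (hgi i j).hasFDerivAt.mul
        ((hFd.hasFDerivAt.clm_apply (hasFDerivAt_const (stdVec j) c)).inner ℝ hz)
      refine h5.congr_fderiv ?_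
      ext v
      simp
    refine HasFDerivAt.congr_of_eventuallyEq ?_ (key i)
    exact (HasFDerivAt.fun_sum (u := Finset.univ) fun j _ => h4 j).const_sub (ξ i)
  have hval : ∀ i, ∑ j, (gramMatrix (fderiv ℝ F c))⁻¹ i j *
      inner ℝ (fderiv ℝ F c (stdVec j)) (fderiv ℝ F c ξ) = ξ i := fun i => by
    have := (key i).self_of_nhds
    simpa using this
  have hprod : ∀ i, fderiv ℝ (fun u => jac (fderiv ℝ F u) *
      ∑ j, (gramMatrix (fderiv ℝ F u))⁻¹ i j *
        inner ℝ (fderiv ℝ F u (stdVec j)) (fderiv ℝ F c ξ)) c (stdVec i) =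
      ξ i * fderiv ℝ (fun u => jac (fderiv ℝ F u)) c (stdVec i) -
      jac (fderiv ℝ F c) * ∑ j, (gramMatrix (fderiv ℝ F c))⁻¹ i j *
        inner ℝ (fderiv ℝ F c (stdVec j)) (fderiv ℝ (fderiv ℝ F) c (stdVec i) ξ) := by
    intro i
    rw [(hjac.hasFDerivAt.fun_mul (hsum i)).fderiv]
    simp [hval i]
    ring
  -- The divergence of `J ξ` is `dJ(ξ)`, which equals the sum of the correction terms by the
  -- symmetry of the second derivative of `F`.
  have hJ := fderiv_jac hFd hinj ξ
  have hlin : fderiv ℝ (fun u => jac (fderiv ℝ F u)) c ξ =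
      ∑ i, ξ i * fderiv ℝ (fun u => jac (fderiv ℝ F u)) c (stdVec i) := by
    conv_lhs => rw [← sum_smul_stdVec ξ]
    simp
  rw [Finset.sum_congr rfl fun i _ => hprod i, Finset.sum_sub_distrib, ← hlin, hJ,
    ← Finset.mul_sum, ← mul_sub]
  simp [sym ξ]

/-- Only the shape matters: principal part `gⁱʲ ∂ᵢ∂ⱼ` and a first-order term along a vector `β`
independent of `f`, whose value is never needed. -/
lemma exists_divergence_form {F : 𝔼 → N} {c : 𝔼} (hF : ContDiffAt ℝ 3 F c)
    (hinj : Function.Injective (fderiv ℝ F c)) :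
    ∃ β : 𝔼, ∀ f : 𝔼 → ℝ, ContDiffAt ℝ 2 f c →
      (jac (fderiv ℝ F c))⁻¹ * ∑ i, fderiv ℝ (fun u => jac (fderiv ℝ F u) *
        ∑ j, (gramMatrix (fderiv ℝ F u))⁻¹ i j * fderiv ℝ f u (stdVec j)) c (stdVec i) =
      ∑ i, ∑ j, (gramMatrix (fderiv ℝ F c))⁻¹ i j *
        fderiv ℝ (fderiv ℝ f) c (stdVec i) (stdVec j) + fderiv ℝ f c β := by
  have hF' : ContDiffAt ℝ 2 (fderiv ℝ F) c := hF.fderiv_right (by norm_num)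
  have hgi : ∀ i j, DifferentiableAt ℝ (fun u => (gramMatrix (fderiv ℝ F u))⁻¹ i j) c :=
    fun i j => (hF'.gramMatrix_inv hinj i j).differentiableAt two_ne_zero
  have hjac : DifferentiableAt ℝ (fun u => jac (fderiv ℝ F u)) c :=
    (hF'.jac hinj).differentiableAt two_ne_zero
  refine ⟨(jac (fderiv ℝ F c))⁻¹ • ∑ i, ∑ j, (fderiv ℝ (fun u => jac (fderiv ℝ F u) *
    (gramMatrix (fderiv ℝ F u))⁻¹ i j) c (stdVec i)) • stdVec j, fun f hf => ?_⟩
  have h1 : ∀ i, fderiv ℝ (fun u => jac (fderiv ℝ F u) *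
        ∑ j, (gramMatrix (fderiv ℝ F u))⁻¹ i j * fderiv ℝ f u (stdVec j)) c (stdVec i) =
      jac (fderiv ℝ F c) * (∑ j, (gramMatrix (fderiv ℝ F c))⁻¹ i j *
        fderiv ℝ (fderiv ℝ f) c (stdVec i) (stdVec j)) +
      ∑ j, (fderiv ℝ (fun u => jac (fderiv ℝ F u) *
    (gramMatrix (fderiv ℝ F u))⁻¹ i j) c (stdVec i)) * fderiv ℝ f c (stdVec j) := by
    intro i
    simp only [Finset.mul_sum, ← mul_assoc]
    have h2 : ∀ j, HasFDerivAt (fun u => jac (fderiv ℝ F u) * (gramMatrix (fderiv ℝ F u))⁻¹ i j *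
        fderiv ℝ f u (stdVec j)) _ c := fun j =>
      (hjac.mul (hgi i j)).hasFDerivAt.mul
        (hf.differentiableAt_fderiv.hasFDerivAt.clm_apply (hasFDerivAt_const (stdVec j) c))
    rw [(HasFDerivAt.fun_sum (u := Finset.univ) fun j _ => h2 j).fderiv, ← Finset.sum_add_distrib,
      _root_.sum_apply]
    refine Finset.sum_congr rfl fun j _ => ?_
    simp [mul_comm (fderiv ℝ f c (stdVec j))]
    left
    rfl
  have hj := (jac_pos hinj).ne'
  simp only [h1, Finset.sum_add_distrib, ← Finset.mul_sum, mul_add, inv_mul_cancel_left₀ hj]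
  simp

/-- In coordinates whose Euclidean norm is the extrinsic distance to the centre, the operator
`∑ ∂ᵢ² + 2 ∑ (∂ᵢ J) ∂ᵢ`, with `J` the volume density, is the Laplace–Beltrami operator at the
centre. -/
theorem laplacian_of_radial {F : 𝔼 → N} {f : 𝔼 → ℝ} {Θ : 𝔼 → 𝔼} {c : 𝔼}
    (hF : ContDiffAt ℝ 3 F c) (hf : ContDiffAt ℝ 2 f c) (hΘ : ContDiffAt ℝ 3 Θ 0) (hc : Θ 0 = c)
    (hr : ∀ᶠ v in 𝓝 0, ‖F (Θ v) - F c‖ = ‖v‖) :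
    ∑ i, fderiv ℝ (fderiv ℝ (f ∘ Θ)) 0 (stdVec i) (stdVec i) +
      2 * ∑ i, fderiv ℝ (fun v => jac (fderiv ℝ (F ∘ Θ) v)) 0 (stdVec i) *
        fderiv ℝ (f ∘ Θ) 0 (stdVec i) =
    (jac (fderiv ℝ F c))⁻¹ * ∑ i, fderiv ℝ (fun u => jac (fderiv ℝ F u) *
        ∑ j, (gramMatrix (fderiv ℝ F u))⁻¹ i j * fderiv ℝ f u (stdVec j)) c (stdVec i) := by
  subst hc
  have hG : ContDiffAt ℝ 3 (F ∘ Θ) 0 := hF.comp 0 hΘ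
  have hΘ2 : ContDiffAt ℝ 2 Θ 0 := hΘ.of_le (by norm_num)
  have hF2 : ContDiffAt ℝ 2 F (Θ 0) := hF.of_le (by norm_num)
  have hr' : ∀ᶠ v in 𝓝 0, ‖(F ∘ Θ) v - (F ∘ Θ) 0‖ = ‖v‖ := hr
  have hiso := norm_fderiv_of_radial hG hr'
  set c := Θ 0
  have hchain : fderiv ℝ (F ∘ Θ) 0 = (fderiv ℝ F c).comp (fderiv ℝ Θ 0) :=
    fderiv_comp 0 (hF2.differentiableAt two_ne_zero) (hΘ2.differentiableAt two_ne_zero)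
  -- The composite derivative is isometric, so `dΘ(0)` is injective, hence bijective, and `dF(c)` is
  -- injective too.
  have hinj0 : Function.Injective (fderiv ℝ F c ∘ fderiv ℝ Θ 0) := by
    have := injective_of_norm_map hiso
    rwa [hchain] at this
  have hsurj : Function.Surjective (fderiv ℝ Θ 0) :=
    (LinearMap.injective_iff_surjective (f := (fderiv ℝ Θ 0 : 𝔼 →ₗ[ℝ] 𝔼))).1 hinj0.of_comp
  have hinj : Function.Injective (fderiv ℝ F c) := hinj0.of_comp_right hsurj
  obtain ⟨β, hβ⟩ := exists_divergence_form hF hinj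
  -- the inverse metric
  set b : Matrix (Fin d) (Fin d) ℝ := Matrix.of fun k i => fderiv ℝ Θ 0 (stdVec i) k with hb
  have hbb : (gramMatrix (fderiv ℝ F c))⁻¹ = b * b.transpose := by
    have h1 : b.transpose * gramMatrix (fderiv ℝ F c) * b = 1 := by
      rw [← gramMatrix_eq_one hiso, hchain, gramMatrix_comp]
    have h2 : b * (b.transpose * gramMatrix (fderiv ℝ F c)) = 1 := mul_eq_one_comm.1 h1
    rw [← Matrix.mul_assoc] at h2
    exact Matrix.inv_eq_left_inv h2
  have hquad : ∀ f : 𝔼 → ℝ, ∑ i, ∑ j, (gramMatrix (fderiv ℝ F c))⁻¹ i j *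
      fderiv ℝ (fderiv ℝ f) c (stdVec i) (stdVec j) =
      ∑ k, fderiv ℝ (fderiv ℝ f) c (fderiv ℝ Θ 0 (stdVec k)) (fderiv ℝ Θ 0 (stdVec k)) := by
    intro f
    have h3 : ∀ k, fderiv ℝ (fderiv ℝ f) c (fderiv ℝ Θ 0 (stdVec k)) (fderiv ℝ Θ 0 (stdVec k)) =
        ∑ i, ∑ j, b i k * b j k * fderiv ℝ (fderiv ℝ f) c (stdVec i) (stdVec j) := fun k => by
      conv_lhs => rw [← sum_smul_stdVec (fderiv ℝ Θ 0 (stdVec k))]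
      simp only [map_sum, map_smul, _root_.sum_apply, _root_.smul_apply,
        smul_eq_mul, Finset.mul_sum]
      rw [Finset.sum_comm]
      refine Finset.sum_congr rfl fun i _ => Finset.sum_congr rfl fun j _ => ?_
      simp only [hb, Matrix.of_apply]
      ring
    simp only [h3, hbb, Matrix.mul_apply, Matrix.transpose_apply, Finset.sum_mul]
    rw [Finset.sum_comm' (t' := Finset.univ) (s' := fun _ => Finset.univ) (by simp)]
    rw [Finset.sum_comm]
    conv_rhs => rw [Finset.sum_comm]
    refine Finset.sum_congr rfl fun i _ => ?_
    rw [Finset.sum_comm]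
  -- the first-order coefficient on the left-hand side
  set J : 𝔼 → ℝ := fun v => jac (fderiv ℝ (F ∘ Θ) v) with hJ
  set α : 𝔼 := ∑ i, fderiv ℝ (fderiv ℝ Θ) 0 (stdVec i) (stdVec i) +
    (2 : ℝ) • ∑ i, fderiv ℝ J 0 (stdVec i) • fderiv ℝ Θ 0 (stdVec i) with hα
  have hleft : ∀ f : 𝔼 → ℝ, ContDiffAt ℝ 2 f c →
      ∑ i, fderiv ℝ (fderiv ℝ (f ∘ Θ)) 0 (stdVec i) (stdVec i) +
      2 * ∑ i, fderiv ℝ J 0 (stdVec i) * fderiv ℝ (f ∘ Θ) 0 (stdVec i) =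
      ∑ k, fderiv ℝ (fderiv ℝ f) c (fderiv ℝ Θ 0 (stdVec k)) (fderiv ℝ Θ 0 (stdVec k)) +
        fderiv ℝ f c α := by
    intro f hf
    simp only [fderiv_fderiv_comp hf hΘ2,
      fderiv_comp 0 (hf.differentiableAt two_ne_zero) (hΘ2.differentiableAt two_ne_zero)]
    simp only [hα, Finset.sum_add_distrib, map_add, map_sum, map_smul, smul_eq_mul,
      ContinuousLinearMap.comp_apply]
    ring
  rw [hleft f hf, hβ f hf, hquad]
  -- The principal parts agree, so the two operators differ by the derivative along the fixed vector
  -- `α - β`.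
  suffices α = β by rw [this]
  -- test on the function `⟪F, n⟫` with `n` tangent
  set n := fderiv ℝ F c (α - β) with hn
  set h : 𝔼 → ℝ := fun u => inner ℝ (F u) n with hh
  have hhc : ContDiffAt ℝ 2 h c := hF2.inner ℝ contDiffAt_const
  have hhd : ∀ u v, DifferentiableAt ℝ F u → fderiv ℝ h u v = inner ℝ (fderiv ℝ F u v) n := by
    intro u v hu
    rw [(hu.hasFDerivAt.inner ℝ (hasFDerivAt_const n u)).fderiv]
    simp
  have hR : (jac (fderiv ℝ F c))⁻¹ * ∑ i, fderiv ℝ (fun u => jac (fderiv ℝ F u) *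
        ∑ j, (gramMatrix (fderiv ℝ F u))⁻¹ i j * fderiv ℝ h u (stdVec j)) c (stdVec i) = 0 := by
    rw [mul_eq_zero]
    right
    rw [← sum_fderiv_jac_gramMatrix_inv hF hinj (α - β)]
    refine Finset.sum_congr rfl fun i _ => ?_
    congr 1
    refine Filter.EventuallyEq.fderiv_eq ?_
    filter_upwards [hF2.eventually_differentiableAt] with u hu
    simp only [hhd _ _ hu, hn]
  have hL : ∑ i, fderiv ℝ (fderiv ℝ (h ∘ Θ)) 0 (stdVec i) (stdVec i) +
      2 * ∑ i, fderiv ℝ J 0 (stdVec i) * fderiv ℝ (h ∘ Θ) 0 (stdVec i) = 0 := by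
    obtain ⟨b', hb'⟩ := hsurj (α - β)
    have hG2 : ContDiffAt ℝ 2 (F ∘ Θ) 0 := hG.of_le (by norm_num)
    have hn' : n = fderiv ℝ (F ∘ Θ) 0 b' := by rw [hchain, hn, ← hb']; rfl
    have e0 : h ∘ Θ = (innerSL ℝ n) ∘ (F ∘ Θ) := by
      funext v; simp [hh, real_inner_comm]
    have e1 : ∀ i, fderiv ℝ (fderiv ℝ (h ∘ Θ)) 0 (stdVec i) (stdVec i) =
        inner ℝ (fderiv ℝ (fderiv ℝ (F ∘ Θ)) 0 (stdVec i) (stdVec i)) n := fun i => by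
      rw [e0, fderiv_fderiv_comp (innerSL ℝ n).contDiff.contDiffAt hG2]
      have : fderiv ℝ (innerSL ℝ n) = fun _ => innerSL ℝ n := by
        funext x; exact (innerSL ℝ n).fderiv
      have h0 : fderiv ℝ (fderiv ℝ (innerSL ℝ n)) (( F ∘ Θ) 0) = 0 := by rw [this]; simp
      rw [h0, this, innerSL_apply_apply, real_inner_comm]
      exact zero_add _
    have e2 : ∀ i, fderiv ℝ (h ∘ Θ) 0 (stdVec i) = inner ℝ b' (stdVec i) := fun i => by
      rw [e0, fderiv_comp 0 (innerSL ℝ n).differentiableAt (hG2.differentiableAt two_ne_zero),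
        ContinuousLinearMap.fderiv, ContinuousLinearMap.comp_apply, innerSL_apply_apply, hn',
        (inner_fderiv_of_radial hG hr' _ _).1]
    have e3 : ∑ i, fderiv ℝ J 0 (stdVec i) * inner ℝ b' (stdVec i) = fderiv ℝ J 0 b' := by
      conv_rhs => rw [← sum_smul_stdVec b']
      simp [mul_comm, EuclideanSpace.inner_single_right]
    simp only [e1, e2, e3]
    rw [← sum_inner, hn', inner_sum_fderiv_of_radial hG hr']
    ring
  have hdiff : fderiv ℝ h c α = fderiv ℝ h c β := by
    have a1 := hleft h hhc
    have a2 := hβ h hhc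
    rw [hL] at a1
    rw [hR, hquad] at a2
    linarith
  -- Both operators annihilate the test function `h`, so `0 = dh(α - β) = ‖n‖²`.
  have hn0 : n = 0 := by
    have a1 := hhd c (α - β) (hF2.differentiableAt two_ne_zero)
    rw [map_sub, hdiff, sub_self] at a1
    exact inner_self_eq_zero.1 (a1.symm)
  exact sub_eq_zero.1 ((injective_iff_map_eq_zero (fderiv ℝ F c)).1 hinj _ hn0)

end Laplacian

/-! ### Moments of the kernel and the Euclidean expansion. -/

section KernelIntegrals

variable {d : ℕ} {K : ℝ → ℝ}

local notation "𝔼" => EuclideanSpace ℝ (Fin d)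

/-- From `exp x ≥ xᵐ / m!`. Polynomial decay of every order serves both for the moments and for the
tails. -/
lemma IsKernelFunction.exists_le_div_pow (hK : IsKernelFunction d K) (m : ℕ) :
    ∃ C : ℝ, 0 ≤ C ∧ ∀ t, 0 ≤ t → K t ≤ C / (1 + t) ^ m := by
  obtain ⟨C, c, hc, h⟩ := hK.exp_decay
  have hC : 0 ≤ C := by
    have := (hK.nonneg 0 le_rfl).trans (h 0 le_rfl)
    simpa using this
  refine ⟨C * (Real.exp c * (m.factorial / c ^ m)), by positivity, fun t ht => ?_⟩
  refine (h t ht).trans ?_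
  rw [mul_div_assoc]
  refine mul_le_mul_of_nonneg_left ?_ hC
  have h1 := Real.pow_div_factorial_le_exp (c * (1 + t)) (by positivity) m
  rw [mul_pow, div_le_iff₀ (by positivity)] at h1
  rw [le_div_iff₀ (by positivity), ← mul_div_assoc, le_div_iff₀ (by positivity)]
  have h2 : Real.exp (c * (1 + t)) = Real.exp c * Real.exp (c * t) := by
    rw [← Real.exp_add]; ring_nf
  have h3 : Real.exp (-c * t) * Real.exp (c * t) = 1 := by
    rw [← Real.exp_add]; simp
  calc Real.exp (-c * t) * (1 + t) ^ m * c ^ m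
      = Real.exp (-c * t) * (c ^ m * (1 + t) ^ m) := by ring
    _ ≤ Real.exp (-c * t) * (Real.exp c * Real.exp (c * t) * m.factorial) := by
        rw [← h2]; gcongr
    _ = (Real.exp (-c * t) * Real.exp (c * t)) * (Real.exp c * m.factorial) := by ring
    _ = Real.exp c * m.factorial := by rw [h3, one_mul]

lemma IsKernelFunction.continuous_comp (hK : IsKernelFunction d K) {X : Type*} [TopologicalSpace X]
    {r : X → ℝ} (hr : Continuous r) (h0 : ∀ x, 0 ≤ r x) : Continuous fun x => K (r x) :=
  hK.contDiffOn.continuousOn.comp_continuous hr h0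

lemma IsKernelFunction.integrable_norm_pow_mul (hK : IsKernelFunction d K) (m : ℕ) :
    Integrable fun v : 𝔼 => ‖v‖ ^ m * K ‖v‖ := by
  -- `m` powers absorb the weight `‖v‖ᵐ`; the other `d + 1` make the bound integrable on `ℝᵈ`.
  obtain ⟨C, hC, h⟩ := hK.exists_le_div_pow (m + d + 1)
  have h1 : Integrable fun v : 𝔼 => C * (1 + ‖v‖) ^ (-((d : ℝ) + 1)) :=
    (integrable_one_add_norm (by simp)).const_mul C
  refine h1.mono' (Continuous.aestronglyMeasurable ((continuous_norm.pow m).mul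
    (hK.continuous_comp continuous_norm fun v => norm_nonneg v))) (.of_forall fun v => ?_)
  have h2 := h ‖v‖ (norm_nonneg v)
  rw [Real.norm_of_nonneg (mul_nonneg (by positivity) (hK.nonneg _ (norm_nonneg v)))]
  have h3 : (1 + ‖v‖) ^ (-((d : ℝ) + 1)) = 1 / (1 + ‖v‖) ^ (d + 1) := by
    rw [Real.rpow_neg (by positivity), one_div]
    norm_cast
  rw [h3]
  calc ‖v‖ ^ m * K ‖v‖ ≤ (1 + ‖v‖) ^ m * (C / (1 + ‖v‖) ^ (m + d + 1)) := by
        gcongr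
        · exact hK.nonneg _ (norm_nonneg v)
        · linarith
    _ = C * (1 / (1 + ‖v‖) ^ (d + 1)) := by
        rw [add_assoc, pow_add]
        field_simp

lemma IsKernelFunction.integrable (hK : IsKernelFunction d K) :
    Integrable fun v : 𝔼 => K ‖v‖ := by
  simpa using hK.integrable_norm_pow_mul 0

lemma IsKernelFunction.integral_eq_one (hK : IsKernelFunction d K) :
    ∫ v : 𝔼, K ‖v‖ = 1 := by
  simpa [kernelMoment] using hK.normalized

lemma kernelMoment_one_two_zero : kernelMoment d K 1 2 0 = ∫ v : 𝔼, ‖v‖ ^ 2 * K ‖v‖ := by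
  simp [kernelMoment]

lemma IsKernelFunction.integrable_mul_of_le (hK : IsKernelFunction d K) {f : 𝔼 → ℝ}
    (hf : Continuous f) {C : ℝ} {m : ℕ} (h : ∀ v, |f v| ≤ C * ‖v‖ ^ m) :
    Integrable fun v : 𝔼 => K ‖v‖ * f v := by
  refine ((hK.integrable_norm_pow_mul m).const_mul C).mono' (Continuous.aestronglyMeasurable
    ((hK.continuous_comp continuous_norm fun v => norm_nonneg v).mul hf)) (.of_forall fun v => ?_)
  rw [norm_mul, Real.norm_of_nonneg (hK.nonneg _ (norm_nonneg v)), Real.norm_eq_abs]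
  calc K ‖v‖ * |f v| ≤ K ‖v‖ * (C * ‖v‖ ^ m) :=
        mul_le_mul_of_nonneg_left (h v) (hK.nonneg _ (norm_nonneg v))
    _ = C * (‖v‖ ^ m * K ‖v‖) := by ring

/-- The reflection of the `i`-th coordinate preserves `‖v‖` and changes the sign of the integrand.
-/
lemma integral_mul_coord_mul_coord_of_ne (i j : Fin d) (hij : i ≠ j) :
    ∫ v : 𝔼, K ‖v‖ * (v i * v j) = 0 := by
  let e : 𝔼 ≃ₗᵢ[ℝ] 𝔼 := LinearIsometryEquiv.piLpCongrRight 2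
    fun k => if k = i then LinearIsometryEquiv.neg ℝ else LinearIsometryEquiv.refl ℝ ℝ
  have hi : ∀ v : 𝔼, e v i = - v i := fun v => by simp [e]
  have hj : ∀ v : 𝔼, e v j = v j := fun v => by simp [e, hij.symm]
  have h := e.measurePreserving.integral_comp e.toHomeomorph.measurableEmbedding
    (fun v : 𝔼 => K ‖v‖ * (v i * v j))
  have h2 : ∀ v : 𝔼, K ‖e v‖ * (e v i * e v j) = -(K ‖v‖ * (v i * v j)) := fun v => by
    rw [hi, hj, e.norm_map]; ring
  have h3 : ∫ v : 𝔼, K ‖e v‖ * (e v i * e v j) = ∫ v : 𝔼, K ‖v‖ * (v i * v j) := h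
  simp only [h2, integral_neg] at h3
  linarith

/-- Swapping two coordinates is an isometry, so all `d` coordinates contribute equally, and together
they give the second moment. -/
lemma integral_mul_coord_sq (hd : 1 ≤ d) (hK : IsKernelFunction d K) (i : Fin d) :
    ∫ v : 𝔼, K ‖v‖ * (v i * v i) = kernelMoment d K 1 2 0 / d := by
  have hint : ∀ j : Fin d, Integrable fun v : 𝔼 => K ‖v‖ * (v j * v j) := fun j => by
    refine hK.integrable_mul_of_le (C := 1) (m := 2) (by fun_prop) fun v => ?_
    have h1 := PiLp.norm_apply_le v j
    rw [abs_mul, one_mul, sq]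
    exact mul_self_le_mul_self (abs_nonneg _) h1
  have heq : ∀ j : Fin d, ∫ v : 𝔼, K ‖v‖ * (v j * v j) = ∫ v : 𝔼, K ‖v‖ * (v i * v i) := by
    intro j
    let e : 𝔼 ≃ₗᵢ[ℝ] 𝔼 := LinearIsometryEquiv.piLpCongrLeft 2 ℝ ℝ (Equiv.swap i j)
    have hi : ∀ v : 𝔼, e v i = v j := fun v => by
      simp [e, LinearIsometryEquiv.piLpCongrLeft_apply, Equiv.piCongrLeft'_apply]
    have h := e.measurePreserving.integral_comp e.toHomeomorph.measurableEmbedding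
      (fun v : 𝔼 => K ‖v‖ * (v i * v i))
    rw [← h]
    refine integral_congr_ae (.of_forall fun v => ?_)
    simp only [hi, e.norm_map]
  have hsum : ∑ j : Fin d, ∫ v : 𝔼, K ‖v‖ * (v j * v j) = kernelMoment d K 1 2 0 := by
    rw [← integral_finsetSum _ fun j _ => hint j, kernelMoment_one_two_zero]
    refine integral_congr_ae (.of_forall fun v => ?_)
    simp only [EuclideanSpace.norm_sq_eq, Real.norm_eq_abs, sq_abs, Finset.sum_mul]
    exact Finset.sum_congr rfl fun j _ => by ring
  simp only [heq, Finset.sum_const, Finset.card_univ, Fintype.card_fin, nsmul_eq_mul] at hsum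
  rw [← hsum]
  have : (d : ℝ) ≠ 0 := by positivity
  field_simp

lemma integral_mul_quadratic (hd : 1 ≤ d) (hK : IsKernelFunction d K) (q : 𝔼 →L[ℝ] 𝔼 →L[ℝ] ℝ) :
    ∫ v : 𝔼, K ‖v‖ * q v v = kernelMoment d K 1 2 0 / d * ∑ i, q (stdVec i) (stdVec i) := by
  have hint : ∀ i j : Fin d, Integrable fun v : 𝔼 => K ‖v‖ * (v i * v j) := fun i j => by
    refine hK.integrable_mul_of_le (C := 1) (m := 2) (by fun_prop) fun v => ?_
    rw [abs_mul, one_mul, sq]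
    exact mul_le_mul (PiLp.norm_apply_le v i) (PiLp.norm_apply_le v j) (abs_nonneg _)
      (norm_nonneg _)
  have h1 : ∀ v : 𝔼, K ‖v‖ * q v v =
      ∑ i, ∑ j, q (stdVec i) (stdVec j) * (K ‖v‖ * (v i * v j)) := fun v => by
    have h2 : q v v = q (∑ i, v i • stdVec i) (∑ j, v j • stdVec j) := by
      rw [sum_smul_stdVec]
    rw [h2]
    simp only [map_sum, map_smul, _root_.sum_apply, _root_.smul_apply, smul_eq_mul, Finset.mul_sum]
    rw [Finset.sum_comm]
    exact Finset.sum_congr rfl fun i _ => Finset.sum_congr rfl fun j _ => by ring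
  simp only [h1]
  rw [integral_finsetSum _ fun i _ => integrable_finsetSum _ fun j _ => (hint i j).const_mul _,
    Finset.mul_sum]
  refine Finset.sum_congr rfl fun i _ => ?_
  rw [integral_finsetSum _ fun j _ => (hint i j).const_mul _, Finset.sum_eq_single i]
  · rw [integral_const_mul, integral_mul_coord_sq hd hK]; ring
  · intro j _ hj
    rw [integral_const_mul, integral_mul_coord_mul_coord_of_ne _ _ hj.symm, mul_zero]
  · simp

lemma IsKernelFunction.integrable_prod_norm_pow (hK : IsKernelFunction d K) (m : ℕ) :
    Integrable fun z : 𝔼 × 𝔼 => K ‖z.1‖ * K ‖z.2‖ * ‖z‖ ^ m := by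
  have h1 : Integrable fun z : 𝔼 × 𝔼 => (‖z.1‖ ^ m * K ‖z.1‖) * (‖z.2‖ ^ 0 * K ‖z.2‖) :=
    (hK.integrable_norm_pow_mul m).mul_prod (hK.integrable_norm_pow_mul 0)
  have h2 : Integrable fun z : 𝔼 × 𝔼 => (‖z.1‖ ^ 0 * K ‖z.1‖) * (‖z.2‖ ^ m * K ‖z.2‖) :=
    (hK.integrable_norm_pow_mul 0).mul_prod (hK.integrable_norm_pow_mul m)
  refine (h1.add h2).mono' (Continuous.aestronglyMeasurable
    (((hK.continuous_comp (by fun_prop) fun z => norm_nonneg _).mul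
    (hK.continuous_comp (by fun_prop) fun z => norm_nonneg _)).mul (by fun_prop)))
    (.of_forall fun z => ?_)
  have k1 := hK.nonneg _ (norm_nonneg z.1)
  have k2 := hK.nonneg _ (norm_nonneg z.2)
  rw [Real.norm_of_nonneg (by positivity)]
  have h3 : ‖z‖ ^ m ≤ ‖z.1‖ ^ m + ‖z.2‖ ^ m := by
    rw [Prod.norm_def]
    rcases max_cases ‖z.1‖ ‖z.2‖ with h | h <;> rw [h.1]
    · linarith [pow_nonneg (norm_nonneg z.2) m]
    · linarith [pow_nonneg (norm_nonneg z.1) m]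
  calc K ‖z.1‖ * K ‖z.2‖ * ‖z‖ ^ m ≤ K ‖z.1‖ * K ‖z.2‖ * (‖z.1‖ ^ m + ‖z.2‖ ^ m) := by gcongr
    _ = _ := by simp only [Pi.add_apply]; ring

/-- Negating the first variable alone preserves the weight, so averaging over this reflection
removes the mixed terms of `q`. -/
lemma integral_prod_mul_quadratic (hd : 1 ≤ d) (hK : IsKernelFunction d K)
    (q : 𝔼 × 𝔼 →L[ℝ] 𝔼 × 𝔼 →L[ℝ] ℝ) :
    ∫ z : 𝔼 × 𝔼, K ‖z.1‖ * K ‖z.2‖ * q z z = kernelMoment d K 1 2 0 / d *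
      (∑ i, q (stdVec i, 0) (stdVec i, 0) + ∑ i, q (0, stdVec i) (0, stdVec i)) := by
  let q1 : 𝔼 →L[ℝ] 𝔼 →L[ℝ] ℝ :=
    q.bilinearComp (ContinuousLinearMap.inl ℝ 𝔼 𝔼) (ContinuousLinearMap.inl ℝ 𝔼 𝔼)
  let q2 : 𝔼 →L[ℝ] 𝔼 →L[ℝ] ℝ :=
    q.bilinearComp (ContinuousLinearMap.inr ℝ 𝔼 𝔼) (ContinuousLinearMap.inr ℝ 𝔼 𝔼)
  have hint : Integrable fun z : 𝔼 × 𝔼 => K ‖z.1‖ * K ‖z.2‖ * q z z := by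
    refine ((hK.integrable_prod_norm_pow 2).const_mul ‖q‖).mono' (Continuous.aestronglyMeasurable
      (((hK.continuous_comp (by fun_prop) fun z => norm_nonneg _).mul
      (hK.continuous_comp (by fun_prop) fun z => norm_nonneg _)).mul (by fun_prop)))
      (.of_forall fun z => ?_)
    have k1 := hK.nonneg _ (norm_nonneg z.1)
    have k2 := hK.nonneg _ (norm_nonneg z.2)
    rw [norm_mul, Real.norm_of_nonneg (by positivity)]
    have := q.le_opNorm₂ z z
    calc K ‖z.1‖ * K ‖z.2‖ * ‖q z z‖ ≤ K ‖z.1‖ * K ‖z.2‖ * (‖q‖ * ‖z‖ * ‖z‖) := by gcongr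
      _ = _ := by ring
  have hmp : MeasurePreserving (fun z : 𝔼 × 𝔼 => (-z.1, z.2)) volume volume :=
    (Measure.measurePreserving_neg (volume : Measure 𝔼)).prod (MeasurePreserving.id volume)
  have hme : MeasurableEmbedding (fun z : 𝔼 × 𝔼 => (-z.1, z.2)) :=
    ((Homeomorph.neg 𝔼).prodCongr (Homeomorph.refl 𝔼)).measurableEmbedding
  have h1 : ∫ z : 𝔼 × 𝔼, K ‖z.1‖ * K ‖z.2‖ * q (-z.1, z.2) (-z.1, z.2) =
      ∫ z : 𝔼 × 𝔼, K ‖z.1‖ * K ‖z.2‖ * q z z := by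
    have := hmp.integral_comp hme (fun z : 𝔼 × 𝔼 => K ‖z.1‖ * K ‖z.2‖ * q z z)
    simpa only [norm_neg] using this
  have hint' : Integrable fun z : 𝔼 × 𝔼 => K ‖z.1‖ * K ‖z.2‖ * q (-z.1, z.2) (-z.1, z.2) := by
    have := (hmp.integrable_comp_emb hme).2 hint
    refine this.congr (.of_forall fun z => ?_)
    simp
  have hq1 : Integrable fun v : 𝔼 => K ‖v‖ * q1 v v :=
    hK.integrable_mul_of_le (C := ‖q1‖) (m := 2) (by fun_prop) fun v => by
      simpa [sq, mul_assoc] using q1.le_opNorm₂ v v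
  have hq2 : Integrable fun v : 𝔼 => K ‖v‖ * q2 v v :=
    hK.integrable_mul_of_le (C := ‖q2‖) (m := 2) (by fun_prop) fun v => by
      simpa [sq, mul_assoc] using q2.le_opNorm₂ v v
  have h2 : ∀ z : 𝔼 × 𝔼, K ‖z.1‖ * K ‖z.2‖ * q z z +
      K ‖z.1‖ * K ‖z.2‖ * q (-z.1, z.2) (-z.1, z.2) =
      2 * ((K ‖z.1‖ * q1 z.1 z.1) * K ‖z.2‖ + K ‖z.1‖ * (K ‖z.2‖ * q2 z.2 z.2)) := by
    intro z
    have e1 : z = ContinuousLinearMap.inl ℝ 𝔼 𝔼 z.1 + ContinuousLinearMap.inr ℝ 𝔼 𝔼 z.2 := by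
      simp
    have e2 : ((-z.1, z.2) : 𝔼 × 𝔼) =
        -ContinuousLinearMap.inl ℝ 𝔼 𝔼 z.1 + ContinuousLinearMap.inr ℝ 𝔼 𝔼 z.2 := by
      simp
    have e3 : q z z = q1 z.1 z.1 + q (ContinuousLinearMap.inl ℝ 𝔼 𝔼 z.1)
        (ContinuousLinearMap.inr ℝ 𝔼 𝔼 z.2) + q (ContinuousLinearMap.inr ℝ 𝔼 𝔼 z.2)
        (ContinuousLinearMap.inl ℝ 𝔼 𝔼 z.1) + q2 z.2 z.2 := by
      conv_lhs => rw [e1]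
      simp only [map_add, _root_.add_apply, q1, q2, ContinuousLinearMap.bilinearComp_apply]
      ring
    have e4 : q (-z.1, z.2) (-z.1, z.2) = q1 z.1 z.1 - q (ContinuousLinearMap.inl ℝ 𝔼 𝔼 z.1)
        (ContinuousLinearMap.inr ℝ 𝔼 𝔼 z.2) - q (ContinuousLinearMap.inr ℝ 𝔼 𝔼 z.2)
        (ContinuousLinearMap.inl ℝ 𝔼 𝔼 z.1) + q2 z.2 z.2 := by
      rw [e2]
      simp only [map_add, map_neg, _root_.add_apply, _root_.neg_apply, q1, q2,
        ContinuousLinearMap.bilinearComp_apply]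
      ring
    rw [e3, e4]
    ring
  have h3 := integral_add hint hint'
  rw [h1] at h3
  simp only [h2] at h3
  have i1 : Integrable fun z : 𝔼 × 𝔼 => (K ‖z.1‖ * q1 z.1 z.1) * K ‖z.2‖ :=
    hq1.mul_prod hK.integrable
  have i2 : Integrable fun z : 𝔼 × 𝔼 => K ‖z.1‖ * (K ‖z.2‖ * q2 z.2 z.2) :=
    hK.integrable.mul_prod hq2
  rw [integral_const_mul, integral_add i1 i2] at h3
  have h4 : ∫ z : 𝔼 × 𝔼, (K ‖z.1‖ * q1 z.1 z.1) * K ‖z.2‖ =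
      (∫ v : 𝔼, K ‖v‖ * q1 v v) * ∫ v : 𝔼, K ‖v‖ :=
    integral_prod_mul (fun v : 𝔼 => K ‖v‖ * q1 v v) (fun v : 𝔼 => K ‖v‖)
  have h5 : ∫ z : 𝔼 × 𝔼, K ‖z.1‖ * (K ‖z.2‖ * q2 z.2 z.2) =
      (∫ v : 𝔼, K ‖v‖) * ∫ v : 𝔼, K ‖v‖ * q2 v v :=
    integral_prod_mul (fun v : 𝔼 => K ‖v‖) (fun v : 𝔼 => K ‖v‖ * q2 v v)
  rw [h4, h5, hK.integral_eq_one, integral_mul_quadratic hd hK, integral_mul_quadratic hd hK] at h3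
  simp only [q1, q2, ContinuousLinearMap.bilinearComp_apply, ContinuousLinearMap.inl_apply,
    ContinuousLinearMap.inr_apply] at h3
  linarith

/-- Second-order expansion of the double kernel average of a function whose even part agrees with
its quadratic Taylor polynomial up to fourth order. -/
theorem kernel_average_expansion (hd : 1 ≤ d) (hK : IsKernelFunction d K) :
    ∃ C : ℝ, 0 ≤ C ∧ ∀ (H : 𝔼 × 𝔼 → ℝ) (a A : ℝ) (q : 𝔼 × 𝔼 →L[ℝ] 𝔼 × 𝔼 →L[ℝ] ℝ),
      Measurable H → (∃ b, ∀ z, |H z| ≤ b) →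
      (∀ z, |H z + H (-z) - 2 * a - q z z| ≤ A * ‖z‖ ^ 4) → ∀ s : ℝ, 0 < s →
      |(∫ z : 𝔼 × 𝔼, K ‖z.1‖ * K ‖z.2‖ * H (s • z)) - (a + s ^ 2 * kernelMoment d K 1 2 0 / (2 * d) *
        (∑ i, q (stdVec i, 0) (stdVec i, 0) + ∑ i, q (0, stdVec i) (0, stdVec i)))| ≤
      C * A * s ^ 4 := by
  set w : 𝔼 × 𝔼 → ℝ := fun z => K ‖z.1‖ * K ‖z.2‖ with hw
  have hw0 : ∀ z, 0 ≤ w z := fun z =>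
    mul_nonneg (hK.nonneg _ (norm_nonneg _)) (hK.nonneg _ (norm_nonneg _))
  have hwc : Continuous w := (hK.continuous_comp (by fun_prop) fun z => norm_nonneg _).mul
      (hK.continuous_comp (by fun_prop) fun z => norm_nonneg _)
  have hw1 : ∫ z, w z = 1 := by
    have : ∫ z : 𝔼 × 𝔼, K ‖z.1‖ * K ‖z.2‖ = (∫ v : 𝔼, K ‖v‖) * ∫ v : 𝔼, K ‖v‖ :=
      integral_prod_mul (fun v : 𝔼 => K ‖v‖) (fun v : 𝔼 => K ‖v‖)
    rw [hw, this, hK.integral_eq_one, one_mul]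
  have hwi : Integrable w := by simpa using hK.integrable_prod_norm_pow 0
  -- The fourth moment of the weight integrates the remainder; the factor 1/2 comes from passing to
  -- the even part.
  refine ⟨1 / 2 * ∫ z : 𝔼 × 𝔼, w z * ‖z‖ ^ 4, ?_, ?_⟩
  · exact mul_nonneg (by norm_num) (integral_nonneg fun z => mul_nonneg (hw0 z) (by positivity))
  intro H a A q hHm ⟨b, hb⟩ hA s hs
  have hH1 : Integrable fun z => w z * H (s • z) := by
    refine (hwi.mul_const b).mono' ?_ (.of_forall fun z => ?_)
    · exact (hwc.measurable.mul (hHm.comp (measurable_const_smul s))).aestronglyMeasurable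
    · rw [norm_mul, Real.norm_of_nonneg (hw0 z)]
      exact mul_le_mul_of_nonneg_left (hb _) (hw0 z)
  have hmp : MeasurePreserving (fun z : 𝔼 × 𝔼 => -z) volume volume :=
    (Measure.measurePreserving_neg (volume : Measure 𝔼)).prod
      (Measure.measurePreserving_neg (volume : Measure 𝔼))
  have hme : MeasurableEmbedding (fun z : 𝔼 × 𝔼 => -z) := (Homeomorph.neg _).measurableEmbedding
  -- The weight is even, so `H` may be replaced by `(H z + H (-z)) / 2`.
  have hH2 : ∫ z, w z * H (-(s • z)) = ∫ z, w z * H (s • z) := by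
    rw [← hmp.integral_comp hme]
    simp [hw]
  have hH2i : Integrable fun z => w z * H (-(s • z)) := by
    refine ((hmp.integrable_comp_emb hme).2 hH1).congr (.of_forall fun z => ?_)
    simp [hw]
  have hqi : Integrable fun z => w z * q z z := by
    refine ((hK.integrable_prod_norm_pow 2).const_mul ‖q‖).mono' (Continuous.aestronglyMeasurable
      (hwc.mul (by fun_prop))) (.of_forall fun z => ?_)
    rw [norm_mul, Real.norm_of_nonneg (hw0 z)]
    calc w z * ‖q z z‖ ≤ w z * (‖q‖ * ‖z‖ * ‖z‖) :=
          mul_le_mul_of_nonneg_left (q.le_opNorm₂ z z) (hw0 z)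
      _ = _ := by simp only [hw]; ring
  have e1 : (∫ z : 𝔼 × 𝔼, w z * H (s • z)) - (a + s ^ 2 * kernelMoment d K 1 2 0 / (2 * d) *
        (∑ i, q (stdVec i, 0) (stdVec i, 0) + ∑ i, q (0, stdVec i) (0, stdVec i))) =
      1 / 2 * ∫ z : 𝔼 × 𝔼, w z * (H (s • z) + H (-(s • z)) - 2 * a - q (s • z) (s • z)) := by
    have e2 : ∀ z, w z * (H (s • z) + H (-(s • z)) - 2 * a - q (s • z) (s • z)) =
        w z * H (s • z) + w z * H (-(s • z)) - w z * (2 * a) - s ^ 2 * (w z * q z z) := by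
      intro z; simp; ring
    simp only [e2]
    rw [integral_sub (f := fun z => w z * H (s • z) + w z * H (-(s • z)) - w z * (2 * a))
        ((hH1.add hH2i).sub (hwi.mul_const _)) (hqi.const_mul _),
      integral_sub (f := fun z => w z * H (s • z) + w z * H (-(s • z)))
        (hH1.add hH2i) (hwi.mul_const _), integral_add hH1 hH2i, hH2,
      integral_mul_const, integral_const_mul, integral_prod_mul_quadratic hd hK q, hw1]
    ring
  rw [e1, abs_mul, abs_of_pos (by norm_num : (0 : ℝ) < 1 / 2)]
  have e3 : |∫ z : 𝔼 × 𝔼, w z * (H (s • z) + H (-(s • z)) - 2 * a - q (s • z) (s • z))| ≤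
      ∫ z : 𝔼 × 𝔼, A * s ^ 4 * (w z * ‖z‖ ^ 4) := by
    rw [← Real.norm_eq_abs]
    refine norm_integral_le_of_norm_le ((hK.integrable_prod_norm_pow 4).const_mul _)
      (.of_forall fun z => ?_)
    rw [norm_mul, Real.norm_of_nonneg (hw0 z), Real.norm_eq_abs]
    have := mul_le_mul_of_nonneg_left (hA (s • z)) (hw0 z)
    rw [norm_smul, mul_pow, Real.norm_of_nonneg hs.le] at this
    linarith
  rw [integral_const_mul] at e3
  linarith

end KernelIntegrals

/-! ### Smooth dependence of integrals on parameters. -/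

section ParametricIntegral

universe u

/-- Differentiating under the integral gives an integral of the same kind with values in `X →L[ℝ]
Y`. The induction therefore runs over all `Y`, and `X` and `Y` share a universe so that the space of
linear maps stays in it. -/
lemma contDiff_parametric_intervalIntegral {X : Type u} [NormedAddCommGroup X] [NormedSpace ℝ X]
    [ProperSpace X] (n : ℕ) : ∀ {Y : Type u} [NormedAddCommGroup Y] [NormedSpace ℝ Y]
    [CompleteSpace Y] {G : X × ℝ → Y}, ContDiff ℝ n G →
      ContDiff ℝ n fun x => ∫ t in (0 : ℝ)..1, G (x, t) := by
  induction n with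
  | zero =>
    intro Y _ _ _ G hG
    rw [CharP.cast_eq_zero, contDiff_zero] at hG ⊢
    exact intervalIntegral.continuous_parametric_intervalIntegral_of_continuous'
      (f := fun x t => G (x, t)) hG 0 1
  | succ n ih =>
    intro Y _ _ _ G hG
    have hG' : ContDiff ℝ n fun z => (fderiv ℝ G z).comp (ContinuousLinearMap.inl ℝ X ℝ) :=
      (hG.fderiv_right (m := n) (by norm_cast)).clm_comp contDiff_const
    have hGc := hG.continuous
    have hG'c := hG'.continuous
    rw [Nat.cast_add, Nat.cast_one, contDiff_succ_iff_hasFDerivAt]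
    refine ⟨_, ih hG', fun x => ?_⟩
    obtain ⟨C, hC⟩ := ((isCompact_closedBall x 1).prod (isCompact_Icc (a := (0 : ℝ)) (b := 1))
      ).exists_bound_of_continuousOn hG'c.continuousOn
    refine intervalIntegral.hasFDerivAt_integral_of_dominated_of_fderiv_le
      (F := fun x t => G (x, t))
      (F' := fun x t => (fderiv ℝ G (x, t)).comp (ContinuousLinearMap.inl ℝ X ℝ))
      (bound := fun _ => C) (Metric.closedBall_mem_nhds x one_pos) ?_ ?_ ?_ ?_ ?_ ?_
    · exact .of_forall fun y => Continuous.aestronglyMeasurable (by fun_prop)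
    · exact Continuous.intervalIntegrable (by fun_prop) _ _
    · exact Continuous.aestronglyMeasurable (hG'c.comp (by fun_prop : Continuous fun t : ℝ => (x, t)))
    · refine .of_forall fun t ht y hy => hC (y, t) ⟨hy, ?_⟩
      rw [Set.uIoc_of_le zero_le_one] at ht
      exact ⟨ht.1.le, ht.2⟩
    · exact intervalIntegrable_const
    · refine .of_forall fun t _ y _ => ?_
      have h1 : HasFDerivAt G (fderiv ℝ G (y, t)) (y, t) :=
        (hG.differentiable (by simp)).differentiableAt.hasFDerivAt
      exact h1.comp y (hasFDerivAt_prodMk_left y t)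

end ParametricIntegral

/-! ### The Morse lemma with parameters. -/

section Morse

variable {d : ℕ} {N : Type} [NormedAddCommGroup N] [InnerProductSpace ℝ N]

local notation "𝔼" => EuclideanSpace ℝ (Fin d)

/-- Hadamard's lemma: `A (u, u')` is the mean of the derivative of `F` over the segment from `u` to
`u'`. -/
lemma exists_secant_map [CompleteSpace N] {F : 𝔼 → N} (hF : ContDiff ℝ ∞ F) :
    ∃ A : 𝔼 × 𝔼 → 𝔼 →L[ℝ] N, (∀ n : ℕ, ContDiff ℝ n A) ∧ (∀ u, A (u, u) = fderiv ℝ F u) ∧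
      ∀ z, A z (z.2 - z.1) = F z.2 - F z.1 := by
  have hF' : ∀ n : ℕ, ContDiff ℝ n (fderiv ℝ F) := fun n =>
    hF.fderiv_right (by exact_mod_cast le_top)
  refine ⟨fun z => ∫ t in (0 : ℝ)..1, fderiv ℝ F (z.1 + t • (z.2 - z.1)), fun n => ?_,
    fun u => ?_, fun z => ?_⟩
  · refine contDiff_parametric_intervalIntegral n
      (G := fun y : (𝔼 × 𝔼) × ℝ => fderiv ℝ F (y.1.1 + y.2 • (y.1.2 - y.1.1))) ?_
    exact (hF' n).comp (by fun_prop)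
  · simp
  · have hc : Continuous fun t : ℝ => fderiv ℝ F (z.1 + t • (z.2 - z.1)) :=
      (hF' 0).continuous.comp (by fun_prop)
    rw [ContinuousLinearMap.intervalIntegral_apply (hc.intervalIntegrable _ _)]
    have h1 : ∀ t : ℝ, HasDerivAt (fun t : ℝ => F (z.1 + t • (z.2 - z.1)))
        (fderiv ℝ F (z.1 + t • (z.2 - z.1)) (z.2 - z.1)) t := fun t => by
      have h2 : HasDerivAt (fun t : ℝ => z.1 + t • (z.2 - z.1)) (z.2 - z.1) t := by
        simpa using ((hasDerivAt_id t).smul_const (z.2 - z.1)).const_add z.1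
      exact ((hF.differentiable (by simp)).differentiableAt.hasFDerivAt).comp_hasDerivAt t h2
    rw [intervalIntegral.integral_eq_sub_of_hasDerivAt (fun t _ => h1 t)
      ((hc.clm_apply continuous_const).intervalIntegrable _ _)]
    simp

/-- `T` pulls an orthonormal basis of the range of `A` back to `𝔼`. -/
lemma exists_isometric_precomp {A : 𝔼 →L[ℝ] N} (hA : Function.Injective A) :
    ∃ T : 𝔼 ≃L[ℝ] 𝔼, ∀ v, ‖A (T v)‖ = ‖v‖ := by
  let e : 𝔼 ≃ₗ[ℝ] LinearMap.range (A : 𝔼 →ₗ[ℝ] N) := LinearEquiv.ofInjective (A : 𝔼 →ₗ[ℝ] N) hA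
  have hfr : Module.finrank ℝ (LinearMap.range (A : 𝔼 →ₗ[ℝ] N)) = d := by
    rw [← e.finrank_eq]; simp
  have : FiniteDimensional ℝ (LinearMap.range (A : 𝔼 →ₗ[ℝ] N)) := inferInstance
  let b := (stdOrthonormalBasis ℝ (LinearMap.range (A : 𝔼 →ₗ[ℝ] N))).reindex (finCongr hfr)
  refine ⟨(b.repr.symm.toLinearEquiv.trans e.symm).toContinuousLinearEquiv, fun v => ?_⟩
  have h1 : ∀ y, A (e.symm y) = (y : N) := fun y => by
    exact congrArg Subtype.val (e.apply_symm_apply y)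
  have h2 : A ((b.repr.symm.toLinearEquiv.trans e.symm).toContinuousLinearEquiv v) =
      ((b.repr.symm v : LinearMap.range (A : 𝔼 →ₗ[ℝ] N)) : N) := h1 _
  rw [h2]
  exact b.repr.symm.norm_map v

/-- Squaring has derivative `2` at the identity, so the inverse function theorem gives a smooth root
`R`. If `S` is self-adjoint, the adjoint of `R S` is another root of `S` near `1`; by local
uniqueness `R S` is self-adjoint, and `‖R S v‖² = ⟪R S (R S v), v⟫ = ⟪S v, v⟫`. -/
lemma exists_smooth_sqrt (n : ℕ) (hn : 1 ≤ n) :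
    ∃ R : (𝔼 →L[ℝ] 𝔼) → (𝔼 →L[ℝ] 𝔼), ContDiffAt ℝ n R 1 ∧ R 1 = 1 ∧
      ∀ᶠ S in 𝓝 (1 : 𝔼 →L[ℝ] 𝔼), (∀ v w, inner ℝ (S v) w = inner ℝ v (S w)) →
        ∀ v, ‖R S v‖ ^ 2 = inner ℝ (S v) v := by
  set sq : (𝔼 →L[ℝ] 𝔼) → (𝔼 →L[ℝ] 𝔼) := fun X => X * X with hsq
  have hs : ContDiffAt ℝ n sq 1 := (contDiff_id.mul contDiff_id).contDiffAt
  let e : (𝔼 →L[ℝ] 𝔼) ≃L[ℝ] (𝔼 →L[ℝ] 𝔼) :=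
    (LinearEquiv.smulOfNeZero ℝ (𝔼 →L[ℝ] 𝔼) (2 : ℝ) two_ne_zero).toContinuousLinearEquiv
  have hd : HasFDerivAt sq (e : (𝔼 →L[ℝ] 𝔼) →L[ℝ] (𝔼 →L[ℝ] 𝔼)) 1 := by
    have h1 := (hasFDerivAt_id (𝕜 := ℝ) (1 : 𝔼 →L[ℝ] 𝔼)).mul' (hasFDerivAt_id (𝕜 := ℝ) _)
    refine h1.congr_fderiv (ContinuousLinearMap.ext fun X => ?_)
    change (1 : 𝔼 →L[ℝ] 𝔼) * X + X * 1 = (2 : ℝ) • X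
    rw [one_mul, mul_one]
    exact (two_smul ℝ X).symm
  have hn0 : (n : WithTop ℕ∞) ≠ 0 := by exact_mod_cast (by omega : n ≠ 0)
  have h1 : sq 1 = 1 := one_mul 1
  have hstrict := hs.hasStrictFDerivAt' hd hn0
  set R := hstrict.localInverse sq e 1 with hR
  have hR1 : R 1 = 1 := by
    have := hstrict.localInverse_apply_image
    rwa [h1] at this
  have hRc : ContDiffAt ℝ n R 1 := by
    have := hs.to_localInverse hd hn0
    rwa [h1] at this
  have hright : ∀ᶠ S in 𝓝 (1 : 𝔼 →L[ℝ] 𝔼), R S * R S = S := by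
    have := hstrict.eventually_right_inverse
    rwa [h1] at this
  have hleft : ∀ᶠ X in 𝓝 (1 : 𝔼 →L[ℝ] 𝔼), R (X * X) = X := hstrict.eventually_left_inverse
  have hadj : Tendsto (fun S => ContinuousLinearMap.adjoint (R S)) (𝓝 (1 : 𝔼 →L[ℝ] 𝔼)) (𝓝 1) := by
    have h2 : ContinuousAt (fun S => ContinuousLinearMap.adjoint (R S)) (1 : 𝔼 →L[ℝ] 𝔼) :=
      (ContinuousLinearMap.adjoint (𝕜 := ℝ) (E := 𝔼) (F := 𝔼)).continuous.continuousAt.comp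
        hRc.continuousAt
    have h3 : ContinuousLinearMap.adjoint (R 1) = (1 : 𝔼 →L[ℝ] 𝔼) := by
      rw [hR1]; exact star_one _
    have h4 := h2.tendsto
    rwa [h3] at h4
  refine ⟨R, hRc, hR1, ?_⟩
  filter_upwards [hright, hadj.eventually hleft] with S hS1 hS2 hSa v
  have h5 : ContinuousLinearMap.adjoint (R S) * ContinuousLinearMap.adjoint (R S) = S := by
    have h6 : star (R S) * star (R S) = star (R S * R S) := (star_mul _ _).symm
    have h7 : star S = S := ((ContinuousLinearMap.eq_adjoint_iff S S).2 hSa).symm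
    change star (R S) * star (R S) = S
    rw [h6, hS1, h7]
  rw [h5] at hS2
  rw [← real_inner_self_eq_norm_sq, ← ContinuousLinearMap.adjoint_inner_left, ← hS2]
  conv_rhs => rw [← hS1]
  rfl

/-- Morse coordinates for the squared extrinsic distance, depending smoothly on the base point. -/
theorem exists_morse_coordinates [CompleteSpace N] {F : 𝔼 → N} (hF : ContDiff ℝ ∞ F) {c : 𝔼}
    (hinj : Function.Injective (fderiv ℝ F c)) (n : ℕ) (hn : 1 ≤ n) :
    ∃ Φ Ψ : 𝔼 × 𝔼 → 𝔼, ContDiffAt ℝ n Φ (c, 0) ∧ Φ (c, 0) = c ∧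
      (∀ᶠ z in 𝓝 (c, (0 : 𝔼)), Ψ (z.1, Φ z) = z.2 ∧ ‖F (Φ z) - F z.1‖ = ‖z.2‖) ∧
      (∀ᶠ y in 𝓝 (c, c), Φ (y.1, Ψ y) = y.2 ∧ ‖Ψ y‖ = ‖F y.2 - F y.1‖) := by
  obtain ⟨A, hAn, hAd, hAF⟩ := exists_secant_map hF
  obtain ⟨T, hT⟩ := exists_isometric_precomp hinj
  obtain ⟨R, hRn, hR1, hR⟩ := exists_smooth_sqrt (d := d) n hn
  -- `B` is isometric at `(c, c)`, so `S = BᵀB` is the identity there and has a smooth square root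
  -- nearby.
  set B : 𝔼 × 𝔼 → 𝔼 →L[ℝ] N := fun z => (A z).comp (T : 𝔼 →L[ℝ] 𝔼) with hB
  have hBn : ContDiff ℝ n B := (hAn n).clm_comp contDiff_const
  set S : 𝔼 × 𝔼 → 𝔼 →L[ℝ] 𝔼 := fun z =>
    ∑ i, ((innerSL ℝ (B z (stdVec i))).comp (B z)).smulRight (stdVec i) with hS
  have hSn : ContDiff ℝ n S := by
    refine ContDiff.sum fun i _ => ContDiff.smulRight (ContDiff.clm_comp ?_ hBn) contDiff_const
    exact (innerSL ℝ (E := N)).contDiff.comp (hBn.clm_apply contDiff_const)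
  have hSi : ∀ z v w, inner ℝ (S z v) w = inner ℝ (B z v) (B z w) := fun z v w => by
    have h1 : B z w = ∑ i, w i • B z (stdVec i) := by
      conv_lhs => rw [← sum_smul_stdVec w]
      simp
    rw [h1]
    simp [hS, sum_inner, inner_sum, inner_smul_left, inner_smul_right,
      EuclideanSpace.inner_single_left, real_inner_comm, mul_comm]
  have hS1 : S (c, c) = 1 := by
    refine ContinuousLinearMap.ext fun v => ext_inner_right ℝ fun w => ?_
    have h2 : ∀ v, ‖B (c, c) v‖ = ‖v‖ := fun v => by
      simp only [hB, hAd]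
      exact hT v
    rw [hSi]
    exact LinearIsometry.inner_map_map ({ B (c, c) with norm_map' := h2 } : 𝔼 →ₗᵢ[ℝ] N) v w
  -- With `w = T⁻¹ (u' - u)`, `‖Ψ (u, u')‖² = ⟪S w, w⟫ = ‖B w‖²`, and `B w = F u' - F u`.
  set Ψ : 𝔼 × 𝔼 → 𝔼 := fun z => R (S z) (T.symm (z.2 - z.1)) with hΨ
  have hRS : ContDiffAt ℝ n (fun z => R (S z)) (c, c) := by
    have : ContDiffAt ℝ n R (S (c, c)) := by rwa [hS1]
    exact this.comp (c, c) hSn.contDiffAt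
  have hΨn : ContDiffAt ℝ n Ψ (c, c) := hRS.clm_apply (by fun_prop)
  have hΨnorm : ∀ᶠ y in 𝓝 (c, c), ‖Ψ y‖ = ‖F y.2 - F y.1‖ := by
    have hS2 : Tendsto S (𝓝 (c, c)) (𝓝 1) := by
      rw [← hS1]; exact hSn.continuous.continuousAt
    filter_upwards [hS2.eventually hR] with z hz
    have h3 := hz (fun v w => (hSi z v w).trans ((real_inner_comm _ _).trans
      ((hSi z w v).symm.trans (real_inner_comm _ _))))
      (T.symm (z.2 - z.1))
    rw [hSi, real_inner_self_eq_norm_sq] at h3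
    have h4 := (sq_eq_sq₀ (norm_nonneg _) (norm_nonneg _)).1 h3
    rw [hΨ]
    simp only
    rw [h4, ← hAF z]
    simp [hB]
  have hn0 : (n : WithTop ℕ∞) ≠ 0 := by exact_mod_cast (by omega : n ≠ 0)
  -- the inverse function theorem for `(u, u') ↦ (u, Ψ (u, u'))`
  set P : 𝔼 × 𝔼 → 𝔼 × 𝔼 := fun z => (z.1, Ψ z) with hP
  have hPn : ContDiffAt ℝ n P (c, c) := contDiffAt_fst.prodMk hΨn
  -- At `(c, c)` the vector `u' - u` vanishes, so the derivative of `R ∘ S` does not contribute and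
  -- the derivative of `P` is the triangular map `(a, a') ↦ (a, T⁻¹ (a' - a))`.
  let e : (𝔼 × 𝔼) ≃L[ℝ] (𝔼 × 𝔼) := ContinuousLinearEquiv.equivOfInverse
    ((ContinuousLinearMap.fst ℝ 𝔼 𝔼).prod ((T.symm : 𝔼 →L[ℝ] 𝔼).comp
      (ContinuousLinearMap.snd ℝ 𝔼 𝔼 - ContinuousLinearMap.fst ℝ 𝔼 𝔼)))
    ((ContinuousLinearMap.fst ℝ 𝔼 𝔼).prod (ContinuousLinearMap.fst ℝ 𝔼 𝔼 +
      (T : 𝔼 →L[ℝ] 𝔼).comp (ContinuousLinearMap.snd ℝ 𝔼 𝔼)))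
    (fun z => by ext <;> simp) (fun z => by ext <;> simp)
  have hPd : HasFDerivAt P (e : (𝔼 × 𝔼) →L[ℝ] (𝔼 × 𝔼)) (c, c) := by
    have h5 : HasFDerivAt (fun z : 𝔼 × 𝔼 => T.symm (z.2 - z.1)) ((T.symm : 𝔼 →L[ℝ] 𝔼).comp
        (ContinuousLinearMap.snd ℝ 𝔼 𝔼 - ContinuousLinearMap.fst ℝ 𝔼 𝔼)) (c, c) :=
      (T.symm : 𝔼 →L[ℝ] 𝔼).hasFDerivAt.comp (c, c) (hasFDerivAt_snd.sub hasFDerivAt_fst)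
    have h6 := (hRS.differentiableAt hn0).hasFDerivAt.clm_apply h5
    refine (hasFDerivAt_fst.prodMk h6).congr_fderiv (ContinuousLinearMap.ext fun z => ?_)
    simp [e, hS1, hR1]
  have hPc : P (c, c) = (c, 0) := by simp [hP, hΨ]
  have hstrict := hPn.hasStrictFDerivAt' hPd hn0
  set Q := hstrict.localInverse P e (c, c) with hQ
  have hQc : Q (c, 0) = (c, c) := by
    have := hstrict.localInverse_apply_image
    rwa [hPc] at this
  have hQn : ContDiffAt ℝ n Q (c, 0) := by
    have := hPn.to_localInverse hPd hn0
    rwa [hPc] at this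
  have hright : ∀ᶠ z in 𝓝 (c, (0 : 𝔼)), P (Q z) = z := by
    have := hstrict.eventually_right_inverse
    rwa [hPc] at this
  have hleft : ∀ᶠ y in 𝓝 (c, c), Q (P y) = y := hstrict.eventually_left_inverse
  refine ⟨fun z => (Q z).2, Ψ, contDiff_snd.contDiffAt.comp _ hQn, congrArg Prod.snd hQc, ?_, ?_⟩
  · have hQt : Tendsto Q (𝓝 (c, 0)) (𝓝 (c, c)) := by
      have := hQn.continuousAt.tendsto
      rwa [hQc] at this
    filter_upwards [hright, hQt.eventually hΨnorm] with z hz hz2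
    have h7' : (P (Q z)).1 = z.1 := congrArg Prod.fst hz
    have h8' : (P (Q z)).2 = z.2 := congrArg Prod.snd hz
    have h7 : (Q z).1 = z.1 := h7'
    have h8 : Ψ (Q z) = z.2 := h8'
    have h9 : (z.1, (Q z).2) = Q z := by rw [← h7]
    rw [h9, h8]
    rw [h8, h7] at hz2
    exact ⟨rfl, hz2.symm⟩
  · filter_upwards [hleft, hΨnorm] with y hy hy2
    exact ⟨congrArg Prod.snd hy, hy2⟩

end Morse

/-! ### Calculus of pointwise `Cⁿ` bounds. -/

section PointwiseBounds

variable {X Y Z : Type*} [NormedAddCommGroup X] [NormedSpace ℝ X] [NormedAddCommGroup Y]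
  [NormedSpace ℝ Y] [NormedAddCommGroup Z] [NormedSpace ℝ Z]

/-- `f` is `Cⁿ` at `x`, with all derivatives of order at most `n` at `x` bounded by `C`. -/
def CkAt (n : ℕ) (f : X → Y) (C : ℝ) (x : X) : Prop :=
  ContDiffAt ℝ n f x ∧ ∀ i ≤ n, ‖iteratedFDeriv ℝ i f x‖ ≤ C

lemma CkAt.mono {n : ℕ} {f : X → Y} {C C' : ℝ} {x : X} (h : CkAt n f C x) (hC : C ≤ C') :
    CkAt n f C' x :=
  ⟨h.1, fun i hi => (h.2 i hi).trans hC⟩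

lemma CkAt.norm_le {n : ℕ} {f : X → Y} {C : ℝ} {x : X} (h : CkAt n f C x) : ‖f x‖ ≤ C := by
  simpa using h.2 0 (Nat.zero_le n)

lemma CkAt.nonneg {n : ℕ} {f : X → Y} {C : ℝ} {x : X} (h : CkAt n f C x) : 0 ≤ C :=
  (norm_nonneg _).trans h.norm_le

lemma CkAt.congr {n : ℕ} {f g : X → Y} {C : ℝ} {x : X} (h : CkAt n f C x) (hfg : g =ᶠ[𝓝 x] f) :
    CkAt n g C x :=
  ⟨h.1.congr_of_eventuallyEq hfg, fun i hi => by rw [(hfg.iteratedFDeriv ℝ i).self_of_nhds]; exact h.2 i hi⟩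

lemma ContDiffAt.exists_isOpen {n : ℕ} {f : X → Y} {x : X} (h : ContDiffAt ℝ n f x) {t : Set X}
    (ht : t ∈ 𝓝 x) : ∃ s ⊆ t, IsOpen s ∧ x ∈ s ∧ ContDiffOn ℝ n f s := by
  obtain ⟨s, hs, hso, hxs⟩ := eventually_nhds_iff.1 ((h.eventually (by simp)).and ht)
  exact ⟨s, fun y hy => (hs y hy).2, hso, hxs, fun y hy => (hs y hy).1.contDiffWithinAt⟩

/-- The normalization `1 ≤ C` is what `CkAt.comp` asks of its inner function. -/
lemma ContDiffAt.exists_ckAt {n : ℕ} {f : X → Y} {x : X} (h : ContDiffAt ℝ n f x) :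
    ∃ C : ℝ, 1 ≤ C ∧ ∀ᶠ y in 𝓝 x, CkAt n f C y := by
  refine ⟨1 + ∑ i ∈ Finset.range (n + 1), (‖iteratedFDeriv ℝ i f x‖ + 1), ?_, ?_⟩
  · exact le_add_of_nonneg_right (Finset.sum_nonneg fun i _ => by positivity)
  have h1 : ∀ i ∈ Finset.range (n + 1), ∀ᶠ y in 𝓝 x,
      ‖iteratedFDeriv ℝ i f y‖ ≤ ‖iteratedFDeriv ℝ i f x‖ + 1 := fun i hi => by
    have hi' : i ≤ n := Nat.lt_succ_iff.1 (Finset.mem_range.1 hi)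
    have hc : ContinuousAt (iteratedFDeriv ℝ i f) x :=
      (h.iteratedFDeriv_right (m := 0) (by simpa using hi')).continuousAt
    exact hc.norm.eventually_le_const (by linarith)
  filter_upwards [h.eventually (by simp), (Finset.range (n + 1)).eventually_all.2 h1] with y hy hy1
  refine ⟨hy, fun i hi => ?_⟩
  have hi' : i ∈ Finset.range (n + 1) := Finset.mem_range.2 (Nat.lt_succ_of_le hi)
  refine (hy1 i hi').trans ?_
  have := Finset.single_le_sum (f := fun i => ‖iteratedFDeriv ℝ i f x‖ + 1)
    (fun i _ => by positivity) hi'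
  linarith

/-- Leibniz rule; the binomial coefficients of order `i ≤ n` sum to `2 ^ i`. -/
lemma CkAt.smul {n : ℕ} {f : X → ℝ} {g : X → Y} {C D : ℝ} {x : X} (hf : CkAt n f C x)
    (hg : CkAt n g D x) : CkAt n (fun y => f y • g y) (2 ^ n * C * D) x := by
  refine ⟨hf.1.smul hg.1, fun i hi => ?_⟩
  obtain ⟨s, -, hso, hxs, hs⟩ := hf.1.exists_isOpen univ_mem
  obtain ⟨t, hts, hto, hxt, ht⟩ := hg.1.exists_isOpen (hso.mem_nhds hxs)
  have h := norm_iteratedFDerivWithin_smul_le (hs.mono hts) ht hto.uniqueDiffOn hxt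
    (n := i) (by exact_mod_cast hi)
  simp only [iteratedFDerivWithin_of_isOpen _ hto hxt] at h
  refine h.trans ?_
  calc ∑ j ∈ Finset.range (i + 1), (i.choose j : ℝ) * ‖iteratedFDeriv ℝ j f x‖ *
        ‖iteratedFDeriv ℝ (i - j) g x‖
      ≤ ∑ j ∈ Finset.range (i + 1), (i.choose j : ℝ) * C * D := by
        refine Finset.sum_le_sum fun j hj => ?_
        have hj' := Nat.lt_succ_iff.1 (Finset.mem_range.1 hj)
        have h1 := hf.2 j (hj'.trans hi)
        have h2 := hg.2 (i - j) ((Nat.sub_le _ _).trans hi)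
        have h3 := hf.nonneg
        gcongr
    _ = 2 ^ i * C * D := by
        rw [← Finset.sum_mul, ← Finset.sum_mul]
        congr 2
        exact_mod_cast Nat.sum_range_choose i
    _ ≤ 2 ^ n * C * D := by
        have h3 := hf.nonneg
        have h4 := hg.nonneg
        gcongr
        norm_num

lemma CkAt.mul {n : ℕ} {f g : X → ℝ} {C D : ℝ} {x : X} (hf : CkAt n f C x)
    (hg : CkAt n g D x) : CkAt n (fun y => f y * g y) (2 ^ n * C * D) x :=
  hf.smul hg

lemma CkAt.sum {n : ℕ} {ι : Type*} (u : Finset ι) {f : ι → X → Y} {C : ℝ} {x : X}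
    (hf : ∀ i ∈ u, CkAt n (f i) C x) : CkAt n (fun y => ∑ i ∈ u, f i y) (u.card * C) x := by
  refine ⟨ContDiffAt.sum fun i hi => (hf i hi).1, fun k hk => ?_⟩
  have h1 : (fun y => ∑ i ∈ u, f i y) = ∑ i ∈ u, f i := by ext y; simp
  rw [h1, iteratedFDeriv_sum_apply fun i hi => (hf i hi).1.of_le (by exact_mod_cast hk)]
  refine (norm_sum_le _ _).trans ?_
  rw [← nsmul_eq_mul]
  exact Finset.sum_le_card_nsmul _ _ _ fun i hi => (hf i hi).2 k hk

lemma CkAt.sub_const {n : ℕ} {f : X → Y} {C : ℝ} {x : X} (hf : CkAt n f C x) (c : Y) :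
    CkAt n (fun y => f y - c) (C + ‖c‖) x := by
  refine ⟨hf.1.sub contDiffAt_const, fun i hi => ?_⟩
  have h0 := norm_nonneg c
  have h1 : iteratedFDeriv ℝ i (fun y => f y - c) x =
      iteratedFDeriv ℝ i f x - iteratedFDeriv ℝ i (fun _ => c) x :=
    iteratedFDeriv_sub_apply (hf.1.of_le (by exact_mod_cast hi)) contDiffAt_const
  rw [h1]
  refine (norm_sub_le _ _).trans (add_le_add (hf.2 i hi) ?_)
  rcases Nat.eq_zero_or_pos i with rfl | hpos
  · simp
  · rw [iteratedFDeriv_const_of_ne hpos.ne']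
    simp

/-- Faà di Bruno's bound wants the `j`-th inner derivative bounded by `D ^ j`; `1 ≤ D` lets a single
`D` serve all orders. -/
lemma CkAt.comp {n : ℕ} {g : Y → Z} {f : X → Y} {C D : ℝ} {x : X} (hg : CkAt n g C (f x))
    (hf : CkAt n f D x) (hD : 1 ≤ D) : CkAt n (g ∘ f) (n.factorial * C * D ^ n) x := by
  refine ⟨hg.1.comp x hf.1, fun i hi => ?_⟩
  obtain ⟨t, -, hto, hxt, ht⟩ := hg.1.exists_isOpen univ_mem
  obtain ⟨s, hst, hso, hxs, hs⟩ := hf.1.exists_isOpen (hf.1.continuousAt (hto.mem_nhds hxt))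
  have h := norm_iteratedFDerivWithin_comp_le ht hs (n := i) (by exact_mod_cast hi)
    hto.uniqueDiffOn hso.uniqueDiffOn hst hxs (C := C) (D := D)
    (fun j hj => by
      rw [iteratedFDerivWithin_of_isOpen _ hto hxt]; exact hg.2 j (hj.trans hi))
    (fun j hj1 hj => by
      rw [iteratedFDerivWithin_of_isOpen _ hso hxs]
      exact (hf.2 j (hj.trans hi)).trans (le_self_pow₀ hD (by omega)))
  rw [iteratedFDerivWithin_of_isOpen _ hso hxs] at h
  refine h.trans ?_
  have := hg.nonneg
  gcongr

lemma CkAt.of_fderiv {n : ℕ} {f : X → Y} {C : ℝ} {x : X} (hf : ContDiffAt ℝ (n + 1 : ℕ) f x)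
    (h0 : ‖f x‖ ≤ C) (h : CkAt n (fderiv ℝ f) C x) : CkAt (n + 1) f C x := by
  refine ⟨hf, fun i hi => ?_⟩
  rcases i with _ | i
  · simpa using h0
  · rw [← norm_iteratedFDeriv_fderiv]
    exact h.2 i (by omega)

lemma CkAt.abs_fderiv_fderiv_le {n : ℕ} {f : X → ℝ} {C : ℝ} {x : X} (h : CkAt n f C x)
    (hn : 2 ≤ n) (v w : X) : |fderiv ℝ (fderiv ℝ f) x v w| ≤ C * ‖v‖ * ‖w‖ := by
  have h1 : ‖fderiv ℝ (fderiv ℝ f) x‖ ≤ C := by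
    rw [← norm_iteratedFDeriv_one, norm_iteratedFDeriv_fderiv]; exact h.2 2 hn
  exact ((fderiv ℝ (fderiv ℝ f) x).le_opNorm₂ v w).trans (by gcongr)

end PointwiseBounds

/-! ### Even Taylor expansion to fourth order. -/

section Taylor

lemma abs_le_of_hasDerivAt_of_abs_le {f g : ℝ → ℝ} {B : ℝ} (hf : ∀ t ∈ Set.Icc (0 : ℝ) 1,
    HasDerivAt f (g t) t) (h0 : f 0 = 0) (hg : ∀ t ∈ Set.Icc (0 : ℝ) 1, |g t| ≤ B) :
    ∀ t ∈ Set.Icc (0 : ℝ) 1, |f t| ≤ B := by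
  intro t ht
  have hB : 0 ≤ B := (abs_nonneg _).trans (hg t ht)
  have := Convex.norm_image_sub_le_of_norm_hasDerivWithin_le
    (fun x hx => (hf x hx).hasDerivWithinAt) hg (convex_Icc (0 : ℝ) 1)
    (Set.left_mem_Icc.2 zero_le_one) ht
  rw [h0, sub_zero, sub_zero, Real.norm_eq_abs, Real.norm_of_nonneg ht.1] at this
  exact this.trans (mul_le_of_le_one_right hB ht.2)

/-- The mean value inequality, applied four times on `[0, 1]`. Powers of `t` are discarded on the
way, which costs the factor `1/24` of the sharp bound. -/
lemma abs_sub_taylor_three_le {c0 c1 c2 c3 c4 : ℝ → ℝ} {B : ℝ}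
    (h0 : ∀ t ∈ Set.Icc (0 : ℝ) 1, HasDerivAt c0 (c1 t) t)
    (h1 : ∀ t ∈ Set.Icc (0 : ℝ) 1, HasDerivAt c1 (c2 t) t)
    (h2 : ∀ t ∈ Set.Icc (0 : ℝ) 1, HasDerivAt c2 (c3 t) t)
    (h3 : ∀ t ∈ Set.Icc (0 : ℝ) 1, HasDerivAt c3 (c4 t) t)
    (h4 : ∀ t ∈ Set.Icc (0 : ℝ) 1, |c4 t| ≤ B) :
    |c0 1 - c0 0 - c1 0 - c2 0 / 2 - c3 0 / 6| ≤ B := by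
  have e3 := abs_le_of_hasDerivAt_of_abs_le (f := fun t => c3 t - c3 0)
    (fun t ht => (h3 t ht).sub_const _) (by ring) h4
  have e2 := abs_le_of_hasDerivAt_of_abs_le (f := fun t => c2 t - c2 0 - c3 0 * t)
    (fun t ht => by
      simpa using ((h2 t ht).sub_const _).fun_sub ((hasDerivAt_id t).const_mul (c3 0)))
    (by ring) e3
  have e1 := abs_le_of_hasDerivAt_of_abs_le (f := fun t => c1 t - c1 0 - c2 0 * t - c3 0 * (t ^ 2 / 2))
    (fun t ht => by
      have := (((h1 t ht).sub_const (c1 0)).sub ((hasDerivAt_id t).const_mul (c2 0))).sub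
        (((hasDerivAt_pow 2 t).div_const 2).const_mul (c3 0))
      refine this.congr_deriv ?_
      simp) (by ring) e2
  have e0 := abs_le_of_hasDerivAt_of_abs_le
    (f := fun t => c0 t - c0 0 - c1 0 * t - c2 0 * (t ^ 2 / 2) - c3 0 * (t ^ 3 / 6))
    (fun t ht => by
      have := ((((h0 t ht).sub_const (c0 0)).sub ((hasDerivAt_id t).const_mul (c1 0))).sub
        (((hasDerivAt_pow 2 t).div_const 2).const_mul (c2 0))).sub
        (((hasDerivAt_pow 3 t).div_const 6).const_mul (c3 0))
      refine this.congr_deriv ?_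
      push_cast
      ring) (by ring) e1 1 (Set.right_mem_Icc.2 zero_le_one)
  convert e0 using 2
  ring

variable {X : Type*} [NormedAddCommGroup X] [NormedSpace ℝ X]

/-- The even part of a `C⁴` function agrees to fourth order with its quadratic Taylor polynomial. -/
lemma abs_even_taylor_le {g : X → ℝ} {z h : X} {C : ℝ}
    (hg : ∀ t ∈ Set.Icc (-1 : ℝ) 1, CkAt 4 g C (z + t • h)) :
    |g (z + h) + g (z - h) - 2 * g z - fderiv ℝ (fderiv ℝ g) z h h| ≤ 2 * C * ‖h‖ ^ 4 := by
  have key : ∀ h : X, (∀ t ∈ Set.Icc (0 : ℝ) 1, CkAt 4 g C (z + t • h)) →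
      |g (z + h) - g z - iteratedFDeriv ℝ 1 g z (fun _ => h) -
        iteratedFDeriv ℝ 2 g z (fun _ => h) / 2 - iteratedFDeriv ℝ 3 g z (fun _ => h) / 6| ≤
      C * ‖h‖ ^ 4 := by
    intro h hg
    have hd : ∀ k < 4, ∀ t ∈ Set.Icc (0 : ℝ) 1,
        HasDerivAt (fun t : ℝ => iteratedFDeriv ℝ k g (z + t • h) (fun _ => h))
          (iteratedFDeriv ℝ (k + 1) g (z + t • h) (fun _ => h)) t := by
      intro k hk t ht
      have h1 : DifferentiableAt ℝ (iteratedFDeriv ℝ k g) (z + t • h) :=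
        ((hg t ht).1.iteratedFDeriv_right (m := 1) (i := k) (by
          norm_cast; omega)).differentiableAt one_ne_zero
      have h2 : HasDerivAt (fun t : ℝ => z + t • h) h t := by
        simpa using ((hasDerivAt_id t).smul_const h).const_add z
      have h3 := h1.hasFDerivAt.comp_hasDerivAt t h2
      have h4 := ((ContinuousMultilinearMap.apply ℝ (fun _ : Fin k => X) ℝ
        (fun _ => h)).hasFDerivAt.comp_hasDerivAt t h3)
      rw [iteratedFDeriv_succ_apply_left]
      exact h4
    have := abs_sub_taylor_three_le (hd 0 (by norm_num)) (hd 1 (by norm_num)) (hd 2 (by norm_num))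
      (hd 3 (by norm_num)) (B := C * ‖h‖ ^ 4) (fun t ht => by
        rw [← Real.norm_eq_abs]
        refine (ContinuousMultilinearMap.le_opNorm _ _).trans ?_
        simp only [Finset.prod_const, Finset.card_univ, Fintype.card_fin]
        have := (hg t ht).2 4 le_rfl
        gcongr)
    simpa using this
  -- Adding the expansions at `h` and `-h` cancels the terms of orders one and three.
  have k1 := key h fun t ht => hg t ⟨by linarith [ht.1], ht.2⟩
  have k2 := key (-h) fun t ht => by
    have := hg (-t) ⟨by linarith [ht.2], by linarith [ht.1]⟩
    simpa using this
  have e : ∀ (k : ℕ), iteratedFDeriv ℝ k g z (fun _ => -h) =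
      (-1) ^ k * iteratedFDeriv ℝ k g z (fun _ => h) := fun k => by
    have := (iteratedFDeriv ℝ k g z).map_smul_univ (fun _ => (-1 : ℝ)) (fun _ => h)
    simpa using this
  rw [e, e, e, norm_neg, ← sub_eq_add_neg] at k2
  have e2 : iteratedFDeriv ℝ 2 g z (fun _ => h) = fderiv ℝ (fderiv ℝ g) z h h :=
    iteratedFDeriv_two_apply g z _
  rw [e2] at k1 k2
  rw [abs_le] at *
  constructor <;> linarith [k1.1, k1.2, k2.1, k2.2]

end Taylor

/-! ### Metric, gradient and Laplacian in charts. -/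

section ChartGeometry

attribute [local instance 2000] chartedSpaceSelf

/-- An orthonormal family of full cardinality in an inner product space computes inner products. -/
lemma sum_inner_mul_inner_of_orthonormal {W : Type*} [NormedAddCommGroup W] [InnerProductSpace ℝ W]
    [FiniteDimensional ℝ W] {d : ℕ} (hd : Module.finrank ℝ W = d) {b : Fin d → W}
    (hb : Orthonormal ℝ b) (x y : W) :
    ∑ k, inner ℝ x (b k) * inner ℝ (b k) y = inner ℝ x y := by
  have hc : Fintype.card (Fin d) = Module.finrank ℝ W := by rw [hd, Fintype.card_fin]
  have := (OrthonormalBasis.mk hb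
    (hb.linearIndependent.span_eq_top_of_card_eq_finrank' hc).ge).sum_inner_mul_inner x y
  simpa using this

/-- The matrix `b` of `B` satisfies `bᵀ G b = 1` for the Gram matrix `G` of `A`, so `G⁻¹ = b bᵀ`:
contraction with the inverse metric is a trace in the frame `B eₖ`. -/
lemma sum_bilin_comp_eq {d : ℕ} {N : Type*} [NormedAddCommGroup N] [InnerProductSpace ℝ N]
    {A : EuclideanSpace ℝ (Fin d) →L[ℝ] N}
    {B : EuclideanSpace ℝ (Fin d) →L[ℝ] EuclideanSpace ℝ (Fin d)} (h : ∀ v, ‖A (B v)‖ = ‖v‖)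
    (q : EuclideanSpace ℝ (Fin d) →L[ℝ] EuclideanSpace ℝ (Fin d) →L[ℝ] ℝ) :
    ∑ i, ∑ j, (gramMatrix A)⁻¹ i j * q (stdVec i) (stdVec j) =
      ∑ k, q (B (stdVec k)) (B (stdVec k)) := by
  set b : Matrix (Fin d) (Fin d) ℝ := Matrix.of fun k i => B (stdVec i) k with hb
  have hbb : (gramMatrix A)⁻¹ = b * b.transpose := by
    have h1 : b.transpose * gramMatrix A * b = 1 := by
      rw [← gramMatrix_eq_one (A := A ∘L B) h, gramMatrix_comp]
    have h2 : b * (b.transpose * gramMatrix A) = 1 := mul_eq_one_comm.1 h1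
    rw [← Matrix.mul_assoc] at h2
    exact Matrix.inv_eq_left_inv h2
  have h3 : ∀ k, q (B (stdVec k)) (B (stdVec k)) =
      ∑ i, ∑ j, b i k * b j k * q (stdVec i) (stdVec j) := fun k => by
    conv_lhs => rw [← sum_smul_stdVec (B (stdVec k))]
    simp only [map_sum, map_smul, _root_.sum_apply, _root_.smul_apply,
      smul_eq_mul, Finset.mul_sum]
    rw [Finset.sum_comm]
    refine Finset.sum_congr rfl fun i _ => Finset.sum_congr rfl fun j _ => ?_
    simp only [hb, Matrix.of_apply]
    ring
  simp only [h3, hbb, Matrix.mul_apply, Matrix.transpose_apply, Finset.sum_mul]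
  conv_rhs => rw [Finset.sum_comm]
  refine Finset.sum_congr rfl fun i _ => ?_
  rw [Finset.sum_comm]

variable {d D : ℕ} {M : Type*} [TopologicalSpace M] [ChartedSpace (EuclideanSpace ℝ (Fin d)) M]
  [IsManifold (𝓡 d) ∞ M]

local notation "𝔼" => EuclideanSpace ℝ (Fin d)

lemma extChartAt_target_mem_nhds_of_mem {p : M} {u : 𝔼} (hu : u ∈ (extChartAt (𝓡 d) p).target) :
    (extChartAt (𝓡 d) p).target ∈ 𝓝 u :=
  (isOpen_extChartAt_target p).mem_nhds hu

lemma mdifferentiableAt_extChartAt_symm {p : M} {u : 𝔼}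
    (hu : u ∈ (extChartAt (𝓡 d) p).target) :
    MDifferentiableAt 𝓘(ℝ, 𝔼) (𝓡 d) (extChartAt (𝓡 d) p).symm u :=
  ((contMDiffOn_extChartAt_symm (n := ∞) p).contMDiffAt
    (extChartAt_target_mem_nhds_of_mem hu)).mdifferentiableAt (by simp)

lemma contDiffOn_comp_extChartAt_symm {Y : Type*} [NormedAddCommGroup Y] [NormedSpace ℝ Y]
    {n : WithTop ℕ∞} (hn : n ≤ ∞) {f : M → Y} (hf : ContMDiff (𝓡 d) 𝓘(ℝ, Y) n f) (p : M) :
    ContDiffOn ℝ n (f ∘ (extChartAt (𝓡 d) p).symm) (extChartAt (𝓡 d) p).target := by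
  rw [← contMDiffOn_iff_contDiffOn]
  exact hf.comp_contMDiffOn ((contMDiffOn_extChartAt_symm (n := ∞) p).of_le hn)

lemma contDiffAt_comp_extChartAt_symm {Y : Type*} [NormedAddCommGroup Y] [NormedSpace ℝ Y]
    {n : WithTop ℕ∞} (hn : n ≤ ∞) {f : M → Y} (hf : ContMDiff (𝓡 d) 𝓘(ℝ, Y) n f) {p : M} {u : 𝔼}
    (hu : u ∈ (extChartAt (𝓡 d) p).target) :
    ContDiffAt ℝ n (f ∘ (extChartAt (𝓡 d) p).symm) u :=
  (contDiffOn_comp_extChartAt_symm hn hf p).contDiffAt (extChartAt_target_mem_nhds_of_mem hu)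

lemma fderiv_comp_extChartAt_symm {Y : Type*} [NormedAddCommGroup Y] [NormedSpace ℝ Y]
    {f : M → Y} {p : M} {u : 𝔼} (hu : u ∈ (extChartAt (𝓡 d) p).target)
    (hf : MDifferentiableAt (𝓡 d) 𝓘(ℝ, Y) f ((extChartAt (𝓡 d) p).symm u)) (v : 𝔼) :
    fderiv ℝ (f ∘ (extChartAt (𝓡 d) p).symm) u v =
      mfderiv (𝓡 d) 𝓘(ℝ, Y) f ((extChartAt (𝓡 d) p).symm u)
        (mfderiv 𝓘(ℝ, 𝔼) (𝓡 d) (extChartAt (𝓡 d) p).symm u v) := by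
  have h := mfderiv_comp u hf (mdifferentiableAt_extChartAt_symm hu)
  rw [mfderiv_eq_fderiv] at h
  rw [h]
  rfl

variable [RiemannianBundle (fun x : M => TangentSpace (𝓡 d) x)]
  {ι : M → EuclideanSpace ℝ (Fin D)}

/-- Isometry of `ι` reduces the Riemannian metric to ordinary calculus for the map `ι ∘ φ⁻¹` into
`ℝᴰ`. -/
lemma inner_mfderiv_extChartAt_symm (hι : IsIsometricEmbedding (d := d) ι) {p : M} {u : 𝔼}
    (hu : u ∈ (extChartAt (𝓡 d) p).target) (v w : 𝔼) :
    inner ℝ (mfderiv 𝓘(ℝ, 𝔼) (𝓡 d) (extChartAt (𝓡 d) p).symm u v :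
        TangentSpace (𝓡 d) ((extChartAt (𝓡 d) p).symm u))
      (mfderiv 𝓘(ℝ, 𝔼) (𝓡 d) (extChartAt (𝓡 d) p).symm u w) =
    inner ℝ (fderiv ℝ (ι ∘ (extChartAt (𝓡 d) p).symm) u v)
      (fderiv ℝ (ι ∘ (extChartAt (𝓡 d) p).symm) u w) := by
  have hd := (hι.contMDiff.contMDiffAt (x := (extChartAt (𝓡 d) p).symm u)).mdifferentiableAt
    (by simp)
  rw [fderiv_comp_extChartAt_symm hu hd, fderiv_comp_extChartAt_symm hu hd]
  exact (hι.inner_mfderiv _ _ _).symm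

lemma metricMatrix_eq_gramMatrix (hι : IsIsometricEmbedding (d := d) ι) {p : M} {u : 𝔼}
    (hu : u ∈ (extChartAt (𝓡 d) p).target) :
    metricMatrix p u = gramMatrix (fderiv ℝ (ι ∘ (extChartAt (𝓡 d) p).symm) u) := by
  ext i j
  exact inner_mfderiv_extChartAt_symm hι hu _ _

lemma volumeDensity_eq_jac (hι : IsIsometricEmbedding (d := d) ι) {p : M} {u : 𝔼}
    (hu : u ∈ (extChartAt (𝓡 d) p).target) :
    volumeDensity p u = jac (fderiv ℝ (ι ∘ (extChartAt (𝓡 d) p).symm) u) := by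
  rw [volumeDensity, metricMatrix_eq_gramMatrix hι hu, jac]

lemma inner_riemannianGradient (f : M → ℝ) (x : M) (v : TangentSpace (𝓡 d) x) :
    inner ℝ (riemannianGradient d f x) v = mfderiv (𝓡 d) 𝓘(ℝ, ℝ) f x v := by
  have : FiniteDimensional ℝ (TangentSpace (𝓡 d) x) :=
    inferInstanceAs (FiniteDimensional ℝ (EuclideanSpace ℝ (Fin d)))
  have : CompleteSpace (TangentSpace (𝓡 d) x) := FiniteDimensional.complete ℝ _
  exact InnerProductSpace.toDual_symm_apply

/-- The chart sends the vectors `B eₖ` to an orthonormal basis of the tangent space. -/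
lemma inner_gradient_eq_sum (hι : IsIsometricEmbedding (d := d) ι) {p : M} {u : 𝔼}
    (hu : u ∈ (extChartAt (𝓡 d) p).target) {B : 𝔼 →L[ℝ] 𝔼}
    (hB : ∀ v, ‖fderiv ℝ (ι ∘ (extChartAt (𝓡 d) p).symm) u (B v)‖ = ‖v‖) {f h : M → ℝ}
    (hf : MDifferentiableAt (𝓡 d) 𝓘(ℝ, ℝ) f ((extChartAt (𝓡 d) p).symm u))
    (hh : MDifferentiableAt (𝓡 d) 𝓘(ℝ, ℝ) h ((extChartAt (𝓡 d) p).symm u)) :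
    inner ℝ (riemannianGradient d f ((extChartAt (𝓡 d) p).symm u))
      (riemannianGradient d h ((extChartAt (𝓡 d) p).symm u)) =
    ∑ k, fderiv ℝ (f ∘ (extChartAt (𝓡 d) p).symm) u (B (stdVec k)) *
      fderiv ℝ (h ∘ (extChartAt (𝓡 d) p).symm) u (B (stdVec k)) := by
  set x := (extChartAt (𝓡 d) p).symm u with hx
  have hfin : FiniteDimensional ℝ (TangentSpace (𝓡 d) x) :=
    inferInstanceAs (FiniteDimensional ℝ (EuclideanSpace ℝ (Fin d)))
  have hrank : Module.finrank ℝ (TangentSpace (𝓡 d) x) = d := by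
    have : Module.finrank ℝ (EuclideanSpace ℝ (Fin d)) = d := by simp
    exact this
  have hb : Orthonormal ℝ (fun k : Fin d => (mfderiv 𝓘(ℝ, 𝔼) (𝓡 d)
      (extChartAt (𝓡 d) p).symm u (B (stdVec k)) : TangentSpace (𝓡 d) x)) := by
    rw [orthonormal_iff_ite]
    intro i j
    have h1 := inner_mfderiv_extChartAt_symm hι hu (B (stdVec i)) (B (stdVec j))
    refine h1.trans ?_
    have h2 := congrFun (congrFun (gramMatrix_eq_one
      (A := (fderiv ℝ (ι ∘ (extChartAt (𝓡 d) p).symm) u) ∘L B) hB) i) j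
    rw [Matrix.one_apply] at h2
    exact h2
  rw [← sum_inner_mul_inner_of_orthonormal hrank hb]
  refine Finset.sum_congr rfl fun k _ => ?_
  rw [fderiv_comp_extChartAt_symm hu hf, fderiv_comp_extChartAt_symm hu hh,
    inner_riemannianGradient, real_inner_comm, inner_riemannianGradient]

lemma injective_fderiv_chart (hι : IsIsometricEmbedding (d := d) ι) {p : M} {u : 𝔼}
    (hu : u ∈ (extChartAt (𝓡 d) p).target) :
    Function.Injective (fderiv ℝ (ι ∘ (extChartAt (𝓡 d) p).symm) u) := by
  rw [injective_iff_map_eq_zero]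
  intro v hv
  have h1 := inner_mfderiv_extChartAt_symm hι hu v v
  rw [hv, inner_zero_left] at h1
  have h2 := inner_self_eq_zero.1 h1
  have h3 := (isInvertible_mfderivWithin_extChartAt_symm (I := 𝓡 d) hu).injective
  rw [ModelWithCorners.range_eq_univ, mfderivWithin_univ] at h3
  exact h3 (h2.trans (map_zero _).symm)

lemma inner_gradient_eq_sum_gramMatrix (hι : IsIsometricEmbedding (d := d) ι) {p : M} {u : 𝔼}
    (hu : u ∈ (extChartAt (𝓡 d) p).target) {f h : M → ℝ}
    (hf : MDifferentiableAt (𝓡 d) 𝓘(ℝ, ℝ) f ((extChartAt (𝓡 d) p).symm u))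
    (hh : MDifferentiableAt (𝓡 d) 𝓘(ℝ, ℝ) h ((extChartAt (𝓡 d) p).symm u)) :
    inner ℝ (riemannianGradient d f ((extChartAt (𝓡 d) p).symm u))
      (riemannianGradient d h ((extChartAt (𝓡 d) p).symm u)) =
    ∑ i, ∑ j, (gramMatrix (fderiv ℝ (ι ∘ (extChartAt (𝓡 d) p).symm) u))⁻¹ i j *
      (fderiv ℝ (f ∘ (extChartAt (𝓡 d) p).symm) u (stdVec i) *
      fderiv ℝ (h ∘ (extChartAt (𝓡 d) p).symm) u (stdVec j)) := by
  obtain ⟨T, hT⟩ := exists_isometric_precomp (injective_fderiv_chart hι hu)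
  rw [inner_gradient_eq_sum hι hu (B := T) hT hf hh]
  have := sum_bilin_comp_eq (B := (T : 𝔼 →L[ℝ] 𝔼)) hT
    ((ContinuousLinearMap.mul ℝ ℝ).bilinearComp (fderiv ℝ (f ∘ (extChartAt (𝓡 d) p).symm) u)
      (fderiv ℝ (h ∘ (extChartAt (𝓡 d) p).symm) u))
  exact this.symm

lemma laplaceBeltrami_eq (hι : IsIsometricEmbedding (d := d) ι) (f : M → ℝ) (x : M) :
    laplaceBeltrami d f x =
      (jac (fderiv ℝ (ι ∘ (extChartAt (𝓡 d) x).symm) (extChartAt (𝓡 d) x x)))⁻¹ *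
      ∑ i, fderiv ℝ (fun u => jac (fderiv ℝ (ι ∘ (extChartAt (𝓡 d) x).symm) u) *
        ∑ j, (gramMatrix (fderiv ℝ (ι ∘ (extChartAt (𝓡 d) x).symm) u))⁻¹ i j *
          fderiv ℝ (f ∘ (extChartAt (𝓡 d) x).symm) u (stdVec j)) (extChartAt (𝓡 d) x x)
          (stdVec i) := by
  rw [laplaceBeltrami, volumeDensity_eq_jac hι (mem_extChartAt_target x)]
  congr 1
  refine Finset.sum_congr rfl fun i _ => ?_
  congr 1
  refine Filter.EventuallyEq.fderiv_eq ?_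
  filter_upwards [extChartAt_target_mem_nhds_of_mem (mem_extChartAt_target (I := 𝓡 d) x)] with u hu
  rw [volumeDensity_eq_jac hι hu, metricMatrix_eq_gramMatrix hι hu]

/-- The Laplace–Beltrami operator in coordinates centred at a point whose Euclidean norm is the
extrinsic distance to the centre. -/
lemma laplaceBeltrami_of_radial (hι : IsIsometricEmbedding (d := d) ι) {p : M} {Θ : 𝔼 → 𝔼}
    (hΘ : ContDiffAt ℝ 3 Θ 0) (hu : Θ 0 ∈ (extChartAt (𝓡 d) p).target)
    (hr : ∀ᶠ v in 𝓝 0, ‖ι ((extChartAt (𝓡 d) p).symm (Θ v)) - ι ((extChartAt (𝓡 d) p).symm (Θ 0))‖ =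
      ‖v‖) {f : M → ℝ} (hf : ContMDiff (𝓡 d) 𝓘(ℝ, ℝ) 2 f) :
    ∑ i, fderiv ℝ (fderiv ℝ ((f ∘ (extChartAt (𝓡 d) p).symm) ∘ Θ)) 0 (stdVec i) (stdVec i) +
      2 * ∑ i, fderiv ℝ (fun v => jac (fderiv ℝ ((ι ∘ (extChartAt (𝓡 d) p).symm) ∘ Θ) v)) 0
        (stdVec i) * fderiv ℝ ((f ∘ (extChartAt (𝓡 d) p).symm) ∘ Θ) 0 (stdVec i) =
    laplaceBeltrami d f ((extChartAt (𝓡 d) p).symm (Θ 0)) := by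
  set φ := extChartAt (𝓡 d) p with hφ
  set x := φ.symm (Θ 0) with hx
  -- `laplaceBeltrami` is computed in the preferred chart at `x`, whereas `Θ` takes values in the
  -- chart at `p`; the transition map `τ` leads from one to the other.
  set τ : 𝔼 → 𝔼 := extChartAt (𝓡 d) x ∘ φ.symm with hτ
  have hxs : x ∈ (extChartAt (𝓡 d) x).source := mem_extChartAt_source x
  have hφc : ContMDiffAt 𝓘(ℝ, 𝔼) (𝓡 d) ∞ φ.symm (Θ 0) :=
    (contMDiffOn_extChartAt_symm (n := ∞) p).contMDiffAt (extChartAt_target_mem_nhds_of_mem hu)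
  have hτc : ContDiffAt ℝ ∞ τ (Θ 0) := by
    rw [← contMDiffAt_iff_contDiffAt]
    exact (contMDiffAt_extChartAt (I := 𝓡 d) (x := x) (n := ∞)).comp (Θ 0) hφc
  have hev : ∀ᶠ u in 𝓝 (Θ 0), (extChartAt (𝓡 d) x).symm (τ u) = φ.symm u := by
    have h1 : ∀ᶠ u in 𝓝 (Θ 0), φ.symm u ∈ (extChartAt (𝓡 d) x).source :=
      hφc.continuousAt.eventually (extChartAt_source_mem_nhds (I := 𝓡 d) x)
    filter_upwards [h1] with u hu
    exact (extChartAt (𝓡 d) x).left_inv hu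
  have hev' : ∀ᶠ v in 𝓝 (0 : 𝔼), (extChartAt (𝓡 d) x).symm (τ (Θ v)) = φ.symm (Θ v) :=
    hΘ.continuousAt.eventually hev
  rw [laplaceBeltrami_eq hι, ← laplacian_of_radial (Θ := τ ∘ Θ)
    (F := ι ∘ (extChartAt (𝓡 d) x).symm) (f := f ∘ (extChartAt (𝓡 d) x).symm)
    ((contDiffAt_comp_extChartAt_symm le_rfl hι.contMDiff (mem_extChartAt_target x)).of_le
      ENat.LEInfty.out)
    (contDiffAt_comp_extChartAt_symm ENat.LEInfty.out hf (mem_extChartAt_target x))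
    ((hτc.of_le ENat.LEInfty.out).comp 0 hΘ) rfl]
  · have e : ∀ {Y : Type} (g : M → Y), (g ∘ (extChartAt (𝓡 d) x).symm) ∘ (τ ∘ Θ) =ᶠ[𝓝 0]
        (g ∘ φ.symm) ∘ Θ := fun g => by
      filter_upwards [hev'] with v hv
      exact congrArg g hv
    have e1 := (e f).fderiv (𝕜 := ℝ)
    have e2 : (fun v => jac (fderiv ℝ ((ι ∘ (extChartAt (𝓡 d) x).symm) ∘ (τ ∘ Θ)) v)) =ᶠ[𝓝 0]
        fun v => jac (fderiv ℝ ((ι ∘ φ.symm) ∘ Θ) v) := by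
      filter_upwards [(e ι).fderiv (𝕜 := ℝ)] with v hv
      rw [hv]
    rw [e1.fderiv_eq, e1.self_of_nhds, e2.fderiv_eq]
  · filter_upwards [hr, hev'] with v hv hv'
    have h0 := hev'.self_of_nhds
    simp only [Function.comp_apply] at *
    rw [hv', extChartAt_to_inv, hv]

end ChartGeometry

/-! ### Tangential derivatives control derivatives in charts. -/

section TangentialDerivatives

attribute [local instance 2000] chartedSpaceSelf

variable {d D : ℕ} {M : Type*} [TopologicalSpace M] [ChartedSpace (EuclideanSpace ℝ (Fin d)) M]
  [IsManifold (𝓡 d) ∞ M] [RiemannianBundle (fun x : M => TangentSpace (𝓡 d) x)]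
  {ι : M → EuclideanSpace ℝ (Fin D)}

local notation "𝔼" => EuclideanSpace ℝ (Fin d)

lemma IsIsometricEmbedding.contMDiff_coord (hι : IsIsometricEmbedding (d := d) ι) (a : Fin D) :
    ContMDiff (𝓡 d) 𝓘(ℝ, ℝ) ∞ (fun y => ι y a) := by
  have h : ContMDiff 𝓘(ℝ, EuclideanSpace ℝ (Fin D)) 𝓘(ℝ, ℝ) ∞
      (EuclideanSpace.proj a : EuclideanSpace ℝ (Fin D) →L[ℝ] ℝ) :=
    ContinuousLinearMap.contMDiff _
  exact h.comp hι.contMDiff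

lemma fderiv_coord_chart (hι : IsIsometricEmbedding (d := d) ι) {p : M} {u : 𝔼}
    (hu : u ∈ (extChartAt (𝓡 d) p).target) (a : Fin D) (v : 𝔼) :
    fderiv ℝ ((fun y => ι y a) ∘ (extChartAt (𝓡 d) p).symm) u v =
      fderiv ℝ (ι ∘ (extChartAt (𝓡 d) p).symm) u v a := by
  have h1 := (contDiffAt_comp_extChartAt_symm le_rfl hι.contMDiff hu).differentiableAt
    (by simp)
  have h2 := ((EuclideanSpace.proj a : EuclideanSpace ℝ (Fin D) →L[ℝ] ℝ).hasFDerivAt.comp u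
    h1.hasFDerivAt).fderiv
  have h3 : ((fun y => ι y a) ∘ (extChartAt (𝓡 d) p).symm) =
      (EuclideanSpace.proj a : EuclideanSpace ℝ (Fin D) →L[ℝ] ℝ) ∘
        (ι ∘ (extChartAt (𝓡 d) p).symm) := rfl
  rw [h3, h2]
  rfl

lemma tangentialDeriv_chart_eq (hι : IsIsometricEmbedding (d := d) ι) {p : M} {u : 𝔼}
    (hu : u ∈ (extChartAt (𝓡 d) p).target) {f : M → ℝ} (hf : MDifferentiable (𝓡 d) 𝓘(ℝ, ℝ) f)
    (a : Fin D) :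
    (tangentialDeriv d ι a f ∘ (extChartAt (𝓡 d) p).symm) u =
    ∑ i, ∑ j, (gramMatrix (fderiv ℝ (ι ∘ (extChartAt (𝓡 d) p).symm) u))⁻¹ i j *
      (fderiv ℝ ((fun y => ι y a) ∘ (extChartAt (𝓡 d) p).symm) u (stdVec i) *
      fderiv ℝ (f ∘ (extChartAt (𝓡 d) p).symm) u (stdVec j)) :=
  inner_gradient_eq_sum_gramMatrix hι hu
    ((hι.contMDiff_coord a).mdifferentiable (by simp) _) (hf _)

lemma contDiffAt_tangentialDeriv_chart (hι : IsIsometricEmbedding (d := d) ι) {p : M} {u : 𝔼}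
    (hu : u ∈ (extChartAt (𝓡 d) p).target) {k : ℕ} {f : M → ℝ}
    (hf : ContMDiff (𝓡 d) 𝓘(ℝ, ℝ) (k + 1 : ℕ) f) (a : Fin D) :
    ContDiffAt ℝ k (tangentialDeriv d ι a f ∘ (extChartAt (𝓡 d) p).symm) u := by
  have hev : tangentialDeriv d ι a f ∘ (extChartAt (𝓡 d) p).symm =ᶠ[𝓝 u] fun u =>
      ∑ i, ∑ j, (gramMatrix (fderiv ℝ (ι ∘ (extChartAt (𝓡 d) p).symm) u))⁻¹ i j *
      (fderiv ℝ ((fun y => ι y a) ∘ (extChartAt (𝓡 d) p).symm) u (stdVec i) *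
      fderiv ℝ (f ∘ (extChartAt (𝓡 d) p).symm) u (stdVec j)) := by
    filter_upwards [extChartAt_target_mem_nhds_of_mem hu] with w hw
    exact tangentialDeriv_chart_eq hι hw (hf.mdifferentiable (by simp)) a
  refine ContDiffAt.congr_of_eventuallyEq ?_ hev
  have hkk : (k : WithTop ℕ∞) + 1 ≤ ∞ := ENat.LEInfty.out (m := ((k + 1 : ℕ) : WithTop ℕ∞))
  have hF : ContDiffAt ℝ k (fderiv ℝ (ι ∘ (extChartAt (𝓡 d) p).symm)) u :=
    ((contDiffAt_comp_extChartAt_symm le_rfl hι.contMDiff hu).of_le hkk).fderiv_right le_rfl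
  have hFa : ContDiffAt ℝ k (fderiv ℝ ((fun y => ι y a) ∘ (extChartAt (𝓡 d) p).symm)) u :=
    ((contDiffAt_comp_extChartAt_symm le_rfl (hι.contMDiff_coord a) hu).of_le hkk).fderiv_right
      le_rfl
  have hff : ContDiffAt ℝ k (fderiv ℝ (f ∘ (extChartAt (𝓡 d) p).symm)) u :=
    (contDiffAt_comp_extChartAt_symm ENat.LEInfty.out hf hu).fderiv_right le_rfl
  exact ContDiffAt.sum fun i _ => ContDiffAt.sum fun j _ =>
    (hF.gramMatrix_inv (injective_fderiv_chart hι hu) i j).mul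
      ((hFa.clm_apply contDiffAt_const).mul (hff.clm_apply contDiffAt_const))

lemma contMDiffAt_of_contDiffAt_chart {Y : Type*} [NormedAddCommGroup Y] [NormedSpace ℝ Y]
    {n : ℕ} {g : M → Y} {p : M}
    (h : ContDiffAt ℝ n (g ∘ (extChartAt (𝓡 d) p).symm) (extChartAt (𝓡 d) p p)) :
    ContMDiffAt (𝓡 d) 𝓘(ℝ, Y) n g p := by
  have h1 : ContMDiffAt (𝓡 d) 𝓘(ℝ, 𝔼) n (extChartAt (𝓡 d) p) p :=
    (contMDiffAt_extChartAt (I := 𝓡 d) (x := p) (n := ∞)).of_le ENat.LEInfty.out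
  refine (h.contMDiffAt.comp p h1).congr_of_eventuallyEq ?_
  filter_upwards [extChartAt_source_mem_nhds (I := 𝓡 d) p] with y hy
  simp only [Function.comp_apply]
  rw [(extChartAt (𝓡 d) p).left_inv hy]

lemma contMDiff_tangentialDeriv (hι : IsIsometricEmbedding (d := d) ι) {k : ℕ} {f : M → ℝ}
    (hf : ContMDiff (𝓡 d) 𝓘(ℝ, ℝ) (k + 1 : ℕ) f) (a : Fin D) :
    ContMDiff (𝓡 d) 𝓘(ℝ, ℝ) k (tangentialDeriv d ι a f) := fun p =>
  contMDiffAt_of_contDiffAt_chart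
    (contDiffAt_tangentialDeriv_chart hι (mem_extChartAt_target p) hf a)

/-- The differential of a function is the combination of the differentials of the coordinates of
`ι` whose coefficients are the tangential derivatives. -/
lemma fderiv_chart_eq_sum_tangentialDeriv (hι : IsIsometricEmbedding (d := d) ι) {p : M} {u : 𝔼}
    (hu : u ∈ (extChartAt (𝓡 d) p).target) {f : M → ℝ} (hf : MDifferentiable (𝓡 d) 𝓘(ℝ, ℝ) f) :
    fderiv ℝ (f ∘ (extChartAt (𝓡 d) p).symm) u =
    ∑ a, (tangentialDeriv d ι a f ∘ (extChartAt (𝓡 d) p).symm) u •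
      fderiv ℝ ((fun y => ι y a) ∘ (extChartAt (𝓡 d) p).symm) u := by
  obtain ⟨T, hT⟩ := exists_isometric_precomp (injective_fderiv_chart hι hu)
  have h1 : ∀ a, (tangentialDeriv d ι a f ∘ (extChartAt (𝓡 d) p).symm) u =
      ∑ k, fderiv ℝ (ι ∘ (extChartAt (𝓡 d) p).symm) u (T (stdVec k)) a *
      fderiv ℝ (f ∘ (extChartAt (𝓡 d) p).symm) u (T (stdVec k)) := fun a => by
    have := inner_gradient_eq_sum hι hu (B := (T : 𝔼 →L[ℝ] 𝔼)) hT
      ((hι.contMDiff_coord a).mdifferentiable (by simp) _) (hf _)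
    refine this.trans (Finset.sum_congr rfl fun k _ => ?_)
    rw [fderiv_coord_chart hι hu]
    rfl
  have h2 := gramMatrix_eq_one (A := fderiv ℝ (ι ∘ (extChartAt (𝓡 d) p).symm) u ∘L
    (T : 𝔼 →L[ℝ] 𝔼)) hT
  have h3 : ∀ v, fderiv ℝ (f ∘ (extChartAt (𝓡 d) p).symm) u (T v) =
      ∑ a, (tangentialDeriv d ι a f ∘ (extChartAt (𝓡 d) p).symm) u *
        fderiv ℝ ((fun y => ι y a) ∘ (extChartAt (𝓡 d) p).symm) u (T v) := fun v => by
    suffices h : ∀ i, fderiv ℝ (f ∘ (extChartAt (𝓡 d) p).symm) u (T (stdVec i)) =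
        ∑ a, (tangentialDeriv d ι a f ∘ (extChartAt (𝓡 d) p).symm) u *
        fderiv ℝ ((fun y => ι y a) ∘ (extChartAt (𝓡 d) p).symm) u (T (stdVec i)) by
      rw [← sum_smul_stdVec v]
      simp only [map_sum, map_smul, smul_eq_mul, Finset.mul_sum, h]
      rw [Finset.sum_comm]
      exact Finset.sum_congr rfl fun a _ => Finset.sum_congr rfl fun i _ => by ring
    intro i
    simp only [h1, fderiv_coord_chart hι hu, Finset.sum_mul]
    rw [Finset.sum_comm]
    -- Orthonormality of the image frame, written in the coordinates of `ℝᴰ`, collapses the double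
    -- sum.
    have h4 : ∀ k, ∑ a, fderiv ℝ (ι ∘ (extChartAt (𝓡 d) p).symm) u (T (stdVec k)) a *
        fderiv ℝ (ι ∘ (extChartAt (𝓡 d) p).symm) u (T (stdVec i)) a =
        if i = k then 1 else 0 := fun k => by
      have h5 := congrFun (congrFun h2 i) k
      rw [Matrix.one_apply] at h5
      rw [← h5, gramMatrix_apply, PiLp.inner_apply]
      rfl
    calc fderiv ℝ (f ∘ (extChartAt (𝓡 d) p).symm) u (T (stdVec i))
        = ∑ k, fderiv ℝ (f ∘ (extChartAt (𝓡 d) p).symm) u (T (stdVec k)) *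
          (if i = k then 1 else 0) := by simp
      _ = _ := by
          refine Finset.sum_congr rfl fun k _ => ?_
          rw [← h4, Finset.mul_sum]
          exact Finset.sum_congr rfl fun a _ => by ring
  ext v
  have h6 := h3 (T.symm v)
  rw [T.apply_symm_apply] at h6
  rw [h6]
  simp

/-- The recursion exposes the outermost derivative; induction on the order needs the innermost one.
-/
lemma iteratedTangentialDeriv_append (l : List (Fin D)) (a : Fin D) (f : M → ℝ) :
    iteratedTangentialDeriv d ι (l ++ [a]) f =
      iteratedTangentialDeriv d ι l (tangentialDeriv d ι a f) := by
  induction l with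
  | nil => rfl
  | cons b l ih =>
    rw [List.cons_append, iteratedTangentialDeriv, ih, iteratedTangentialDeriv]

lemma CkNormLE.tangentialDeriv {k : ℕ} {f : M → ℝ} {A : ℝ} (h : CkNormLE d ι (k + 1) f A)
    (a : Fin D) : CkNormLE d ι k (tangentialDeriv d ι a f) A := fun l hl x => by
  rw [← iteratedTangentialDeriv_append]
  exact h _ (by simpa using hl) x

lemma CkNormLE.nonneg {k : ℕ} {f : M → ℝ} {A : ℝ} (h : CkNormLE d ι k f A) (p : M) : 0 ≤ A :=
  (abs_nonneg _).trans (h [] (Nat.zero_le _) p)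

/-- The `Cᵏ` norm defined by tangential derivatives controls the derivatives in a chart. -/
lemma exists_ckAt_chart (hι : IsIsometricEmbedding (d := d) ι) (p : M) (k : ℕ) :
    ∃ C : ℝ, 0 ≤ C ∧ ∀ᶠ u in 𝓝 (extChartAt (𝓡 d) p p), ∀ (f : M → ℝ) (A : ℝ),
      ContMDiff (𝓡 d) 𝓘(ℝ, ℝ) k f → CkNormLE d ι k f A →
      CkAt k (f ∘ (extChartAt (𝓡 d) p).symm) (C * A) u := by
  have htar : ∀ᶠ u in 𝓝 (extChartAt (𝓡 d) p p), u ∈ (extChartAt (𝓡 d) p).target :=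
    extChartAt_target_mem_nhds_of_mem (mem_extChartAt_target (I := 𝓡 d) p)
  induction k with
  | zero =>
    refine ⟨1, zero_le_one, ?_⟩
    filter_upwards [htar] with u hu f A hf hA
    refine ⟨contDiffAt_comp_extChartAt_symm ENat.LEInfty.out hf hu, fun i hi => ?_⟩
    obtain rfl : i = 0 := by omega
    rw [norm_iteratedFDeriv_zero, one_mul]
    exact hA [] le_rfl ((extChartAt (𝓡 d) p).symm u)
  | succ k ih =>
    obtain ⟨C, hC, hev⟩ := ih
    have h1 : ∀ a : Fin D, ∃ E : ℝ, 1 ≤ E ∧ ∀ᶠ u in 𝓝 (extChartAt (𝓡 d) p p),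
        CkAt k (fderiv ℝ ((fun y => ι y a) ∘ (extChartAt (𝓡 d) p).symm)) E u := fun a =>
      ContDiffAt.exists_ckAt ((contDiffAt_comp_extChartAt_symm le_rfl (hι.contMDiff_coord a)
        (mem_extChartAt_target p)).fderiv_right (m := k)
        (ENat.LEInfty.out (m := ((k + 1 : ℕ) : WithTop ℕ∞))))
    choose E hE1 hE using h1
    have hE0 : ∀ a, 0 ≤ E a := fun a => zero_le_one.trans (hE1 a)
    set E' := ∑ a, E a with hE'
    have hEle : ∀ a, E a ≤ E' := fun a =>
      Finset.single_le_sum (fun i _ => hE0 i) (Finset.mem_univ a)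
    have hE'0 : 0 ≤ E' := Finset.sum_nonneg fun i _ => hE0 i
    -- The summand `1` covers the value of `f`. The rest covers its differential, a sum of `D`
    -- products of a tangential derivative (bound `C A`) and `dιₐ` (bound `E'`), each with the
    -- Leibniz factor `2 ^ k`.
    refine ⟨1 + (Finset.univ : Finset (Fin D)).card * (2 ^ k * C * E'), by positivity, ?_⟩
    filter_upwards [htar, hev, Filter.eventually_all.2 hE] with u hu hev' hE' f A hf hA
    have hA0 := hA.nonneg p
    have hfd : MDifferentiable (𝓡 d) 𝓘(ℝ, ℝ) f := hf.mdifferentiable (by simp)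
    refine CkAt.of_fderiv (contDiffAt_comp_extChartAt_symm ENat.LEInfty.out hf hu) ?_ ?_
    · refine (hA [] (Nat.zero_le _) ((extChartAt (𝓡 d) p).symm u)).trans ?_
      refine le_mul_of_one_le_left hA0 (le_add_of_nonneg_right ?_)
      positivity
    · have h2 := CkAt.sum Finset.univ fun (a : Fin D) _ =>
        ((hev' (tangentialDeriv d ι a f) A (contMDiff_tangentialDeriv hι hf a)
          (hA.tangentialDeriv a)).smul ((hE' a).mono (hEle a)))
      refine (h2.mono ?_).congr ?_
      · have : 0 ≤ A := hA0
        nlinarith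
      · filter_upwards [extChartAt_target_mem_nhds_of_mem hu] with w hw
        exact fderiv_chart_eq_sum_tangentialDeriv hι hw hfd

end TangentialDerivatives

/-! ### Continuity of the density and measurable preimages. -/

section Measurability

lemma jac_nonneg {d : ℕ} {N : Type*} [NormedAddCommGroup N] [InnerProductSpace ℝ N]
    (A : EuclideanSpace ℝ (Fin d) →L[ℝ] N) : 0 ≤ jac A := Real.sqrt_nonneg _

lemma continuous_jac {d : ℕ} {N : Type*} [NormedAddCommGroup N] [InnerProductSpace ℝ N] :
    Continuous (jac : (EuclideanSpace ℝ (Fin d) →L[ℝ] N) → ℝ) := by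
  have h : Continuous fun A : EuclideanSpace ℝ (Fin d) →L[ℝ] N => gramMatrix A :=
    continuous_matrix fun i j => by
      simp only [gramMatrix_apply]
      fun_prop
  exact h.matrix_det.sqrt

lemma ContinuousOn.measurableSet_inter_preimage {X Y : Type*} [TopologicalSpace X]
    [MeasurableSpace X] [OpensMeasurableSpace X] [TopologicalSpace Y] [MeasurableSpace Y]
    [BorelSpace Y] {f : X → Y} {s : Set X} (hf : ContinuousOn f s) (hs : MeasurableSet s)
    {t : Set Y} (ht : MeasurableSet t) : MeasurableSet (s ∩ f ⁻¹' t) := by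
  have h := hs.subtype_image (hf.domRestrict.measurable ht)
  rwa [show (s.domRestrict f) ⁻¹' t = ((↑) : s → X) ⁻¹' (f ⁻¹' t) from rfl,
    Subtype.image_preimage_coe] at h

end Measurability

/-! ### The Riemannian volume and its change of variables. -/

section RiemannianVolume

attribute [local instance 2000] chartedSpaceSelf

variable {d D : ℕ} {M : Type*} [TopologicalSpace M] [ChartedSpace (EuclideanSpace ℝ (Fin d)) M]
  [IsManifold (𝓡 d) ∞ M] [RiemannianBundle (fun x : M => TangentSpace (𝓡 d) x)]
  [MeasurableSpace M] [BorelSpace M] {ι : M → EuclideanSpace ℝ (Fin D)}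

local notation "𝔼" => EuclideanSpace ℝ (Fin d)

lemma chartVolume_apply (hι : IsIsometricEmbedding (d := d) ι) (p : M) {S : Set M}
    (hS : MeasurableSet S) :
    chartVolume (d := d) p S = ∫⁻ u in (extChartAt (𝓡 d) p).symm ⁻¹' S ∩
      (extChartAt (𝓡 d) p).target,
      ENNReal.ofReal (jac (fderiv ℝ (ι ∘ (extChartAt (𝓡 d) p).symm) u)) := by
  have ht : MeasurableSet (extChartAt (𝓡 d) p).target := (isOpen_extChartAt_target p).measurableSet
  have hm : AEMeasurable (extChartAt (𝓡 d) p).symm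
      ((volume.restrict (extChartAt (𝓡 d) p).target).withDensity
        fun u => ENNReal.ofReal (volumeDensity p u)) :=
    ((continuousOn_extChartAt_symm p).aemeasurable ht).mono_ac
      (withDensity_absolutelyContinuous _ _)
  rw [chartVolume, Measure.map_apply_of_aemeasurable hm hS, withDensity_apply',
    Measure.restrict_restrict' ht]
  have hmeas : MeasurableSet ((extChartAt (𝓡 d) p).symm ⁻¹' S ∩ (extChartAt (𝓡 d) p).target) := by
    rw [Set.inter_comm]
    exact ContinuousOn.measurableSet_inter_preimage (continuousOn_extChartAt_symm p) ht hS
  refine setLIntegral_congr_fun hmeas fun u hu => ?_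
  rw [volumeDensity_eq_jac hι hu.2]

/-- The factor `|det dΘ|` merges with the chart density by `jac_comp`, so only the composite map
into `ℝᴰ` enters. -/
lemma chartVolume_apply_parametrization (hι : IsIsometricEmbedding (d := d) ι) (p : M)
    {Θ : 𝔼 → 𝔼} {B : Set 𝔼} (hB : MeasurableSet B) (hd : ∀ v ∈ B, DifferentiableAt ℝ Θ v)
    (hinj : Set.InjOn Θ B) (hmaps : ∀ v ∈ B, Θ v ∈ (extChartAt (𝓡 d) p).target)
    {S : Set M} (hS : MeasurableSet S) (hSB : S ⊆ (fun v => (extChartAt (𝓡 d) p).symm (Θ v)) '' B) :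
    chartVolume (d := d) p S = ∫⁻ v in B ∩ (fun v => (extChartAt (𝓡 d) p).symm (Θ v)) ⁻¹' S,
      ENNReal.ofReal (jac (fderiv ℝ (fun v => ι ((extChartAt (𝓡 d) p).symm (Θ v))) v)) := by
  set φ := extChartAt (𝓡 d) p with hφ
  have himage : φ.symm ⁻¹' S ∩ φ.target = Θ '' (B ∩ (fun v => φ.symm (Θ v)) ⁻¹' S) := by
    ext w
    constructor
    · rintro ⟨hw, hwt⟩
      obtain ⟨v, hv, hvw⟩ := hSB hw
      have : Θ v = w := φ.symm.injOn (hmaps v hv) hwt hvw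
      exact ⟨v, ⟨hv, by simpa [hvw] using hw⟩, this⟩
    · rintro ⟨v, ⟨hv, hvS⟩, rfl⟩
      exact ⟨hvS, hmaps v hv⟩
  have hcont : ContinuousOn (fun v => φ.symm (Θ v)) B :=
    (continuousOn_extChartAt_symm p).comp (fun v hv => (hd v hv).continuousAt.continuousWithinAt)
      hmaps
  have hmeas : MeasurableSet (B ∩ (fun v => φ.symm (Θ v)) ⁻¹' S) :=
    hcont.measurableSet_inter_preimage hB hS
  rw [chartVolume_apply hι p hS, himage,
    lintegral_image_eq_lintegral_abs_det_fderiv_mul volume hmeas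
      (fun v hv => (hd v hv.1).hasFDerivAt.hasFDerivWithinAt) (hinj.mono Set.inter_subset_left)]
  refine setLIntegral_congr_fun hmeas fun v hv => ?_
  have h1 : fderiv ℝ (fun v => ι (φ.symm (Θ v))) v =
      fderiv ℝ (ι ∘ φ.symm) (Θ v) ∘L fderiv ℝ Θ v :=
    fderiv_comp v ((contDiffAt_comp_extChartAt_symm le_rfl hι.contMDiff
      (hmaps v hv.1)).differentiableAt (by simp)) (hd v hv.1)
  rw [h1, jac_comp, ENNReal.ofReal_mul (abs_nonneg _)]

/-- Parametrize the chart at `q` by the transition map from the chart at `p`: the composite with `ι`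
is locally the same map, so the densities coincide. -/
lemma chartVolume_eq_of_subset (hι : IsIsometricEmbedding (d := d) ι) (p q : M) {S : Set M}
    (hS : MeasurableSet S) (hp : S ⊆ (extChartAt (𝓡 d) p).source)
    (hq : S ⊆ (extChartAt (𝓡 d) q).source) :
    chartVolume (d := d) q S = chartVolume (d := d) p S := by
  set φ := extChartAt (𝓡 d) p with hφ
  set ψ := extChartAt (𝓡 d) q with hψ
  set B : Set 𝔼 := φ.target ∩ φ.symm ⁻¹' S with hBdef
  have hB : MeasurableSet B := ContinuousOn.measurableSet_inter_preimage (continuousOn_extChartAt_symm p)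
    (isOpen_extChartAt_target p).measurableSet hS
  have hev : ∀ v ∈ B, (fun w => ψ.symm (ψ (φ.symm w))) =ᶠ[𝓝 v] φ.symm := fun v hv => by
    have h1 : ∀ᶠ w in 𝓝 v, φ.symm w ∈ ψ.source :=
      ((continuousOn_extChartAt_symm p).continuousAt
        (extChartAt_target_mem_nhds_of_mem hv.1)).eventually
        ((isOpen_extChartAt_source q).mem_nhds (hq hv.2))
    filter_upwards [h1] with w hw using ψ.left_inv hw
  have hdiff : ∀ v ∈ B, DifferentiableAt ℝ (fun w => ψ (φ.symm w)) v := fun v hv => by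
    have h1 : ContMDiffAt 𝓘(ℝ, 𝔼) (𝓡 d) ∞ φ.symm v :=
      (contMDiffOn_extChartAt_symm (n := ∞) p).contMDiffAt
        (extChartAt_target_mem_nhds_of_mem hv.1)
    have h2 : ContMDiffAt (𝓡 d) 𝓘(ℝ, 𝔼) ∞ ψ (φ.symm v) :=
      contMDiffAt_extChartAt' (by simpa [hψ] using hq hv.2)
    exact (h2.comp v h1).contDiffAt.differentiableAt (by simp)
  rw [chartVolume_apply_parametrization hι q (Θ := fun w => ψ (φ.symm w)) (B := B) hB hdiff ?_ ?_ hS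
    ?_, chartVolume_apply hι p hS]
  · have h1 : B ∩ (fun v => ψ.symm (ψ (φ.symm v))) ⁻¹' S = φ.symm ⁻¹' S ∩ φ.target := by
      ext v
      constructor
      · rintro ⟨hv, -⟩
        exact ⟨hv.2, hv.1⟩
      · rintro ⟨hv, hv'⟩
        refine ⟨⟨hv', hv⟩, ?_⟩
        simp only [Set.mem_preimage]
        rw [ψ.left_inv (hq hv)]
        exact hv
    rw [h1]
    refine setLIntegral_congr_fun (by rwa [Set.inter_comm]) fun v hv => ?_
    have h2 : (fun w => ι (ψ.symm (ψ (φ.symm w)))) =ᶠ[𝓝 v] ι ∘ φ.symm :=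
      (hev v ⟨hv.2, hv.1⟩).fun_comp ι
    show ENNReal.ofReal (jac (fderiv ℝ (fun w => ι (ψ.symm (ψ (φ.symm w)))) v)) = _
    rw [h2.fderiv_eq]
  · intro v hv w hw hvw
    exact φ.symm.injOn hv.1 hw.1 (ψ.injOn (hq hv.2) (hq hw.2) hvw)
  · exact fun v hv => ψ.map_source (hq hv.2)
  · intro y hy
    refine ⟨φ y, ⟨φ.map_source (hp hy), ?_⟩, ?_⟩
    · rwa [Set.mem_preimage, φ.left_inv (hp hy)]
    · show ψ.symm (ψ (φ.symm (φ y))) = y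
      rw [φ.left_inv (hp hy), ψ.left_inv (hq hy)]

lemma chartVolume_eq_zero_of_disjoint (hι : IsIsometricEmbedding (d := d) ι) (p : M) {S : Set M}
    (hS : MeasurableSet S) (hp : Disjoint S (extChartAt (𝓡 d) p).source) :
    chartVolume (d := d) p S = 0 := by
  rw [chartVolume_apply hι p hS]
  have : (extChartAt (𝓡 d) p).symm ⁻¹' S ∩ (extChartAt (𝓡 d) p).target = ∅ := by
    ext w
    simp only [Set.mem_inter_iff, Set.mem_preimage, Set.mem_empty_iff_false, iff_false, not_and]
    intro hw hwt
    exact hp.le_bot ⟨hw, (extChartAt (𝓡 d) p).map_target hwt⟩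
  rw [this]
  simp

lemma chartVolume_inter_source (hι : IsIsometricEmbedding (d := d) ι) (p : M) {S : Set M}
    (hS : MeasurableSet S) :
    chartVolume (d := d) p (S ∩ (extChartAt (𝓡 d) p).source) = chartVolume (d := d) p S := by
  have hs : MeasurableSet (extChartAt (𝓡 d) p).source := (isOpen_extChartAt_source p).measurableSet
  rw [← measure_inter_add_sdiff S hs, chartVolume_eq_zero_of_disjoint hι p (hS.diff hs)
    Set.disjoint_sdiff_left, add_zero]

/-- The chart volumes are the restrictions of the Riemannian volume. -/
lemma riemannianVolume_apply [CompactSpace M] (hι : IsIsometricEmbedding (d := d) ι) (p : M)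
    {S : Set M} (hS : MeasurableSet S) (hp : S ⊆ (extChartAt (𝓡 d) p).source) :
    riemannianVolume d M S = chartVolume (d := d) p S := by
  have hsm : ∀ q : M, MeasurableSet (extChartAt (𝓡 d) q).source := fun q =>
    (isOpen_extChartAt_source q).measurableSet
  obtain ⟨t, ht⟩ := isCompact_univ.elim_finite_subcover
    (fun q : M => (extChartAt (𝓡 d) q).source) (fun q => isOpen_extChartAt_source q)
    (fun x _ => Set.mem_iUnion.2 ⟨x, mem_extChartAt_source x⟩)
  -- A measure that dominates every chart volume and agrees with the one at `p` on its chart domain.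
  -- Off this domain a finite cover gives an upper bound, and counting overlaps several times is
  -- harmless there.
  set ν : Measure M := chartVolume (d := d) p +
    (∑ q ∈ t, chartVolume (d := d) q).restrict (extChartAt (𝓡 d) p).sourceᶜ with hν
  have hle : riemannianVolume d M ≤ ν := by
    refine iSup_le fun q => Measure.le_iff.2 fun T hT => ?_
    rw [← measure_inter_add_sdiff T (hsm p), hν, Measure.add_apply,
      Measure.restrict_apply hT, ← Set.sdiff_eq]
    refine add_le_add ?_ ?_
    · have hT' := hT.inter (hsm p)
      rw [← chartVolume_inter_source hι q hT', chartVolume_eq_of_subset hι p q (hT'.inter (hsm q))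
        (Set.inter_subset_left.trans Set.inter_subset_right) Set.inter_subset_right]
      exact measure_mono (Set.inter_subset_left.trans Set.inter_subset_left)
    · have hT' := hT.diff (hsm p)
      set T' := T \ (extChartAt (𝓡 d) p).source
      rw [← chartVolume_inter_source hι q hT', Measure.finsetSum_apply]
      have hcov : T' ∩ (extChartAt (𝓡 d) q).source ⊆
          ⋃ r ∈ t, T' ∩ (extChartAt (𝓡 d) q).source ∩ (extChartAt (𝓡 d) r).source := by
        intro y hy
        obtain ⟨r, hr, hyr⟩ := Set.mem_iUnion₂.1 (ht (Set.mem_univ y))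
        exact Set.mem_iUnion₂.2 ⟨r, hr, hy, hyr⟩
      refine (measure_mono hcov).trans ((measure_biUnion_finset_le _ _).trans
        (Finset.sum_le_sum fun r _ => ?_))
      rw [chartVolume_eq_of_subset hι r q ((hT'.inter (hsm q)).inter (hsm r))
        Set.inter_subset_right (Set.inter_subset_left.trans Set.inter_subset_right)]
      exact measure_mono (Set.inter_subset_left.trans Set.inter_subset_left)
  refine le_antisymm ((hle S).trans ?_) (le_iSup (fun q : M => chartVolume (d := d) q) p S)
  have h0 : S ∩ (extChartAt (𝓡 d) p).sourceᶜ = ∅ :=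
    (Set.disjoint_compl_right_iff_subset.2 hp).inter_eq
  rw [hν, Measure.add_apply, Measure.restrict_apply hS, h0]
  simp

lemma restrict_riemannianVolume_eq_map [CompactSpace M] (hι : IsIsometricEmbedding (d := d) ι)
    (p : M) {Θ : 𝔼 → 𝔼} {B : Set 𝔼} (hB : MeasurableSet B)
    (hd : ∀ v ∈ B, DifferentiableAt ℝ Θ v)
    (hinj : Set.InjOn Θ B) (hmaps : ∀ v ∈ B, Θ v ∈ (extChartAt (𝓡 d) p).target)
    {U : Set M} (hU : MeasurableSet U)
    (hUB : U = (fun v => (extChartAt (𝓡 d) p).symm (Θ v)) '' B) :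
    (riemannianVolume d M).restrict U = ((volume.restrict B).withDensity fun v =>
      ENNReal.ofReal (jac (fderiv ℝ (fun v => ι ((extChartAt (𝓡 d) p).symm (Θ v))) v))).map
      (fun v => (extChartAt (𝓡 d) p).symm (Θ v)) := by
  have hcont : ContinuousOn (fun v => (extChartAt (𝓡 d) p).symm (Θ v)) B :=
    (continuousOn_extChartAt_symm p).comp (fun v hv => (hd v hv).continuousAt.continuousWithinAt)
      hmaps
  have hm : AEMeasurable (fun v => (extChartAt (𝓡 d) p).symm (Θ v))
      ((volume.restrict B).withDensity fun v =>
      ENNReal.ofReal (jac (fderiv ℝ (fun v => ι ((extChartAt (𝓡 d) p).symm (Θ v))) v))) :=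
    (hcont.aemeasurable hB).mono_ac (withDensity_absolutelyContinuous _ _)
  have hUs : U ⊆ (extChartAt (𝓡 d) p).source := by
    rw [hUB]
    rintro _ ⟨v, hv, rfl⟩
    exact (extChartAt (𝓡 d) p).map_target (hmaps v hv)
  ext S hS
  rw [Measure.restrict_apply hS, Measure.map_apply_of_aemeasurable hm hS, withDensity_apply',
    riemannianVolume_apply hι p (hS.inter hU) (Set.inter_subset_right.trans hUs),
    chartVolume_apply_parametrization hι p hB hd hinj hmaps (hS.inter hU)
      (Set.inter_subset_right.trans hUB.subset), Measure.restrict_restrict' hB]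
  have : B ∩ (fun v => (extChartAt (𝓡 d) p).symm (Θ v)) ⁻¹' (S ∩ U) =
      (fun v => (extChartAt (𝓡 d) p).symm (Θ v)) ⁻¹' S ∩ B := by
    ext v
    simp only [Set.mem_inter_iff, Set.mem_preimage]
    constructor
    · rintro ⟨hv, h1, -⟩
      exact ⟨h1, hv⟩
    · rintro ⟨h1, hv⟩
      refine ⟨hv, h1, ?_⟩
      rw [hUB]
      exact ⟨v, hv, rfl⟩
  rw [this]

/-- The change of variables formula for the Riemannian volume. -/
lemma setIntegral_riemannianVolume_eq [CompactSpace M] (hι : IsIsometricEmbedding (d := d) ι)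
    (p : M) {Θ : 𝔼 → 𝔼} {B : Set 𝔼} (hB : MeasurableSet B)
    (hd : ∀ v ∈ B, ContDiffAt ℝ 1 Θ v)
    (hinj : Set.InjOn Θ B) (hmaps : ∀ v ∈ B, Θ v ∈ (extChartAt (𝓡 d) p).target)
    {U : Set M} (hU : MeasurableSet U)
    (hUB : U = (fun v => (extChartAt (𝓡 d) p).symm (Θ v)) '' B) {g : M → ℝ} (hg : Measurable g) :
    ∫ y in U, g y ∂(riemannianVolume d M) =
      ∫ v in B, jac (fderiv ℝ (fun v => ι ((extChartAt (𝓡 d) p).symm (Θ v))) v) *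
        g ((extChartAt (𝓡 d) p).symm (Θ v)) := by
  have hd' : ∀ v ∈ B, DifferentiableAt ℝ Θ v := fun v hv => (hd v hv).differentiableAt one_ne_zero
  have hcont : ContinuousOn (fun v => (extChartAt (𝓡 d) p).symm (Θ v)) B :=
    (continuousOn_extChartAt_symm p).comp (fun v hv => (hd v hv).continuousAt.continuousWithinAt)
      hmaps
  rw [restrict_riemannianVolume_eq_map hι p hB hd' hinj hmaps hU hUB, integral_map
    ((hcont.aemeasurable hB).mono_ac (withDensity_absolutelyContinuous _ _))
    hg.aestronglyMeasurable]
  have hjc : ContinuousOn (fun v =>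
      jac (fderiv ℝ (fun v => ι ((extChartAt (𝓡 d) p).symm (Θ v))) v)) B := fun v hv => by
    have h1 : ContDiffAt ℝ 1 (fun v => ι ((extChartAt (𝓡 d) p).symm (Θ v))) v :=
      ((contDiffAt_comp_extChartAt_symm le_rfl hι.contMDiff (hmaps v hv)).of_le
        ENat.LEInfty.out).comp v (hd v hv)
    have h2 : ContDiffAt ℝ 0 (fderiv ℝ (fun v => ι ((extChartAt (𝓡 d) p).symm (Θ v)))) v :=
      h1.fderiv_right (by simp)
    exact (continuous_jac.continuousAt.comp h2.continuousAt).continuousWithinAt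
  rw [integral_withDensity_eq_integral_toReal_smul₀
    (hjc.aemeasurable hB).ennreal_ofReal (by simp)]
  refine setIntegral_congr_fun hB fun v _ => ?_
  rw [ENNReal.toReal_ofReal (jac_nonneg _), smul_eq_mul]

/-- The density is continuous, hence bounded near every point; compactness does the rest. -/
lemma isFiniteMeasure_riemannianVolume [CompactSpace M] (hι : IsIsometricEmbedding (d := d) ι) :
    IsFiniteMeasure (riemannianVolume d M) := by
  have hloc : IsLocallyFiniteMeasure (riemannianVolume d M) := by
    refine ⟨fun p => ?_⟩
    set F := ι ∘ (extChartAt (𝓡 d) p).symm with hF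
    have hc : ContinuousAt (fun u => jac (fderiv ℝ F u)) (extChartAt (𝓡 d) p p) := by
      have h2 : ContDiffAt ℝ 0 (fderiv ℝ F) (extChartAt (𝓡 d) p p) :=
        (contDiffAt_comp_extChartAt_symm le_rfl hι.contMDiff
          (mem_extChartAt_target p)).fderiv_right (ENat.LEInfty.out (m := 1))
      exact continuous_jac.continuousAt.comp h2.continuousAt
    have hev := hc.eventually_le_const (lt_add_one _)
    obtain ⟨r, hr, hball⟩ := Metric.eventually_nhds_iff_ball.1 hev
    have hU : IsOpen ((extChartAt (𝓡 d) p).source ∩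
        (extChartAt (𝓡 d) p) ⁻¹' Metric.ball (extChartAt (𝓡 d) p p) r) :=
      (continuousOn_extChartAt p).isOpen_inter_preimage (isOpen_extChartAt_source p)
        Metric.isOpen_ball
    refine ⟨_, hU.mem_nhds ⟨mem_extChartAt_source p, Metric.mem_ball_self hr⟩, ?_⟩
    rw [riemannianVolume_apply hι p hU.measurableSet Set.inter_subset_left,
      chartVolume_apply hι p hU.measurableSet]
    calc _ ≤ ∫⁻ u in Metric.ball (extChartAt (𝓡 d) p p) r,
          ENNReal.ofReal (jac (fderiv ℝ F u)) := by
          refine lintegral_mono_set ?_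
          rintro u ⟨hu, hut⟩
          have := hu.2
          rwa [Set.mem_preimage, (extChartAt (𝓡 d) p).right_inv hut] at this
      _ ≤ ∫⁻ u in Metric.ball (extChartAt (𝓡 d) p p) r,
          ENNReal.ofReal (jac (fderiv ℝ F (extChartAt (𝓡 d) p p)) + 1) :=
          setLIntegral_mono' Metric.isOpen_ball.measurableSet fun u hu =>
            ENNReal.ofReal_le_ofReal (hball u hu)
      _ < ⊤ := by
          rw [setLIntegral_const]
          exact ENNReal.mul_lt_top ENNReal.ofReal_lt_top Metric.isBounded_ball.measure_lt_top
  exact ⟨isCompact_univ.measure_lt_top⟩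

end RiemannianVolume

/-! ### Radial coordinates on the manifold. -/

section RadialParametrization

attribute [local instance 2000] chartedSpaceSelf

/-- The secant map integrates along segments that may leave the chart, so the Morse lemma is stated
for globally smooth maps; a bump function supplies one. -/
lemma exists_contDiff_eventuallyEq {X Y : Type*} [NormedAddCommGroup X] [InnerProductSpace ℝ X]
    [FiniteDimensional ℝ X] [NormedAddCommGroup Y] [NormedSpace ℝ Y] {f : X → Y} {t : Set X} {c : X}
    (hf : ContDiffOn ℝ ∞ f t) (ht : IsOpen t) (hc : c ∈ t) :
    ∃ F : X → Y, ContDiff ℝ ∞ F ∧ F =ᶠ[𝓝 c] f := by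
  obtain ⟨r, hr, hrt⟩ := Metric.isOpen_iff.1 ht c hc
  let χ : ContDiffBump c := ⟨r / 4, r / 2, by positivity, by linarith⟩
  refine ⟨fun x => χ x • f x, contDiff_iff_contDiffAt.2 fun x => ?_, ?_⟩
  · by_cases hx : x ∈ t
    · exact χ.contDiff.contDiffAt.smul (hf.contDiffAt (ht.mem_nhds hx))
    · have h1 : x ∉ tsupport χ := fun h => hx (hrt (by
        rw [χ.tsupport_eq] at h
        exact Metric.closedBall_subset_ball (by show r / 2 < r; linarith) h))
      have h2 : (fun x => χ x • f x) =ᶠ[𝓝 x] fun _ => 0 := by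
        filter_upwards [(isClosed_tsupport χ).isOpen_compl.mem_nhds h1] with y hy
        rw [image_eq_zero_of_notMem_tsupport hy, zero_smul]
      exact contDiffAt_const.congr_of_eventuallyEq h2
  · filter_upwards [χ.eventuallyEq_one] with y hy
    rw [hy, Pi.one_apply, one_smul]

variable {d D : ℕ} {M : Type*} [TopologicalSpace M] [ChartedSpace (EuclideanSpace ℝ (Fin d)) M]
  [IsManifold (𝓡 d) ∞ M] [RiemannianBundle (fun x : M => TangentSpace (𝓡 d) x)]
  {ι : M → EuclideanSpace ℝ (Fin D)}

local notation "𝔼" => EuclideanSpace ℝ (Fin d)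

/-- Smooth parametrizations of the extrinsic balls of a fixed radius, by the Euclidean ball of the
same radius and depending smoothly on the centre, that preserve the distance to the centre. -/
lemma exists_radial_parametrization (hι : IsIsometricEmbedding (d := d) ι) (p : M) {O : Set 𝔼}
    (hO : O ∈ 𝓝 (extChartAt (𝓡 d) p p)) (n : ℕ) (hn : 1 ≤ n) :
    ∃ (Φ : 𝔼 × 𝔼 → 𝔼) (r : ℝ), 0 < r ∧
      (∀ u ∈ Metric.ball (extChartAt (𝓡 d) p p) r,
        u ∈ (extChartAt (𝓡 d) p).target ∧ Φ (u, 0) = u ∧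
        ∀ v ∈ Metric.ball (0 : 𝔼) r, ContDiffAt ℝ n Φ (u, v) ∧ Φ (u, v) ∈ O ∧
          Φ (u, v) ∈ (extChartAt (𝓡 d) p).target ∧
          ‖ι ((extChartAt (𝓡 d) p).symm (Φ (u, v))) - ι ((extChartAt (𝓡 d) p).symm u)‖ = ‖v‖) ∧
      (∀ u ∈ Metric.ball (extChartAt (𝓡 d) p p) r,
        Set.InjOn (fun v => Φ (u, v)) (Metric.ball 0 r)) ∧
      (∀ u ∈ Metric.ball (extChartAt (𝓡 d) p p) r, ∀ δ ≤ r,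
        {y | ‖ι y - ι ((extChartAt (𝓡 d) p).symm u)‖ < δ} =
          (fun v => (extChartAt (𝓡 d) p).symm (Φ (u, v))) '' Metric.ball 0 δ) := by
  set φ := extChartAt (𝓡 d) p with hφ
  set c := φ p with hc
  have hct : c ∈ φ.target := mem_extChartAt_target p
  obtain ⟨F, hF, hFev⟩ := exists_contDiff_eventuallyEq
    (contDiffOn_comp_extChartAt_symm le_rfl hι.contMDiff p) (isOpen_extChartAt_target p) hct
  have hinj : Function.Injective (fderiv ℝ F c) := by
    rw [hFev.fderiv_eq]
    exact injective_fderiv_chart hι hct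
  obtain ⟨Φ, Ψ, hΦn, hΦc, h1, h2⟩ := exists_morse_coordinates hF hinj n hn
  have htn : φ.target ∈ 𝓝 c := extChartAt_target_mem_nhds_of_mem hct
  have hΦcont : Tendsto Φ (𝓝 (c, 0)) (𝓝 c) := by
    have := hΦn.continuousAt.tendsto
    rwa [hΦc] at this
  -- near the centre
  have e1 : ∀ᶠ z in 𝓝 (c, (0 : 𝔼)), (Ψ (z.1, Φ z) = z.2 ∧ ‖F (Φ z) - F z.1‖ = ‖z.2‖) ∧
      ContDiffAt ℝ n Φ z ∧ Φ z ∈ O ∧ Φ z ∈ φ.target ∧ F (Φ z) = ι (φ.symm (Φ z)) :=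
    h1.and ((hΦn.eventually (by simp)).and ((hΦcont.eventually hO).and
      ((hΦcont.eventually htn).and (hΦcont.eventually hFev))))
  have e2 : ∀ᶠ u in 𝓝 c, F u = ι (φ.symm u) ∧ u ∈ φ.target := hFev.and htn
  have e3 : ∀ᶠ y in 𝓝 (c, c), Φ (y.1, Ψ y) = y.2 ∧ ‖Ψ y‖ = ‖F y.2 - F y.1‖ := h2
  obtain ⟨r1, hr1, hb1⟩ := Metric.eventually_nhds_iff_ball.1 e1
  obtain ⟨r2, hr2, hb2⟩ := Metric.eventually_nhds_iff_ball.1 e2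
  obtain ⟨r3, hr3, hb3⟩ := Metric.eventually_nhds_iff_ball.1 e3
  -- extrinsic neighbourhoods of `p`
  set ρ := min r2 r3 with hρ
  have hρ0 : 0 < ρ := lt_min hr2 hr3
  have hW : φ.source ∩ φ ⁻¹' Metric.ball c ρ ∈ 𝓝 p :=
    inter_mem (extChartAt_source_mem_nhds (I := 𝓡 d) p)
      ((continuousAt_extChartAt p).preimage_mem_nhds (Metric.ball_mem_nhds _ hρ0))
  -- As `ι` is a topological embedding, points with image close to `ι p` are close to `p`, so small
  -- extrinsic balls stay inside the chart.
  rw [hι.isEmbedding.isInducing.nhds_eq_comap, Metric.nhds_basis_ball.comap ι |>.mem_iff] at hW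
  obtain ⟨η, hη, hWη⟩ := hW
  have e4 : ∀ᶠ u in 𝓝 c, ‖ι (φ.symm u) - ι p‖ < η / 2 := by
    have h3 : ContinuousAt (fun u => ‖ι (φ.symm u) - ι p‖) c :=
      ((((contDiffAt_comp_extChartAt_symm le_rfl hι.contMDiff hct).continuousAt).sub
        continuousAt_const).norm)
    refine h3.eventually_lt_const ?_
    show ‖ι (φ.symm (φ p)) - ι p‖ < η / 2
    rw [φ.left_inv (mem_extChartAt_source p), sub_self, norm_zero]
    positivity
  obtain ⟨r4, hr4, hb4⟩ := Metric.eventually_nhds_iff_ball.1 e4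
  -- An extrinsic ball of radius at most `η / 2`, centred within `η / 2` of `p`, lies within `η` of
  -- `p`.
  set r := min (min r1 ρ) (min r4 (η / 2)) with hr
  have hr0 : 0 < r := lt_min (lt_min hr1 hρ0) (lt_min hr4 (by positivity))
  have hrr1 : r ≤ r1 := (min_le_left _ _).trans (min_le_left _ _)
  have hrρ : r ≤ ρ := (min_le_left _ _).trans (min_le_right _ _)
  have hrr2 : r ≤ r2 := hrρ.trans (min_le_left _ _)
  have hρ3 : ρ ≤ r3 := min_le_right _ _
  have hrr4 : r ≤ r4 := (min_le_right _ _).trans (min_le_left _ _)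
  have hrη : r ≤ η / 2 := (min_le_right _ _).trans (min_le_right _ _)
  have m1 : ∀ u ∈ Metric.ball c r, ∀ v ∈ Metric.ball (0 : 𝔼) r, (u, v) ∈ Metric.ball (c, (0 : 𝔼)) r1 :=
    fun u hu v hv => by
      rw [← ball_prod_same]
      exact ⟨Metric.ball_subset_ball hrr1 hu, Metric.ball_subset_ball hrr1 hv⟩
  have k1 : ∀ u ∈ Metric.ball c r, ∀ v ∈ Metric.ball (0 : 𝔼) r,
      ‖ι (φ.symm (Φ (u, v))) - ι (φ.symm u)‖ = ‖v‖ := fun u hu v hv => by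
    have h4 := hb1 _ (m1 u hu v hv)
    rw [← h4.2.2.2.2, ← (hb2 u (Metric.ball_subset_ball hrr2 hu)).1, h4.1.2]
  refine ⟨Φ, r, hr0, fun u hu => ⟨(hb2 u (Metric.ball_subset_ball hrr2 hu)).2, ?_, fun v hv => ?_⟩,
    fun u hu => ?_, fun u hu δ hδ => ?_⟩
  -- `‖Ψ (u, u)‖ = ‖F u - F u‖ = 0`, whence `Φ (u, 0) = u`.
  · have hu3 : u ∈ Metric.ball c r3 := Metric.ball_subset_ball (hrρ.trans hρ3) hu
    have h4 := hb3 (u, u) (by rw [← ball_prod_same]; exact ⟨hu3, hu3⟩)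
    rw [sub_self, norm_zero, norm_eq_zero] at h4
    have h5 := h4.1
    rwa [h4.2] at h5
  · have h4 := hb1 _ (m1 u hu v hv)
    exact ⟨h4.2.1, h4.2.2.1, h4.2.2.2.1, k1 u hu v hv⟩
  · intro v hv w hw hvw
    have hvw' : Φ (u, v) = Φ (u, w) := hvw
    have h4 : Ψ (u, Φ (u, v)) = v := (hb1 _ (m1 u hu v hv)).1.1
    have h5 : Ψ (u, Φ (u, w)) = w := (hb1 _ (m1 u hu w hw)).1.1
    rw [← h4, ← h5, hvw']
  · ext y
    constructor
    · intro hy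
      have hy' : ‖ι y - ι (φ.symm u)‖ < δ := hy
      have h4 : ι y ∈ Metric.ball (ι p) η := by
        rw [mem_ball_iff_norm]
        have h5 := hb4 u (Metric.ball_subset_ball hrr4 hu)
        calc ‖ι y - ι p‖ = ‖(ι y - ι (φ.symm u)) + (ι (φ.symm u) - ι p)‖ := by congr 1; abel
          _ ≤ _ := norm_add_le _ _
          _ < η := by linarith
      obtain ⟨hys, hyb⟩ := hWη h4
      have hyb' : φ y ∈ Metric.ball c ρ := hyb
      have h6 := hb3 (u, φ y) (by
        rw [← ball_prod_same]
        exact ⟨Metric.ball_subset_ball (hrρ.trans hρ3) hu, Metric.ball_subset_ball hρ3 hyb'⟩)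
      have h7 := (hb2 _ (Metric.ball_subset_ball (min_le_left _ _) hyb')).1
      have h8 := (hb2 u (Metric.ball_subset_ball hrr2 hu)).1
      refine ⟨Ψ (u, φ y), ?_, ?_⟩
      · rw [mem_ball_zero_iff, h6.2, h7, h8, φ.left_inv hys]
        exact hy'
      · show φ.symm (Φ (u, Ψ (u, φ y))) = y
        rw [h6.1]
        exact φ.left_inv hys
    · rintro ⟨v, hv, rfl⟩
      show ‖ι (φ.symm (Φ (u, v))) - ι (φ.symm u)‖ < δ
      rw [k1 u hu v (Metric.ball_subset_ball hδ hv)]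
      exact mem_ball_zero_iff.1 hv

end RadialParametrization

/-! ### Jacobians in part of the variables. -/

section PartialJacobian

variable {d : ℕ} {N : Type*} [NormedAddCommGroup N] [InnerProductSpace ℝ N]

local notation "𝔼" => EuclideanSpace ℝ (Fin d)

lemma fderiv_slice {X Y Z : Type*} [NormedAddCommGroup X] [NormedSpace ℝ X] [NormedAddCommGroup Y]
    [NormedSpace ℝ Y] [NormedAddCommGroup Z] [NormedSpace ℝ Z] {G : X × Y → Z} {y : X × Y}
    (hG : DifferentiableAt ℝ G y) :
    fderiv ℝ (fun v => G (y.1, v)) y.2 = fderiv ℝ G y ∘L ContinuousLinearMap.inr ℝ X Y := by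
  have h1 : HasFDerivAt (fun v : Y => (y.1, v)) (ContinuousLinearMap.inr ℝ X Y) y.2 :=
    hasFDerivAt_prodMk_right y.1 y.2
  have h2 : HasFDerivAt G (fderiv ℝ G y) (y.1, y.2) := hG.hasFDerivAt
  exact (h2.comp y.2 h1).fderiv

/-- The Jacobian consumes one derivative, hence `n + 1`. Injectivity keeps the Gram determinant away
from the singularity of the square root. -/
lemma contDiffAt_jac_slice {G : 𝔼 × 𝔼 → N} {c : 𝔼 × 𝔼} {n : ℕ} (hG : ContDiffAt ℝ (n + 1 : ℕ) G c)
    (hinj : Function.Injective (fderiv ℝ (fun v => G (c.1, v)) c.2)) :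
    ContDiffAt ℝ n (fun y : 𝔼 × 𝔼 => jac (fderiv ℝ (fun v => G (y.1, v)) y.2)) c := by
  have hd : ∀ᶠ y in 𝓝 c, DifferentiableAt ℝ G y :=
    (hG.eventually (by simp)).mono fun y hy => hy.differentiableAt (by simp)
  rw [fderiv_slice hd.self_of_nhds] at hinj
  have h1 : ContDiffAt ℝ n (fun y => fderiv ℝ G y ∘L ContinuousLinearMap.inr ℝ 𝔼 𝔼) c :=
    (hG.fderiv_right (m := n) le_rfl).clm_comp contDiffAt_const
  refine (h1.jac hinj).congr_of_eventuallyEq ?_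
  filter_upwards [hd] with y hy
  rw [fderiv_slice hy]

end PartialJacobian

/-! ### The integrand of the double average in radial coordinates. -/

section IteratedIntegrand

variable {d : ℕ}

local notation "𝔼" => EuclideanSpace ℝ (Fin d)

/-- The integrand of the double average with kernel `K(‖v‖) K(‖v'‖)`, in radial coordinates `v`
around `u` and `v'` around `Φ (u, v)`. -/
def radialIntegrand (Φ : 𝔼 × 𝔼 → 𝔼) (J : 𝔼 × 𝔼 → ℝ) (g q : 𝔼 → ℝ) (x : 𝔼 × (𝔼 × 𝔼)) : ℝ :=
  q (Φ (x.1, x.2.1)) * J (x.1, x.2.1) *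
    (g (Φ (Φ (x.1, x.2.1), x.2.2)) * J (Φ (x.1, x.2.1), x.2.2))

/-- The constant is chosen before `g` and `q`, and the bound is bilinear in theirs: uniformity in
the functions originates here. -/
lemma exists_ckAt_radialIntegrand {Φ : 𝔼 × 𝔼 → 𝔼} {J : 𝔼 × 𝔼 → ℝ} {c : 𝔼}
    (hΦ : ContDiffAt ℝ 4 Φ (c, 0)) (hΦc : Φ (c, 0) = c) (hJ : ContDiffAt ℝ 4 J (c, 0)) {O : Set 𝔼}
    (hO : O ∈ 𝓝 c) :
    ∃ C : ℝ, 0 ≤ C ∧ ∀ᶠ x : 𝔼 × (𝔼 × 𝔼) in 𝓝 (c, 0),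
      ∀ (g q : 𝔼 → ℝ) (G Q : ℝ), (∀ w ∈ O, CkAt 4 g G w) → (∀ w ∈ O, CkAt 4 q Q w) →
        CkAt 4 (radialIntegrand Φ J g q) (C * (G * Q)) x := by
  have p1 : ContDiffAt ℝ 4 (fun x : 𝔼 × (𝔼 × 𝔼) => (x.1, x.2.1)) (c, 0) := by fun_prop
  have f1 : ContDiffAt ℝ 4 (fun x : 𝔼 × (𝔼 × 𝔼) => Φ (x.1, x.2.1)) (c, 0) :=
    ContDiffAt.comp (c, (0 : 𝔼 × 𝔼)) hΦ p1
  have p2 : ContDiffAt ℝ 4 (fun x : 𝔼 × (𝔼 × 𝔼) => (Φ (x.1, x.2.1), x.2.2)) (c, 0) :=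
    f1.prodMk (by fun_prop)
  have hΦ' : ContDiffAt ℝ 4 Φ (Φ (c, 0), 0) := by rwa [hΦc]
  have hJ' : ContDiffAt ℝ 4 J (Φ (c, 0), 0) := by rwa [hΦc]
  have f2 : ContDiffAt ℝ 4 (fun x : 𝔼 × (𝔼 × 𝔼) => Φ (Φ (x.1, x.2.1), x.2.2)) (c, 0) :=
    ContDiffAt.comp (g := Φ) (f := fun x : 𝔼 × (𝔼 × 𝔼) => (Φ (x.1, x.2.1), x.2.2))
      (c, (0 : 𝔼 × 𝔼)) hΦ' p2
  have j1 : ContDiffAt ℝ 4 (fun x : 𝔼 × (𝔼 × 𝔼) => J (x.1, x.2.1)) (c, 0) :=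
    ContDiffAt.comp (c, (0 : 𝔼 × 𝔼)) hJ p1
  have j2 : ContDiffAt ℝ 4 (fun x : 𝔼 × (𝔼 × 𝔼) => J (Φ (x.1, x.2.1), x.2.2)) (c, 0) :=
    ContDiffAt.comp (g := J) (f := fun x : 𝔼 × (𝔼 × 𝔼) => (Φ (x.1, x.2.1), x.2.2))
      (c, (0 : 𝔼 × 𝔼)) hJ' p2
  have t1 : Tendsto (fun x : 𝔼 × (𝔼 × 𝔼) => Φ (x.1, x.2.1)) (𝓝 (c, 0)) (𝓝 c) := by
    have h : Tendsto _ _ (𝓝 (Φ (c, 0))) := f1.continuousAt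
    rwa [hΦc] at h
  have t2 : Tendsto (fun x : 𝔼 × (𝔼 × 𝔼) => Φ (Φ (x.1, x.2.1), x.2.2)) (𝓝 (c, 0)) (𝓝 c) := by
    have h : Tendsto _ _ (𝓝 (Φ (Φ (c, 0), 0))) := f2.continuousAt
    rwa [hΦc, hΦc] at h
  obtain ⟨A1, hA1, e1⟩ := ContDiffAt.exists_ckAt (n := 4) f1
  obtain ⟨A2, hA2, e2⟩ := ContDiffAt.exists_ckAt (n := 4) f2
  obtain ⟨B1, hB1, e3⟩ := ContDiffAt.exists_ckAt (n := 4) j1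
  obtain ⟨B2, hB2, e4⟩ := ContDiffAt.exists_ckAt (n := 4) j2
  -- Each of the two compositions costs `4! Aᵢ⁴`, each of the three products `2⁴`.
  refine ⟨2 ^ 4 * (2 ^ 4 * ((Nat.factorial 4 : ℕ) * A1 ^ 4) * B1) *
    (2 ^ 4 * ((Nat.factorial 4 : ℕ) * A2 ^ 4) * B2), by positivity, ?_⟩
  filter_upwards [e1, e2, e3, e4, t1.eventually hO, t2.eventually hO] with x h1 h2 h3 h4 h5 h6 g q G
    Q hg hq
  have k1 := ((CkAt.comp (f := fun x : 𝔼 × (𝔼 × 𝔼) => Φ (x.1, x.2.1)) (hq _ h5) h1 hA1).mul h3).mul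
    ((CkAt.comp (f := fun x : 𝔼 × (𝔼 × 𝔼) => Φ (Φ (x.1, x.2.1), x.2.2)) (hg _ h6) h2 hA2).mul h4)
  refine (k1.mono (le_of_eq ?_))
  ring

end IteratedIntegrand

/-! ### Even expansion of a function cut off to a ball. -/

section EvenExpansion

variable {X Y : Type*} [NormedAddCommGroup X] [NormedSpace ℝ X] [NormedAddCommGroup Y]
  [NormedSpace ℝ Y]

/-- Inside the ball this is `abs_even_taylor_le`. Outside, the cut-off function vanishes, and `‖z‖ ≥
δ` lets `‖z‖⁴` absorb the value and the Hessian term. The bound thus holds everywhere, as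
integration over the whole space requires. -/
lemma abs_even_taylor_indicator_le {h : X × Y → ℝ} {u : X} {δ A : ℝ} (hδ : 0 < δ)
    (hh : ∀ z ∈ Metric.ball (0 : Y) δ, CkAt 4 h A (u, z)) (z : Y) :
    |(Metric.ball (0 : Y) δ).indicator (fun z => h (u, z)) z +
      (Metric.ball (0 : Y) δ).indicator (fun z => h (u, z)) (-z) - 2 * h (u, 0) -
      fderiv ℝ (fderiv ℝ h) (u, 0) (0, z) (0, z)| ≤ (2 + 2 / δ ^ 4 + 1 / δ ^ 2) * A * ‖z‖ ^ 4 := by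
  have h0 := hh 0 (Metric.mem_ball_self hδ)
  have hA := h0.nonneg
  by_cases hz : z ∈ Metric.ball (0 : Y) δ
  · have hz' : -z ∈ Metric.ball (0 : Y) δ := by simpa using hz
    rw [Set.indicator_of_mem hz, Set.indicator_of_mem hz']
    have h1 := abs_even_taylor_le (g := h) (z := (u, (0 : Y))) (h := ((0 : X), z)) (C := A)
      fun t ht => by
        have h2 : (u, (0 : Y)) + t • ((0 : X), z) = (u, t • z) := by
          simp
        rw [h2]
        refine hh _ ?_
        rw [mem_ball_zero_iff] at hz ⊢
        rw [norm_smul]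
        refine lt_of_le_of_lt ?_ hz
        exact mul_le_of_le_one_left (norm_nonneg _) (abs_le.2 ht)
    have h2 : ‖((0 : X), z)‖ = ‖z‖ := by simp [Prod.norm_def]
    simp only [Prod.mk_add_mk, Prod.mk_sub_mk, add_zero, zero_add, sub_zero, zero_sub, h2] at h1
    refine h1.trans ?_
    have : 0 ≤ (2 / δ ^ 4 + 1 / δ ^ 2) * A * ‖z‖ ^ 4 := by positivity
    nlinarith
  · have hz' : -z ∉ Metric.ball (0 : Y) δ := by simpa using hz
    rw [Set.indicator_of_notMem hz, Set.indicator_of_notMem hz']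
    have hzδ : δ ≤ ‖z‖ := by simpa using hz
    have h1 := h0.norm_le
    rw [Real.norm_eq_abs] at h1
    have h2 := h0.abs_fderiv_fderiv_le (by norm_num) ((0 : X), z) ((0 : X), z)
    have h3 : ‖((0 : X), z)‖ = ‖z‖ := by simp [Prod.norm_def]
    rw [h3] at h2
    have h4 : |0 + 0 - 2 * h (u, 0) - fderiv ℝ (fderiv ℝ h) (u, 0) (0, z) (0, z)| ≤
        2 * A + A * ‖z‖ * ‖z‖ := by
      rw [abs_le] at h1 h2 ⊢
      constructor <;> linarith [h1.1, h1.2, h2.1, h2.2]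
    refine h4.trans ?_
    have h5 : 1 ≤ ‖z‖ / δ := (one_le_div hδ).2 hzδ
    have h6 : 2 * A ≤ 2 / δ ^ 4 * A * ‖z‖ ^ 4 := by
      have : 1 ≤ (‖z‖ / δ) ^ 4 := one_le_pow₀ h5
      calc 2 * A ≤ 2 * A * (‖z‖ / δ) ^ 4 := le_mul_of_one_le_right (by positivity) this
        _ = _ := by rw [div_pow]; ring
    have h7 : A * ‖z‖ * ‖z‖ ≤ 1 / δ ^ 2 * A * ‖z‖ ^ 4 := by
      have : 1 ≤ (‖z‖ / δ) ^ 2 := one_le_pow₀ h5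
      calc A * ‖z‖ * ‖z‖ ≤ A * ‖z‖ * ‖z‖ * (‖z‖ / δ) ^ 2 := le_mul_of_one_le_right (by positivity) this
        _ = _ := by rw [div_pow]; ring
    have h8 : 0 ≤ 2 * A * ‖z‖ ^ 4 := by positivity
    linarith

lemma measurable_indicator_slice [MeasurableSpace Y] [BorelSpace Y] {h : X × Y → ℝ} {u : X} {δ A : ℝ}
    (hh : ∀ z ∈ Metric.ball (0 : Y) δ, CkAt 4 h A (u, z)) :
    Measurable ((Metric.ball (0 : Y) δ).indicator fun z => h (u, z)) := by
  have hc : ContinuousOn (fun z => h (u, z)) (Metric.ball (0 : Y) δ) := fun z hz =>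
    (ContinuousAt.comp (f := fun z : Y => (u, z)) (hh z hz).1.continuousAt
      (by fun_prop)).continuousWithinAt
  classical
  rw [← Set.piecewise_eq_indicator]
  exact hc.measurable_piecewise continuousOn_const Metric.isOpen_ball.measurableSet

lemma abs_indicator_slice_le {h : X × Y → ℝ} {u : X} {δ A : ℝ} (hA : 0 ≤ A)
    (hh : ∀ z ∈ Metric.ball (0 : Y) δ, CkAt 4 h A (u, z)) (z : Y) :
    |(Metric.ball (0 : Y) δ).indicator (fun z => h (u, z)) z| ≤ A := by
  by_cases hz : z ∈ Metric.ball (0 : Y) δ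
  · rw [Set.indicator_of_mem hz]
    exact (hh z hz).norm_le
  · rw [Set.indicator_of_notMem hz, abs_zero]
    exact hA

/-- Second derivatives along affine maps. -/
lemma fderiv_fderiv_comp_affine {Z : Type*} [NormedAddCommGroup Z] [NormedSpace ℝ Z] {h : X → ℝ}
    {x : X} (hh : ContDiffAt ℝ 2 h x) (L : Z →L[ℝ] X) (a b : Z) :
    fderiv ℝ (fderiv ℝ fun v => h (x + L v)) 0 a b = fderiv ℝ (fderiv ℝ h) x (L a) (L b) := by
  have h1 : ∀ v : Z, HasFDerivAt (fun v => x + L v) L v := fun v => L.hasFDerivAt.const_add x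
  have h2 : fderiv ℝ (fun v => x + L v) = fun _ => L := funext fun v => (h1 v).fderiv
  have h3 := fderiv_fderiv_comp (f := h) (g := fun v => x + L v) (x := 0)
    (by simpa using hh) (by fun_prop) a b
  rw [h2] at h3
  simpa [Function.comp_def] using h3

end EvenExpansion

/-! ### Double averages and their localization near the diagonal. -/

section DoubleAverage

attribute [local instance 2000] chartedSpaceSelf

/-- The unnormalized double average of `g` with radial kernel `R` and landmark weight `q`. -/
def doubleAverage {D : ℕ} {M : Type*} [MeasurableSpace M] (V : Measure M)
    (ι : M → EuclideanSpace ℝ (Fin D)) (R : ℝ → ℝ) (q g : M → ℝ) (x : M) : ℝ :=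
  ∫ z, R ‖ι x - ι z‖ * q z * ∫ y, R ‖ι z - ι y‖ * g y ∂V ∂V

/-- The restriction of a radial kernel to distances less than `δ`. -/
def nearKernel (R : ℝ → ℝ) (δ : ℝ) (t : ℝ) : ℝ := (Set.Iio δ).indicator R t

section General

variable {D : ℕ} {M : Type*} [MeasurableSpace M] {V : Measure M} [IsFiniteMeasure V]
  {ι : M → EuclideanSpace ℝ (Fin D)} {R : ℝ → ℝ} {q g : M → ℝ} {κ Q G : ℝ}

lemma integrable_doubleAverage (hR : Measurable fun w : M × M => R ‖ι w.1 - ι w.2‖)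
    (hq : Measurable q) (hg : Measurable g) (hRκ : ∀ t, 0 ≤ t → |R t| ≤ κ) (hqQ : ∀ x, |q x| ≤ Q)
    (hgG : ∀ x, |g x| ≤ G) (x : M) :
    Integrable (fun w : M × M => R ‖ι x - ι w.1‖ * q w.1 * (R ‖ι w.1 - ι w.2‖ * g w.2))
      (V.prod V) := by
  have hκ : 0 ≤ κ := (abs_nonneg _).trans (hRκ 0 le_rfl)
  have hQ : 0 ≤ Q := (abs_nonneg _).trans (hqQ x)
  refine Integrable.of_bound (C := κ * Q * (κ * G)) ?_ (Eventually.of_forall fun w => ?_)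
  · have h0 : Measurable fun w : M × M => (x, w.1) := measurable_const.prodMk measurable_fst
    have h1 := hR.comp h0
    simp only [Function.comp_def] at h1
    have h2 : Measurable fun w : M × M => q w.1 := hq.comp measurable_fst
    have h3 : Measurable fun w : M × M => g w.2 := hg.comp measurable_snd
    have h4 : Measurable fun w : M × M =>
        R ‖ι x - ι w.1‖ * q w.1 * (R ‖ι w.1 - ι w.2‖ * g w.2) := (h1.mul h2).mul (hR.mul h3)
    exact h4.aestronglyMeasurable
  · rw [Real.norm_eq_abs, abs_mul, abs_mul, abs_mul]
    have := hRκ _ (norm_nonneg (ι x - ι w.1))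
    have := hRκ _ (norm_nonneg (ι w.1 - ι w.2))
    have := hqQ w.1
    have := hgG w.2
    gcongr

lemma doubleAverage_eq_integral_prod (hR : Measurable fun w : M × M => R ‖ι w.1 - ι w.2‖)
    (hq : Measurable q) (hg : Measurable g) (hRκ : ∀ t, 0 ≤ t → |R t| ≤ κ) (hqQ : ∀ x, |q x| ≤ Q)
    (hgG : ∀ x, |g x| ≤ G) (x : M) :
    doubleAverage V ι R q g x =
      ∫ w, R ‖ι x - ι w.1‖ * q w.1 * (R ‖ι w.1 - ι w.2‖ * g w.2) ∂(V.prod V) := by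
  rw [integral_prod _ (integrable_doubleAverage hR hq hg hRκ hqQ hgG x)]
  simp only [integral_const_mul]
  rfl

lemma measurable_nearKernel (hι : Measurable ι)
    (hR : Measurable fun w : M × M => R ‖ι w.1 - ι w.2‖) (δ : ℝ) :
    Measurable fun w : M × M => nearKernel R δ ‖ι w.1 - ι w.2‖ := by
  have h1 : MeasurableSet {w : M × M | ‖ι w.1 - ι w.2‖ < δ} :=
    measurableSet_lt ((hι.comp measurable_fst).sub (hι.comp measurable_snd)).norm measurable_const
  exact hR.indicator h1

lemma abs_nearKernel_le (hRκ : ∀ t, 0 ≤ t → |R t| ≤ κ) (δ t : ℝ) (ht : 0 ≤ t) :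
    |nearKernel R δ t| ≤ κ := by
  rw [nearKernel, Set.indicator_apply]
  split_ifs
  · exact hRκ t ht
  · simpa using (abs_nonneg _).trans (hRκ 0 le_rfl)

/-- Cutting off a kernel at distance `δ` changes the double average little if the kernel is small
beyond `δ`. -/
lemma abs_doubleAverage_sub_nearKernel_le (hι : Measurable ι)
    (hR : Measurable fun w : M × M => R ‖ι w.1 - ι w.2‖)
    (hq : Measurable q) (hg : Measurable g) (hRκ : ∀ t, 0 ≤ t → |R t| ≤ κ) (hqQ : ∀ x, |q x| ≤ Q)
    (hgG : ∀ x, |g x| ≤ G) {δ τ : ℝ} (hτ : ∀ t, 0 ≤ t → δ ≤ t → |R t| ≤ τ) (hτ0 : 0 ≤ τ) (x : M) :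
    |doubleAverage V ι R q g x - doubleAverage V ι (nearKernel R δ) q g x| ≤
      κ * τ * Q * G * (V.prod V).real Set.univ := by
  have hR' := measurable_nearKernel hι hR δ
  have hRκ' := abs_nearKernel_le hRκ δ
  rw [doubleAverage_eq_integral_prod hR hq hg hRκ hqQ hgG,
    doubleAverage_eq_integral_prod hR' hq hg hRκ' hqQ hgG,
    ← integral_sub (integrable_doubleAverage hR hq hg hRκ hqQ hgG x)
      (integrable_doubleAverage hR' hq hg hRκ' hqQ hgG x), ← Real.norm_eq_abs]
  refine norm_integral_le_of_norm_le_const (Eventually.of_forall fun w => ?_)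
  have hκ : 0 ≤ κ := (abs_nonneg _).trans (hRκ 0 le_rfl)
  have hQ : 0 ≤ Q := (abs_nonneg _).trans (hqQ x)
  have hG : 0 ≤ G := (abs_nonneg _).trans (hgG x)
  have a1 := hRκ _ (norm_nonneg (ι x - ι w.1))
  have a2 := hRκ _ (norm_nonneg (ι w.1 - ι w.2))
  have a3 := hqQ w.1
  have a4 := hgG w.2
  -- The product changes only if one factor is taken beyond `δ`; that factor is at most `τ` and the
  -- other at most `κ`.
  have key : ∀ s t : ℝ, 0 ≤ s → 0 ≤ t →
      |R s * R t - nearKernel R δ s * nearKernel R δ t| ≤ κ * τ := fun s t hs ht => by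
    rcases lt_or_ge s δ with h1 | h1
    · rcases lt_or_ge t δ with h2 | h2
      · rw [nearKernel, nearKernel, Set.indicator_of_mem (Set.mem_Iio.2 h1),
          Set.indicator_of_mem (Set.mem_Iio.2 h2), sub_self, abs_zero]
        positivity
      · rw [nearKernel, nearKernel, Set.indicator_of_notMem (a := t) (by simpa using h2), mul_zero,
          sub_zero, abs_mul]
        exact mul_le_mul (hRκ s hs) (hτ t ht h2) (abs_nonneg _) hκ
    · rw [nearKernel, nearKernel, Set.indicator_of_notMem (a := s) (by simpa using h1), zero_mul,
          sub_zero, abs_mul, mul_comm κ]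
      exact mul_le_mul (hτ s hs h1) (hRκ t ht) (abs_nonneg _) hτ0
  have h := key _ _ (norm_nonneg (ι x - ι w.1)) (norm_nonneg (ι w.1 - ι w.2))
  calc _ = |(R ‖ι x - ι w.1‖ * R ‖ι w.1 - ι w.2‖ - nearKernel R δ ‖ι x - ι w.1‖ *
        nearKernel R δ ‖ι w.1 - ι w.2‖) * q w.1 * g w.2| := by
        rw [Real.norm_eq_abs]; congr 1; ring
    _ ≤ κ * τ * Q * G := by
        rw [abs_mul, abs_mul]
        gcongr

end General

section Fubini

variable {d : ℕ}

local notation "𝔼" => EuclideanSpace ℝ (Fin d)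

/-- Products carry the maximum norm, so the product of the two balls is a ball, and Fubini applies.
-/
lemma setIntegral_setIntegral_radial {R : ℝ → ℝ} {κ A δ : ℝ} (hRn : Measurable fun v : 𝔼 => R ‖v‖)
    (hRκ : ∀ t, 0 ≤ t → |R t| ≤ κ) {f : 𝔼 × 𝔼 → ℝ}
    (hm : Measurable ((Metric.ball (0 : 𝔼 × 𝔼) δ).indicator f))
    (hA : ∀ z, |(Metric.ball (0 : 𝔼 × 𝔼) δ).indicator f z| ≤ A) :
    ∫ v in Metric.ball (0 : 𝔼) δ, ∫ v' in Metric.ball (0 : 𝔼) δ, R ‖v‖ * (R ‖v'‖ * f (v, v')) =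
      ∫ z : 𝔼 × 𝔼, R ‖z.1‖ * (R ‖z.2‖ * (Metric.ball (0 : 𝔼 × 𝔼) δ).indicator f z) := by
  have hB : MeasurableSet (Metric.ball (0 : 𝔼) δ) := Metric.isOpen_ball.measurableSet
  have hball : Metric.ball (0 : 𝔼) δ ×ˢ Metric.ball (0 : 𝔼) δ = Metric.ball (0 : 𝔼 × 𝔼) δ :=
    ball_prod_same 0 0 δ
  have hκ : 0 ≤ κ := (abs_nonneg _).trans (hRκ 0 le_rfl)
  have hind : (Metric.ball (0 : 𝔼 × 𝔼) δ).indicator (fun z : 𝔼 × 𝔼 => R ‖z.1‖ * (R ‖z.2‖ * f z)) =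
      fun z => R ‖z.1‖ * (R ‖z.2‖ * (Metric.ball (0 : 𝔼 × 𝔼) δ).indicator f z) := by
    ext z
    by_cases hz : z ∈ Metric.ball (0 : 𝔼 × 𝔼) δ
    · rw [Set.indicator_of_mem hz, Set.indicator_of_mem hz]
    · rw [Set.indicator_of_notMem hz, Set.indicator_of_notMem hz, mul_zero, mul_zero]
  have hR1 : Measurable fun z : 𝔼 × 𝔼 => R ‖z.1‖ := hRn.comp measurable_fst
  have hR2 : Measurable fun z : 𝔼 × 𝔼 => R ‖z.2‖ := hRn.comp measurable_snd
  have hm' : Measurable fun z : 𝔼 × 𝔼 =>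
      R ‖z.1‖ * (R ‖z.2‖ * (Metric.ball (0 : 𝔼 × 𝔼) δ).indicator f z) := hR1.mul (hR2.mul hm)
  have hBB : MeasurableSet (Metric.ball (0 : 𝔼 × 𝔼) δ) := Metric.isOpen_ball.measurableSet
  have hint : IntegrableOn (fun z : 𝔼 × 𝔼 => R ‖z.1‖ * (R ‖z.2‖ * f z))
      (Metric.ball (0 : 𝔼) δ ×ˢ Metric.ball (0 : 𝔼) δ) (volume.prod volume) := by
    rw [hball]
    have h1 : IntegrableOn (fun z : 𝔼 × 𝔼 =>
        R ‖z.1‖ * (R ‖z.2‖ * (Metric.ball (0 : 𝔼 × 𝔼) δ).indicator f z)) (Metric.ball 0 δ) volume := by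
      refine Measure.integrableOn_of_bounded (M := κ * (κ * A))
        Metric.isBounded_ball.measure_lt_top.ne hm'.aestronglyMeasurable
        (Eventually.of_forall fun z => ?_)
      rw [Real.norm_eq_abs, abs_mul, abs_mul]
      have a1 := hRκ _ (norm_nonneg z.1)
      have a2 := hRκ _ (norm_nonneg z.2)
      have a3 := hA z
      gcongr
    refine h1.congr_fun (fun z hz => ?_) hBB
    simp only
    rw [Set.indicator_of_mem hz]
  have h2 := setIntegral_prod _ hint
  rw [← h2, hball, ← hind, integral_indicator hBB]
  rfl

end Fubini

/-! ### The localized double average in radial coordinates. -/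

section Near

variable {d D : ℕ} {M : Type*} [TopologicalSpace M] [ChartedSpace (EuclideanSpace ℝ (Fin d)) M]
  [IsManifold (𝓡 d) ∞ M] [RiemannianBundle (fun x : M => TangentSpace (𝓡 d) x)]
  [MeasurableSpace M] [BorelSpace M] [CompactSpace M] {ι : M → EuclideanSpace ℝ (Fin D)}

local notation "𝔼" => EuclideanSpace ℝ (Fin d)

/-- The Jacobian of the coordinates `v ↦ Φ (u, v)`. -/
def radialJacobian (ι : M → EuclideanSpace ℝ (Fin D)) (p : M) (Φ : 𝔼 × 𝔼 → 𝔼) (y : 𝔼 × 𝔼) : ℝ :=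
  jac (fderiv ℝ (fun v => ι ((extChartAt (𝓡 d) p).symm (Φ (y.1, v)))) y.2)

/-- `v ↦ Φ (u, v)` parametrizes the extrinsic ball of radius `δ` around the point with coordinates
`u` by the Euclidean ball, preserving the distance to the centre. -/
structure IsRadialAt (ι : M → EuclideanSpace ℝ (Fin D)) (p : M) (Φ : 𝔼 × 𝔼 → 𝔼) (δ : ℝ) (u : 𝔼) :
    Prop where
  contDiffAt : ∀ v ∈ Metric.ball (0 : 𝔼) δ, ContDiffAt ℝ 1 Φ (u, v)
  mem_target : ∀ v ∈ Metric.ball (0 : 𝔼) δ, Φ (u, v) ∈ (extChartAt (𝓡 d) p).target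
  norm_eq : ∀ v ∈ Metric.ball (0 : 𝔼) δ,
    ‖ι ((extChartAt (𝓡 d) p).symm (Φ (u, v))) - ι ((extChartAt (𝓡 d) p).symm u)‖ = ‖v‖
  injOn : Set.InjOn (fun v => Φ (u, v)) (Metric.ball 0 δ)
  ball_eq : {y | ‖ι y - ι ((extChartAt (𝓡 d) p).symm u)‖ < δ} =
    (fun v => (extChartAt (𝓡 d) p).symm (Φ (u, v))) '' Metric.ball 0 δ

/-- The extrinsic ball is the image of the Euclidean one and the distance to the centre is `‖v‖`, so
the kernel passes to coordinates unchanged. -/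
lemma IsRadialAt.integral_nearKernel (hι : IsIsometricEmbedding (d := d) ι) {p : M}
    {Φ : 𝔼 × 𝔼 → 𝔼} {δ : ℝ} {u : 𝔼} (h : IsRadialAt ι p Φ δ u) {R : ℝ → ℝ}
    (hR : ∀ x, Measurable fun y => R ‖ι x - ι y‖) {f : M → ℝ} (hf : Measurable f) :
    ∫ y, nearKernel R δ ‖ι ((extChartAt (𝓡 d) p).symm u) - ι y‖ * f y ∂(riemannianVolume d M) =
      ∫ v in Metric.ball (0 : 𝔼) δ, radialJacobian ι p Φ (u, v) *
        (R ‖v‖ * f ((extChartAt (𝓡 d) p).symm (Φ (u, v)))) := by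
  set x := (extChartAt (𝓡 d) p).symm u with hx
  have hU : MeasurableSet {y | ‖ι y - ι x‖ < δ} :=
    (isOpen_lt (hι.contMDiff.continuous.sub continuous_const).norm continuous_const).measurableSet
  have h1 : (fun y => nearKernel R δ ‖ι x - ι y‖ * f y) =
      {y | ‖ι y - ι x‖ < δ}.indicator fun y => R ‖ι x - ι y‖ * f y := by
    ext y
    by_cases hy : ‖ι y - ι x‖ < δ
    · rw [Set.indicator_of_mem (show y ∈ {y | ‖ι y - ι x‖ < δ} from hy), nearKernel,
        Set.indicator_of_mem (by rwa [Set.mem_Iio, norm_sub_rev])]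
    · rw [Set.indicator_of_notMem (show y ∉ {y | ‖ι y - ι x‖ < δ} from hy), nearKernel,
        Set.indicator_of_notMem (by rwa [Set.mem_Iio, norm_sub_rev]), zero_mul]
  have h3 : Measurable fun y => R ‖ι x - ι y‖ * f y := (hR x).mul hf
  rw [h1, integral_indicator hU, setIntegral_riemannianVolume_eq hι p (Θ := fun v => Φ (u, v))
    Metric.isOpen_ball.measurableSet
    (fun v hv => ContDiffAt.comp (f := fun v : 𝔼 => (u, v)) v (h.contDiffAt v hv) (by fun_prop))
    h.injOn h.mem_target hU h.ball_eq h3]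
  refine setIntegral_congr_fun Metric.isOpen_ball.measurableSet fun v hv => ?_
  have h2 := h.norm_eq v hv
  rw [← hx, norm_sub_rev] at h2
  simp only [radialJacobian]
  rw [h2]

/-- The outer integral uses radial coordinates around `u`, the inner one those around the moving
centre `Φ (u, v)`. -/
lemma IsRadialAt.doubleAverage_nearKernel (hι : IsIsometricEmbedding (d := d) ι) {p : M}
    {Φ : 𝔼 × 𝔼 → 𝔼} {δ : ℝ} {u : 𝔼} (h : IsRadialAt ι p Φ δ u)
    (h' : ∀ v ∈ Metric.ball (0 : 𝔼) δ, IsRadialAt ι p Φ δ (Φ (u, v))) {R : ℝ → ℝ} {κ : ℝ}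
    (hR : Measurable fun w : M × M => R ‖ι w.1 - ι w.2‖) (hRn : Measurable fun v : 𝔼 => R ‖v‖)
    (hRκ : ∀ t, 0 ≤ t → |R t| ≤ κ) {q g : M → ℝ} (hq : Measurable q) (hg : Measurable g) {A : ℝ}
    (hA : ∀ z ∈ Metric.ball (0 : 𝔼 × 𝔼) δ, CkAt 4 (radialIntegrand Φ (radialJacobian ι p Φ)
      (g ∘ (extChartAt (𝓡 d) p).symm) (q ∘ (extChartAt (𝓡 d) p).symm)) A (u, z)) :
    doubleAverage (riemannianVolume d M) ι (nearKernel R δ) q g ((extChartAt (𝓡 d) p).symm u) =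
      ∫ z : 𝔼 × 𝔼, R ‖z.1‖ * (R ‖z.2‖ * (Metric.ball (0 : 𝔼 × 𝔼) δ).indicator
        (fun z => radialIntegrand Φ (radialJacobian ι p Φ) (g ∘ (extChartAt (𝓡 d) p).symm)
          (q ∘ (extChartAt (𝓡 d) p).symm) (u, z)) z) := by
  have := isFiniteMeasure_riemannianVolume (d := d) hι
  set φ := extChartAt (𝓡 d) p with hφ
  set J := radialJacobian ι p Φ with hJ
  have hRx : ∀ x, Measurable fun y => R ‖ι x - ι y‖ := fun x => by
    have h0 : Measurable fun y : M => (x, y) := measurable_const.prodMk measurable_id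
    have h1 := hR.comp h0
    simpa only [Function.comp_def] using h1
  have hB : MeasurableSet (Metric.ball (0 : 𝔼) δ) := Metric.isOpen_ball.measurableSet
  have hin : Measurable fun z => q z * ∫ y, nearKernel R δ ‖ι z - ι y‖ * g y ∂riemannianVolume d M :=
    by
      have h1 : Measurable fun w : M × M => g w.2 := hg.comp measurable_snd
      have h2 : Measurable fun w : M × M => nearKernel R δ ‖ι w.1 - ι w.2‖ * g w.2 :=
        (measurable_nearKernel hι.contMDiff.continuous.measurable hR δ).mul h1
      exact hq.mul h2.stronglyMeasurable.integral_prod_right'.measurable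
  rw [doubleAverage]
  simp only [mul_assoc]
  rw [h.integral_nearKernel hι hRx hin]
  have h1 : ∀ v ∈ Metric.ball (0 : 𝔼) δ, J (u, v) * (R ‖v‖ * (q (φ.symm (Φ (u, v))) *
      ∫ y, nearKernel R δ ‖ι (φ.symm (Φ (u, v))) - ι y‖ * g y ∂riemannianVolume d M)) =
      ∫ v' in Metric.ball (0 : 𝔼) δ, R ‖v‖ * (R ‖v'‖ *
        radialIntegrand Φ J (g ∘ φ.symm) (q ∘ φ.symm) (u, (v, v'))) := fun v hv => by
    rw [(h' v hv).integral_nearKernel hι hRx hg, ← integral_const_mul, ← integral_const_mul,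
      ← integral_const_mul]
    refine integral_congr_ae (Eventually.of_forall fun v' => ?_)
    simp only [radialIntegrand, Function.comp_apply]
    ring
  rw [setIntegral_congr_fun hB h1]
  rcases le_or_gt δ 0 with hδ | hδ
  · rw [Metric.ball_eq_empty.2 hδ, Metric.ball_eq_empty.2 hδ]
    simp
  have hA0 := (hA 0 (Metric.mem_ball_self hδ)).nonneg
  exact setIntegral_setIntegral_radial hRn hRκ (measurable_indicator_slice hA)
    (abs_indicator_slice_le hA0 hA)

end Near

end DoubleAverage

/-! ### Hessian traces of the integrand at the centre. -/

section RadialTraces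

attribute [local instance 2000] chartedSpaceSelf

variable {d D : ℕ} {M : Type*} [TopologicalSpace M] [ChartedSpace (EuclideanSpace ℝ (Fin d)) M]
  [IsManifold (𝓡 d) ∞ M] [RiemannianBundle (fun x : M => TangentSpace (𝓡 d) x)]
  {ι : M → EuclideanSpace ℝ (Fin D)}

local notation "𝔼" => EuclideanSpace ℝ (Fin d)

/-- Smoothness at the centre of radial coordinates around the point with coordinates `u`. -/
structure IsRadialCenter (ι : M → EuclideanSpace ℝ (Fin D)) (p : M) (Φ : 𝔼 × 𝔼 → 𝔼) (u : 𝔼) :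
    Prop where
  contDiffAt : ContDiffAt ℝ 5 Φ (u, 0)
  mem_target : u ∈ (extChartAt (𝓡 d) p).target
  apply_zero : Φ (u, 0) = u
  norm_eq : ∀ᶠ v in 𝓝 (0 : 𝔼),
    ‖ι ((extChartAt (𝓡 d) p).symm (Φ (u, v))) - ι ((extChartAt (𝓡 d) p).symm u)‖ = ‖v‖

lemma IsRadialCenter.contDiffAt_slice {p : M} {Φ : 𝔼 × 𝔼 → 𝔼} {u : 𝔼}
    (h : IsRadialCenter ι p Φ u) :
    ContDiffAt ℝ 5 (fun v => Φ (u, v)) 0 :=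
  ContDiffAt.comp (f := fun v : 𝔼 => (u, v)) 0 h.contDiffAt (by fun_prop)

lemma IsRadialCenter.norm_fderiv {p : M} {Φ : 𝔼 × 𝔼 → 𝔼} {u : 𝔼}
    (hι : IsIsometricEmbedding (d := d) ι) (h : IsRadialCenter ι p Φ u) (v : 𝔼) :
    ‖fderiv ℝ (fun v => ι ((extChartAt (𝓡 d) p).symm (Φ (u, v)))) 0 v‖ = ‖v‖ := by
  refine norm_fderiv_of_radial (G := fun v => ι ((extChartAt (𝓡 d) p).symm (Φ (u, v)))) ?_ ?_ v
  · have h1 : ContDiffAt ℝ 3 (ι ∘ (extChartAt (𝓡 d) p).symm) (Φ (u, 0)) :=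
      (contDiffAt_comp_extChartAt_symm le_rfl hι.contMDiff
        (by rw [h.apply_zero]; exact h.mem_target)).of_le ENat.LEInfty.out
    exact ContDiffAt.comp (f := fun v => Φ (u, v)) 0 h1 (h.contDiffAt_slice.of_le (by norm_num))
  · filter_upwards [h.norm_eq] with v hv
    rw [h.apply_zero, hv]

lemma IsRadialCenter.radialJacobian_eq_one {p : M} {Φ : 𝔼 × 𝔼 → 𝔼} {u : 𝔼}
    (hι : IsIsometricEmbedding (d := d) ι) (h : IsRadialCenter ι p Φ u) : radialJacobian ι p Φ (u, 0) = 1 :=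
  jac_eq_one (h.norm_fderiv hι)

lemma IsRadialCenter.contDiffAt_radialJacobian {p : M} {Φ : 𝔼 × 𝔼 → 𝔼} {u : 𝔼}
    (hι : IsIsometricEmbedding (d := d) ι) (h : IsRadialCenter ι p Φ u) : ContDiffAt ℝ 4 (radialJacobian ι p Φ) (u, 0) := by
  refine contDiffAt_jac_slice (n := 4) (c := (u, 0))
    (G := fun y => ι ((extChartAt (𝓡 d) p).symm (Φ y))) ?_ (injective_of_norm_map (h.norm_fderiv hι))
  have h1 : ContDiffAt ℝ 5 (ι ∘ (extChartAt (𝓡 d) p).symm) (Φ (u, 0)) :=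
    (contDiffAt_comp_extChartAt_symm le_rfl hι.contMDiff
      (by rw [h.apply_zero]; exact h.mem_target)).of_le ENat.LEInfty.out
  exact ContDiffAt.comp (f := Φ) (u, 0) h1 h.contDiffAt

/-- The Laplacian at the centre of a function times the Jacobian, in radial coordinates. -/
lemma IsRadialCenter.sum_fderiv_fderiv_mul {p : M} {Φ : 𝔼 × 𝔼 → 𝔼} {u : 𝔼}
    (hι : IsIsometricEmbedding (d := d) ι) (h : IsRadialCenter ι p Φ u) {f : M → ℝ} (hf : ContMDiff (𝓡 d) 𝓘(ℝ, ℝ) 2 f) :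
    ∑ i, fderiv ℝ (fderiv ℝ fun v => f ((extChartAt (𝓡 d) p).symm (Φ (u, v))) *
      radialJacobian ι p Φ (u, v)) 0 (stdVec i) (stdVec i) =
    f ((extChartAt (𝓡 d) p).symm u) *
      ∑ i, fderiv ℝ (fderiv ℝ fun v => radialJacobian ι p Φ (u, v)) 0 (stdVec i) (stdVec i) +
      laplaceBeltrami d f ((extChartAt (𝓡 d) p).symm u) := by
  have hj : ContDiffAt ℝ 2 (fun v => radialJacobian ι p Φ (u, v)) 0 :=
    ContDiffAt.comp (f := fun v : 𝔼 => (u, v)) 0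
      ((h.contDiffAt_radialJacobian hι).of_le (by norm_num)) (by fun_prop)
  have hmem : Φ (u, 0) ∈ (extChartAt (𝓡 d) p).target := by
    rw [h.apply_zero]; exact h.mem_target
  have hfΘ : ContDiffAt ℝ 2 (fun v => f ((extChartAt (𝓡 d) p).symm (Φ (u, v)))) 0 :=
    ContDiffAt.comp (g := f ∘ (extChartAt (𝓡 d) p).symm) (f := fun v => Φ (u, v)) 0
      (contDiffAt_comp_extChartAt_symm ENat.LEInfty.out hf hmem)
      (h.contDiffAt_slice.of_le (by norm_num))
  have h1 := laplaceBeltrami_of_radial hι (p := p) (Θ := fun v => Φ (u, v))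
    (h.contDiffAt_slice.of_le (by norm_num)) hmem
    (by filter_upwards [h.norm_eq] with v hv; rw [h.apply_zero, hv]) hf
  have h2 : (f ∘ (extChartAt (𝓡 d) p).symm) ∘ (fun v => Φ (u, v)) =
      fun v => f ((extChartAt (𝓡 d) p).symm (Φ (u, v))) := rfl
  have h3 : (fun v => jac (fderiv ℝ ((ι ∘ (extChartAt (𝓡 d) p).symm) ∘ fun v => Φ (u, v)) v)) =
      fun v => radialJacobian ι p Φ (u, v) := rfl
  rw [h2, h3, h.apply_zero] at h1
  rw [← h1]
  -- As `J = 1` at the centre, the mixed terms of the product rule are exactly the first-order part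
  -- `2 ∑ ∂ᵢJ ∂ᵢf` of the Laplacian.
  simp only [fderiv_fderiv_mul hfΘ hj, h.radialJacobian_eq_one hι, h.apply_zero,
    Finset.sum_add_distrib, Finset.mul_sum, two_mul]
  have h4 : ∀ i, fderiv ℝ (fun v => f ((extChartAt (𝓡 d) p).symm (Φ (u, v)))) 0 (stdVec i) *
      fderiv ℝ (fun v => radialJacobian ι p Φ (u, v)) 0 (stdVec i) =
      fderiv ℝ (fun v => radialJacobian ι p Φ (u, v)) 0 (stdVec i) *
      fderiv ℝ (fun v => f ((extChartAt (𝓡 d) p).symm (Φ (u, v)))) 0 (stdVec i) :=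
    fun i => mul_comm _ _
  simp only [h4, one_mul]
  ring

/-- At `v' = 0` the inner Jacobian is `1` and the integrand is `g q` times the Jacobian around `u`.
The inner Jacobian is taken at `Φ (u, v)`, hence the hypothesis on nearby centres. -/
lemma IsRadialCenter.sum_fderiv_fderiv_radialIntegrand_fst {p : M} {Φ : 𝔼 × 𝔼 → 𝔼} {u : 𝔼}
    (hι : IsIsometricEmbedding (d := d) ι) (h : IsRadialCenter ι p Φ u) (h' : ∀ᶠ w in 𝓝 u, IsRadialCenter ι p Φ w)
    {g q : M → ℝ} (hg : ContMDiff (𝓡 d) 𝓘(ℝ, ℝ) 2 g) (hq : ContMDiff (𝓡 d) 𝓘(ℝ, ℝ) 2 q)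
    (hc : ContDiffAt ℝ 2 (radialIntegrand Φ (radialJacobian ι p Φ)
      (g ∘ (extChartAt (𝓡 d) p).symm) (q ∘ (extChartAt (𝓡 d) p).symm)) (u, 0)) :
    ∑ i, fderiv ℝ (fderiv ℝ (radialIntegrand Φ (radialJacobian ι p Φ)
      (g ∘ (extChartAt (𝓡 d) p).symm) (q ∘ (extChartAt (𝓡 d) p).symm))) (u, 0)
        (0, (stdVec i, 0)) (0, (stdVec i, 0)) =
    g ((extChartAt (𝓡 d) p).symm u) * q ((extChartAt (𝓡 d) p).symm u) *
      ∑ i, fderiv ℝ (fderiv ℝ fun v => radialJacobian ι p Φ (u, v)) 0 (stdVec i) (stdVec i) +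
      laplaceBeltrami d (fun y => g y * q y) ((extChartAt (𝓡 d) p).symm u) := by
  set φ := extChartAt (𝓡 d) p with hφ
  set L : 𝔼 →L[ℝ] 𝔼 × (𝔼 × 𝔼) :=
    (ContinuousLinearMap.inr ℝ 𝔼 (𝔼 × 𝔼)) ∘L (ContinuousLinearMap.inl ℝ 𝔼 𝔼) with hL
  have hLv : ∀ v, L v = (0, (v, 0)) := fun v => rfl
  have e1 : ∀ᶠ v in 𝓝 (0 : 𝔼), IsRadialCenter ι p Φ (Φ (u, v)) := by
    have ht : Tendsto (fun v => Φ (u, v)) (𝓝 0) (𝓝 u) := by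
      have := h.contDiffAt_slice.continuousAt.tendsto
      rwa [h.apply_zero] at this
    exact ht.eventually h'
  have e2 : (fun v => radialIntegrand Φ (radialJacobian ι p Φ) (g ∘ φ.symm) (q ∘ φ.symm)
      ((u, 0) + L v)) =ᶠ[𝓝 0] fun v => (fun y => g y * q y) (φ.symm (Φ (u, v))) *
      radialJacobian ι p Φ (u, v) := by
    filter_upwards [e1] with v hv
    simp only [hLv, radialIntegrand, Prod.mk_add_mk, add_zero, zero_add,
      hv.apply_zero, hv.radialJacobian_eq_one hι,
      Function.comp_apply]
    ring
  rw [← h.sum_fderiv_fderiv_mul hι (f := fun y => g y * q y) (hg.mul hq)]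
  refine Finset.sum_congr rfl fun i _ => ?_
  rw [← e2.fderiv.fderiv_eq, fderiv_fderiv_comp_affine hc]
  simp only [hLv]

/-- At `v = 0` the outer factor is the constant `q` and the inner one is `g` times the Jacobian
around `u`. -/
lemma IsRadialCenter.sum_fderiv_fderiv_radialIntegrand_snd {p : M} {Φ : 𝔼 × 𝔼 → 𝔼} {u : 𝔼}
    (hι : IsIsometricEmbedding (d := d) ι) (h : IsRadialCenter ι p Φ u)
    {g q : M → ℝ} (hg : ContMDiff (𝓡 d) 𝓘(ℝ, ℝ) 2 g)
    (hc : ContDiffAt ℝ 2 (radialIntegrand Φ (radialJacobian ι p Φ)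
      (g ∘ (extChartAt (𝓡 d) p).symm) (q ∘ (extChartAt (𝓡 d) p).symm)) (u, 0)) :
    ∑ i, fderiv ℝ (fderiv ℝ (radialIntegrand Φ (radialJacobian ι p Φ)
      (g ∘ (extChartAt (𝓡 d) p).symm) (q ∘ (extChartAt (𝓡 d) p).symm))) (u, 0)
        (0, (0, stdVec i)) (0, (0, stdVec i)) =
    q ((extChartAt (𝓡 d) p).symm u) * (g ((extChartAt (𝓡 d) p).symm u) *
      ∑ i, fderiv ℝ (fderiv ℝ fun v => radialJacobian ι p Φ (u, v)) 0 (stdVec i) (stdVec i) +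
      laplaceBeltrami d g ((extChartAt (𝓡 d) p).symm u)) := by
  set φ := extChartAt (𝓡 d) p with hφ
  set L : 𝔼 →L[ℝ] 𝔼 × (𝔼 × 𝔼) :=
    (ContinuousLinearMap.inr ℝ 𝔼 (𝔼 × 𝔼)) ∘L (ContinuousLinearMap.inr ℝ 𝔼 𝔼) with hL
  have hLv : ∀ v, L v = (0, (0, v)) := fun v => rfl
  have e2 : (fun v => radialIntegrand Φ (radialJacobian ι p Φ) (g ∘ φ.symm) (q ∘ φ.symm)
      ((u, 0) + L v)) = fun v => q (φ.symm u) * (g (φ.symm (Φ (u, v))) *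
      radialJacobian ι p Φ (u, v)) := by
    ext v
    simp only [hLv, radialIntegrand, Prod.mk_add_mk, add_zero, zero_add,
      h.apply_zero, h.radialJacobian_eq_one hι,
      Function.comp_apply]
    ring
  have hj : ContDiffAt ℝ 2 (fun v => radialJacobian ι p Φ (u, v)) 0 :=
    ContDiffAt.comp (f := fun v : 𝔼 => (u, v)) 0
      ((h.contDiffAt_radialJacobian hι).of_le (by norm_num)) (by fun_prop)
  have hmem : Φ (u, 0) ∈ (extChartAt (𝓡 d) p).target := by
    rw [h.apply_zero]; exact h.mem_target
  have hgΘ : ContDiffAt ℝ 2 (fun v => g ((extChartAt (𝓡 d) p).symm (Φ (u, v)))) 0 :=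
    ContDiffAt.comp (g := g ∘ (extChartAt (𝓡 d) p).symm) (f := fun v => Φ (u, v)) 0
      (contDiffAt_comp_extChartAt_symm ENat.LEInfty.out hg hmem)
      (h.contDiffAt_slice.of_le (by norm_num))
  rw [← h.sum_fderiv_fderiv_mul hι hg, Finset.mul_sum]
  refine Finset.sum_congr rfl fun i _ => ?_
  have h1 := fderiv_fderiv_mul (f := fun _ => q (φ.symm u)) (g := fun v => g (φ.symm (Φ (u, v))) *
    radialJacobian ι p Φ (u, v)) (x := 0) contDiffAt_const (hgΘ.mul hj) (stdVec i) (stdVec i)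
  have h2 := fderiv_fderiv_comp_affine hc L (stdVec i) (stdVec i)
  rw [e2, h1] at h2
  rw [hLv] at h2
  have h3 : fderiv ℝ (fun _ : 𝔼 => q (φ.symm u)) = 0 := by
    ext x
    simp
  rw [← h2, h3, fderiv_zero]
  simp [hφ]

end RadialTraces

/-! ### The expansion of the double average near a point. -/

section LocalExpansion

attribute [local instance 2000] chartedSpaceSelf

lemma integral_scaled_kernel {d : ℕ} (K : ℝ → ℝ)
    (H : EuclideanSpace ℝ (Fin d) × EuclideanSpace ℝ (Fin d) → ℝ) {s : ℝ} (hs : 0 < s) :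
    (s ^ (2 * d))⁻¹ * ∫ z : EuclideanSpace ℝ (Fin d) × EuclideanSpace ℝ (Fin d),
      K (‖z.1‖ / s) * (K (‖z.2‖ / s) * H z) =
    ∫ z : EuclideanSpace ℝ (Fin d) × EuclideanSpace ℝ (Fin d), K ‖z.1‖ * K ‖z.2‖ * H (s • z) := by
  have : (volume : Measure (EuclideanSpace ℝ (Fin d) × EuclideanSpace ℝ (Fin d))).IsAddHaarMeasure :=
    inferInstanceAs (volume.prod volume : Measure (EuclideanSpace ℝ (Fin d) ×
      EuclideanSpace ℝ (Fin d))).IsAddHaarMeasure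
  have h := Measure.integral_comp_smul
    (volume : Measure (EuclideanSpace ℝ (Fin d) × EuclideanSpace ℝ (Fin d)))
    (fun z => K (‖z.1‖ / s) * (K (‖z.2‖ / s) * H z)) s
  have hr : Module.finrank ℝ (EuclideanSpace ℝ (Fin d) × EuclideanSpace ℝ (Fin d)) = 2 * d := by
    rw [Module.finrank_prod]; simp [two_mul]
  rw [hr, abs_of_pos (by positivity), smul_eq_mul] at h
  rw [← h]
  refine integral_congr_ae (Eventually.of_forall fun z => ?_)
  have hn : ∀ v : EuclideanSpace ℝ (Fin d), ‖s • v‖ / s = ‖v‖ := fun v => by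
    rw [norm_smul, Real.norm_of_nonneg hs.le, mul_div_cancel_left₀ _ hs.ne']
  simp only [Prod.smul_fst, Prod.smul_snd, hn, mul_assoc]

variable {d D : ℕ} {M : Type*} [TopologicalSpace M] [ChartedSpace (EuclideanSpace ℝ (Fin d)) M]
  [IsManifold (𝓡 d) ∞ M] [RiemannianBundle (fun x : M => TangentSpace (𝓡 d) x)]
  {ι : M → EuclideanSpace ℝ (Fin D)}

local notation "𝔼" => EuclideanSpace ℝ (Fin d)

/-- Radial coordinates in which the integrand of the double average is controlled. -/
lemma exists_radial_coordinates (hι : IsIsometricEmbedding (d := d) ι) (p : M) {O : Set 𝔼}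
    (hO : O ∈ 𝓝 (extChartAt (𝓡 d) p p)) :
    ∃ (Φ : 𝔼 × 𝔼 → 𝔼) (δ C : ℝ), 0 < δ ∧ 0 ≤ C ∧
      ∀ u ∈ Metric.ball (extChartAt (𝓡 d) p p) δ,
        (∀ᶠ w in 𝓝 u, IsRadialCenter ι p Φ w) ∧ IsRadialAt ι p Φ δ u ∧
        (∀ v ∈ Metric.ball (0 : 𝔼) δ, IsRadialAt ι p Φ δ (Φ (u, v))) ∧
        ∀ z ∈ Metric.ball (0 : 𝔼 × 𝔼) δ, ∀ (g q : 𝔼 → ℝ) (G Q : ℝ),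
          (∀ w ∈ O, CkAt 4 g G w) → (∀ w ∈ O, CkAt 4 q Q w) →
          CkAt 4 (radialIntegrand Φ (radialJacobian ι p Φ) g q) (C * (G * Q)) (u, z) := by
  set c := extChartAt (𝓡 d) p p with hc
  -- Order five, because the Jacobian loses one derivative and the integrand has to be `C⁴`.
  obtain ⟨Φ, r, hr, h1, h2, h3⟩ := exists_radial_parametrization hι p hO 5 (by norm_num)
  have hcen : ∀ u ∈ Metric.ball c r, IsRadialCenter ι p Φ u := fun u hu => by
    obtain ⟨a1, a2, a3⟩ := h1 u hu
    refine ⟨(a3 0 (Metric.mem_ball_self hr)).1, a1, a2, ?_⟩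
    filter_upwards [Metric.ball_mem_nhds (0 : 𝔼) hr] with v hv
    exact (a3 v hv).2.2.2
  have hrad : ∀ δ ≤ r, ∀ u ∈ Metric.ball c r, IsRadialAt ι p Φ δ u := fun δ hδ u hu => by
    obtain ⟨a1, a2, a3⟩ := h1 u hu
    have hsub : Metric.ball (0 : 𝔼) δ ⊆ Metric.ball 0 r := Metric.ball_subset_ball hδ
    exact ⟨fun v hv => (a3 v (hsub hv)).1.of_le (by norm_num),
      fun v hv => (a3 v (hsub hv)).2.2.1, fun v hv => (a3 v (hsub hv)).2.2.2,
      (h2 u hu).mono hsub, h3 u hu δ hδ⟩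
  have hcc := hcen c (Metric.mem_ball_self hr)
  obtain ⟨C, hC, hev⟩ := exists_ckAt_radialIntegrand (hcc.contDiffAt.of_le (by norm_num))
    hcc.apply_zero (hcc.contDiffAt_radialJacobian hι) hO
  have ht : Tendsto (fun x : 𝔼 × (𝔼 × 𝔼) => Φ (x.1, x.2.1)) (𝓝 (c, 0)) (𝓝 c) := by
    have hp : ContinuousAt (fun x : 𝔼 × (𝔼 × 𝔼) => (x.1, x.2.1)) (c, 0) := by fun_prop
    have h4 : ContinuousAt (fun x : 𝔼 × (𝔼 × 𝔼) => Φ (x.1, x.2.1)) (c, 0) :=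
      ContinuousAt.comp (g := Φ) (f := fun x : 𝔼 × (𝔼 × 𝔼) => (x.1, x.2.1))
        hcc.contDiffAt.continuousAt hp
    have h5 : Tendsto _ _ (𝓝 (Φ (c, 0))) := h4
    rwa [hcc.apply_zero] at h5
  obtain ⟨r', hr', hball⟩ := Metric.eventually_nhds_iff_ball.1
    (hev.and (ht.eventually (Metric.ball_mem_nhds c hr)))
  have hin : ∀ u ∈ Metric.ball c (min r r'), ∀ z ∈ Metric.ball (0 : 𝔼 × 𝔼) (min r r'),
      (u, z) ∈ Metric.ball (c, (0 : 𝔼 × 𝔼)) r' := fun u hu z hz => by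
    rw [← ball_prod_same]
    exact ⟨Metric.ball_subset_ball (min_le_right _ _) hu,
      Metric.ball_subset_ball (min_le_right _ _) hz⟩
  refine ⟨Φ, min r r', C, lt_min hr hr', hC, fun u hu => ?_⟩
  have hur : u ∈ Metric.ball c r := Metric.ball_subset_ball (min_le_left _ _) hu
  refine ⟨?_, hrad _ (min_le_left _ _) u hur, fun v hv => hrad _ (min_le_left _ _) _ ?_,
    fun z hz => (hball _ (hin u hu z hz)).1⟩
  · filter_upwards [Metric.isOpen_ball.mem_nhds hur] with w hw using hcen w hw
  · have hz : ((v, 0) : 𝔼 × 𝔼) ∈ Metric.ball (0 : 𝔼 × 𝔼) (min r r') := by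
      rw [mem_ball_zero_iff] at hv ⊢
      simpa [Prod.norm_def] using hv
    exact (hball _ (hin u hu _ hz)).2

variable [MeasurableSpace M] [BorelSpace M] [CompactSpace M]

/-- The small-scale expansion of the double average, locally uniformly in the centre and in the
functions. -/
lemma exists_local_expansion (hd : 1 ≤ d) (hι : IsIsometricEmbedding (d := d) ι) {K : ℝ → ℝ}
    (hK : IsKernelFunction d K) (p : M) {O : Set 𝔼} (hO : O ∈ 𝓝 (extChartAt (𝓡 d) p p)) :
    ∃ C : ℝ, 0 ≤ C ∧ ∀ᶠ x in 𝓝 p, ∀ (g q : M → ℝ) (G Q : ℝ),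
      ContMDiff (𝓡 d) 𝓘(ℝ, ℝ) 4 g → ContMDiff (𝓡 d) 𝓘(ℝ, ℝ) 4 q →
      (∀ w ∈ O, CkAt 4 (g ∘ (extChartAt (𝓡 d) p).symm) G w) →
      (∀ w ∈ O, CkAt 4 (q ∘ (extChartAt (𝓡 d) p).symm) Q w) →
      (∀ y, |g y| ≤ G) → (∀ y, |q y| ≤ Q) →
      ∃ S τ : ℝ, τ = 2 * (g x * q x * S) + laplaceBeltrami d (fun y => g y * q y) x +
          q x * laplaceBeltrami d g x ∧ |τ| ≤ C * (G * Q) ∧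
        ∀ s : ℝ, 0 < s →
          |(s ^ (2 * d))⁻¹ * doubleAverage (riemannianVolume d M) ι (fun t => K (t / s)) q g x -
            (g x * q x + s ^ 2 * kernelMoment d K 1 2 0 / (2 * d) * τ)| ≤ C * (G * Q) * s ^ 4 := by
  have hfin := isFiniteMeasure_riemannianVolume (d := d) hι
  have hsc : SecondCountableTopology M := hι.isEmbedding.secondCountableTopology
  have hιm : Measurable ι := hι.contMDiff.continuous.measurable
  set c := extChartAt (𝓡 d) p p with hc
  obtain ⟨Φ, δ, C₀, hδ, hC₀, hΦ⟩ := exists_radial_coordinates hι p hO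
  obtain ⟨C₁, hC₁, hexp⟩ := kernel_average_expansion hd hK
  obtain ⟨κ, hκ0, hκ⟩ := hK.exists_le_div_pow 0
  -- The normalization `s^(-2d)` costs `2d` powers of `s`, and the tail must still be of order `s⁴`.
  obtain ⟨C₂, hC₂, hdec⟩ := hK.exists_le_div_pow (2 * d + 4)
  set vol := ((riemannianVolume d M).prod (riemannianVolume d M)).real Set.univ with hvol
  have hvol0 : 0 ≤ vol := measureReal_nonneg
  set T := 2 + 2 / δ ^ 4 + 1 / δ ^ 2 with hT
  have hT0 : 0 ≤ T := by positivity
  -- The summands bound, in this order, the coefficient `τ`, the Taylor remainder and the tail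
  -- beyond `δ`.
  set C := 2 * d * C₀ + (C₁ * (T * C₀) + κ * (C₂ / δ ^ (2 * d + 4)) * vol) with hC
  have hCa : 2 * d * C₀ ≤ C := le_add_of_nonneg_right (by positivity)
  have hCb : C₁ * (T * C₀) + κ * (C₂ / δ ^ (2 * d + 4)) * vol ≤ C :=
    le_add_of_nonneg_left (by positivity)
  refine ⟨C, by positivity, ?_⟩
  have hx1 : ∀ᶠ x in 𝓝 p, extChartAt (𝓡 d) p x ∈ Metric.ball c δ :=
    (continuousAt_extChartAt (I := 𝓡 d) p).eventually (Metric.ball_mem_nhds _ hδ)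
  filter_upwards [hx1, extChartAt_source_mem_nhds (I := 𝓡 d) p] with x hx hxs g q G Q hg hq hgO hqO
    hgG hqQ
  set u := extChartAt (𝓡 d) p x with hu
  have hxu : (extChartAt (𝓡 d) p).symm u = x := (extChartAt (𝓡 d) p).left_inv hxs
  obtain ⟨hcen, hrad, hrad', hck⟩ := hΦ u hx
  have hG : 0 ≤ G := (abs_nonneg _).trans (hgG x)
  have hQ : 0 ≤ Q := (abs_nonneg _).trans (hqQ x)
  set h := radialIntegrand Φ (radialJacobian ι p Φ) (g ∘ (extChartAt (𝓡 d) p).symm)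
    (q ∘ (extChartAt (𝓡 d) p).symm) with hh
  have hck' : ∀ z ∈ Metric.ball (0 : 𝔼 × 𝔼) δ, CkAt 4 h (C₀ * (G * Q)) (u, z) := fun z hz =>
    hck z hz _ _ G Q hgO hqO
  have hck0 := hck' 0 (Metric.mem_ball_self hδ)
  have hh0 : h (u, 0) = g x * q x := by
    have h0 := hcen.self_of_nhds
    simp only [hh, radialIntegrand, Prod.fst_zero, Prod.snd_zero, h0.apply_zero,
      h0.radialJacobian_eq_one hι, Function.comp_apply, hxu]
    ring
  -- This purely geometric number occurs in both traces, multiplied by `g x * q x`.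
  set S := ∑ i, fderiv ℝ (fderiv ℝ fun v => radialJacobian ι p Φ (u, v)) 0 (stdVec i) (stdVec i)
    with hS
  set τ₁ := ∑ i, fderiv ℝ (fderiv ℝ h) (u, 0) (0, (stdVec i, 0)) (0, (stdVec i, 0)) with hτ₁
  set τ₂ := ∑ i, fderiv ℝ (fderiv ℝ h) (u, 0) (0, (0, stdVec i)) (0, (0, stdVec i)) with hτ₂
  have e1 : τ₁ = g x * q x * S + laplaceBeltrami d (fun y => g y * q y) x := by
    have := hcen.self_of_nhds.sum_fderiv_fderiv_radialIntegrand_fst hι hcen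
      (hg.of_le (by norm_num)) (hq.of_le (by norm_num)) (hck0.1.of_le (by norm_num))
    rwa [hxu] at this
  have e2 : τ₂ = q x * (g x * S + laplaceBeltrami d g x) := by
    have := hcen.self_of_nhds.sum_fderiv_fderiv_radialIntegrand_snd hι
      (hg.of_le (by norm_num)) (hck0.1.of_le (by norm_num))
    rwa [hxu] at this
  have hbound : ∀ w : 𝔼 × 𝔼, ‖w‖ = 1 →
      |fderiv ℝ (fderiv ℝ h) (u, 0) (0, w) (0, w)| ≤ C₀ * (G * Q) := fun w hw => by
    have h3 : ‖((0 : 𝔼), w)‖ = 1 := by rw [Prod.norm_def]; simp [hw]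
    have := hck0.abs_fderiv_fderiv_le (by norm_num) ((0 : 𝔼), w) ((0 : 𝔼), w)
    rwa [h3, mul_one, mul_one] at this
  refine ⟨S, τ₁ + τ₂, by rw [e1, e2]; ring, ?_, fun s hs => ?_⟩
  · have b1 : |τ₁| ≤ d * (C₀ * (G * Q)) := by
      refine (Finset.abs_sum_le_sum_abs _ _).trans ((Finset.sum_le_card_nsmul _ _ _ fun i _ =>
        hbound (stdVec i, 0) (by simp [Prod.norm_def])).trans ?_)
      simp
    have b2 : |τ₂| ≤ d * (C₀ * (G * Q)) := by
      refine (Finset.abs_sum_le_sum_abs _ _).trans ((Finset.sum_le_card_nsmul _ _ _ fun i _ =>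
        hbound (0, stdVec i) (by simp [Prod.norm_def])).trans ?_)
      simp
    calc |τ₁ + τ₂| ≤ |τ₁| + |τ₂| := abs_add_le _ _
      _ ≤ 2 * d * C₀ * (G * Q) := by linarith
      _ ≤ C * (G * Q) := by gcongr
  · set R : ℝ → ℝ := fun t => K (t / s) with hR
    have hRκ : ∀ t, 0 ≤ t → |R t| ≤ κ := fun t ht => by
      have ht' : 0 ≤ t / s := by positivity
      rw [abs_of_nonneg (hK.nonneg _ ht')]
      simpa using hκ _ ht'
    have hRτ : ∀ t, 0 ≤ t → δ ≤ t → |R t| ≤ C₂ / δ ^ (2 * d + 4) * s ^ (2 * d + 4) :=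
      fun t ht hδt => by
        have ht' : 0 ≤ t / s := by positivity
        rw [abs_of_nonneg (hK.nonneg _ ht')]
        refine (hdec _ ht').trans ?_
        have h4 : δ / s ≤ 1 + t / s := by
          have : δ / s ≤ t / s := by gcongr
          linarith
        calc C₂ / (1 + t / s) ^ (2 * d + 4) ≤ C₂ / (δ / s) ^ (2 * d + 4) := by gcongr
          _ = _ := by rw [div_pow, div_div_eq_mul_div, div_mul_eq_mul_div]
    have hRm : Measurable fun w : M × M => R ‖ι w.1 - ι w.2‖ := by
      have hcont : Continuous fun w : M × M => K (‖ι w.1 - ι w.2‖ / s) := by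
        have hιc := hι.contMDiff.continuous
        exact hK.continuous_comp (by fun_prop) fun w => by positivity
      exact hcont.measurable
    have hRn : Measurable fun v : 𝔼 => R ‖v‖ :=
      (hK.continuous_comp (by fun_prop) fun v : 𝔼 => by positivity : Continuous fun v : 𝔼 =>
        K (‖v‖ / s)).measurable
    have hgm := hg.continuous.measurable
    have hqm := hq.continuous.measurable
    have hfar := abs_doubleAverage_sub_nearKernel_le (V := riemannianVolume d M) hιm hRm hqm hgm hRκ
      hqQ hgG hRτ (by positivity) x
    have hnear := hrad.doubleAverage_nearKernel hι hrad' hRm hRn hRκ hqm hgm hck'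
    rw [hxu] at hnear
    set H := (Metric.ball (0 : 𝔼 × 𝔼) δ).indicator fun z => h (u, z) with hH
    have hscale := integral_scaled_kernel K H hs
    have hexp' := hexp H (h (u, 0)) (T * (C₀ * (G * Q)))
      ((fderiv ℝ (fderiv ℝ h) (u, 0)).bilinearComp (ContinuousLinearMap.inr ℝ 𝔼 (𝔼 × 𝔼))
        (ContinuousLinearMap.inr ℝ 𝔼 (𝔼 × 𝔼))) (measurable_indicator_slice hck')
      ⟨_, abs_indicator_slice_le hck0.nonneg hck'⟩
      (fun z => abs_even_taylor_indicator_le hδ hck' z) s hs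
    rw [← hscale, hh0] at hexp'
    have hfar' : |(s ^ (2 * d))⁻¹ * doubleAverage (riemannianVolume d M) ι R q g x -
        (s ^ (2 * d))⁻¹ * ∫ z : 𝔼 × 𝔼, R ‖z.1‖ * (R ‖z.2‖ * H z)| ≤
        κ * (C₂ / δ ^ (2 * d + 4)) * vol * (G * Q) * s ^ 4 := by
      rw [hnear] at hfar
      rw [← mul_sub, abs_mul, abs_of_pos (by positivity)]
      refine (mul_le_mul_of_nonneg_left hfar (by positivity)).trans (le_of_eq ?_)
      rw [pow_add s]
      field_simp
      ring
    calc |(s ^ (2 * d))⁻¹ * doubleAverage (riemannianVolume d M) ι R q g x -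
          (g x * q x + s ^ 2 * kernelMoment d K 1 2 0 / (2 * d) * (τ₁ + τ₂))|
        ≤ κ * (C₂ / δ ^ (2 * d + 4)) * vol * (G * Q) * s ^ 4 +
          C₁ * (T * (C₀ * (G * Q))) * s ^ 4 :=
          (abs_sub_le _ _ _).trans (add_le_add hfar' hexp')
      _ = (C₁ * (T * C₀) + κ * (C₂ / δ ^ (2 * d + 4)) * vol) * (G * Q) * s ^ 4 := by ring
      _ ≤ C * (G * Q) * s ^ 4 := by gcongr

end LocalExpansion

/-! ### The landmark operator as a quotient of double averages. -/

section LandmarkOperator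

variable {D : ℕ} {M : Type*} [MeasurableSpace M] {V : Measure M} [IsFiniteMeasure V]
  {ι : M → EuclideanSpace ℝ (Fin D)} {K : ℝ → ℝ} {q g : M → ℝ} {κ Q G ε : ℝ}

/-- Fubini: the left side integrates over the landmark `z` first, the double average over `y` first.
-/
lemma integral_landmarkKernel_mul (hR : Measurable fun w : M × M => K (‖ι w.1 - ι w.2‖ / √ε))
    (hq : Measurable q) (hg : Measurable g) (hRκ : ∀ t, 0 ≤ t → |K (t / √ε)| ≤ κ)
    (hqQ : ∀ x, |q x| ≤ Q) (hgG : ∀ x, |g x| ≤ G) (x : M) :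
    ∫ y, landmarkKernel V ι K q ε x y * g y ∂V =
      doubleAverage V ι (fun t => K (t / √ε)) q g x := by
  have hint := integrable_doubleAverage (V := V) (R := fun t => K (t / √ε)) hR hq hg hRκ hqQ hgG x
  have h1 := integral_integral_swap
    (f := fun z y => K (‖ι x - ι z‖ / √ε) * q z * (K (‖ι z - ι y‖ / √ε) * g y)) hint
  have h2 : doubleAverage V ι (fun t => K (t / √ε)) q g x =
      ∫ z, ∫ y, K (‖ι x - ι z‖ / √ε) * q z * (K (‖ι z - ι y‖ / √ε) * g y) ∂V ∂V := by
    simp only [doubleAverage, integral_const_mul]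
  rw [h2, h1]
  refine integral_congr_ae (Eventually.of_forall fun y => ?_)
  simp only [landmarkKernel, scaledKernel]
  rw [← integral_mul_const]
  refine integral_congr_ae (Eventually.of_forall fun z => ?_)
  simp only
  ring

/-- The bias of the landmark operator is a ratio of double averages. -/
lemma landmarkOperator_sub_eq (hR : Measurable fun w : M × M => K (‖ι w.1 - ι w.2‖ / √ε))
    (hq : Measurable q) {f pX : M → ℝ} (hf : Measurable f) (hp : Measurable pX)
    (hRκ : ∀ t, 0 ≤ t → |K (t / √ε)| ≤ κ) (hqQ : ∀ x, |q x| ≤ Q) {A B : ℝ} (hfA : ∀ x, |f x| ≤ A)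
    (hpB : ∀ x, |pX x| ≤ B) (x : M)
    (hne : doubleAverage V ι (fun t => K (t / √ε)) q pX x ≠ 0) :
    landmarkOperator V ι K pX q ε f x - f x =
      doubleAverage V ι (fun t => K (t / √ε)) q (fun y => (f y - f x) * pX y) x /
        doubleAverage V ι (fun t => K (t / √ε)) q pX x := by
  have hA : 0 ≤ A := (abs_nonneg _).trans (hfA x)
  have hfp : Measurable fun y => f y * pX y := hf.mul hp
  have hfpG : ∀ y, |f y * pX y| ≤ A * B := fun y => by
    rw [abs_mul]
    exact mul_le_mul (hfA y) (hpB y) (abs_nonneg _) hA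
  have hdeg : landmarkDegree V ι K pX q ε x = doubleAverage V ι (fun t => K (t / √ε)) q pX x :=
    integral_landmarkKernel_mul hR hq hp hRκ hqQ hpB x
  have hop : landmarkOperator V ι K pX q ε f x =
      doubleAverage V ι (fun t => K (t / √ε)) q (fun y => f y * pX y) x /
        doubleAverage V ι (fun t => K (t / √ε)) q pX x := by
    rw [landmarkOperator, hdeg, ← integral_landmarkKernel_mul hR hq hfp hRκ hqQ hfpG x,
      ← integral_div]
    refine integral_congr_ae (Eventually.of_forall fun y => ?_)
    simp only
    ring
  have hsub : doubleAverage V ι (fun t => K (t / √ε)) q (fun y => (f y - f x) * pX y) x =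
      doubleAverage V ι (fun t => K (t / √ε)) q (fun y => f y * pX y) x -
        f x * doubleAverage V ι (fun t => K (t / √ε)) q pX x := by
    have hfx : Measurable fun y => (f y - f x) * pX y := (hf.sub measurable_const).mul hp
    have hfxG : ∀ y, |(f y - f x) * pX y| ≤ (A + A) * B := fun y => by
      rw [abs_mul]
      exact mul_le_mul ((abs_sub _ _).trans (add_le_add (hfA y) (hfA x))) (hpB y) (abs_nonneg _)
        (by positivity)
    have hR' : Measurable fun w : M × M => (fun t => K (t / √ε)) ‖ι w.1 - ι w.2‖ := hR
    rw [doubleAverage_eq_integral_prod hR' hq hfx hRκ hqQ hfxG,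
      doubleAverage_eq_integral_prod hR' hq hfp hRκ hqQ hfpG,
      doubleAverage_eq_integral_prod hR' hq hp hRκ hqQ hpB, ← integral_const_mul,
      ← integral_sub (integrable_doubleAverage hR' hq hfp hRκ hqQ hfpG x)
        ((integrable_doubleAverage hR' hq hp hRκ hqQ hpB x).const_mul _)]
    refine integral_congr_ae (Eventually.of_forall fun w => ?_)
    simp only
    ring
  rw [hop, hsub, sub_div, mul_div_cancel_right₀ _ hne]

end LandmarkOperator

/-! ### Product rules for gradient and Laplacian. -/

section ProductRules

attribute [local instance 2000] chartedSpaceSelf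

variable {d D : ℕ} {M : Type*} [TopologicalSpace M] [ChartedSpace (EuclideanSpace ℝ (Fin d)) M]
  [IsManifold (𝓡 d) ∞ M] [RiemannianBundle (fun x : M => TangentSpace (𝓡 d) x)]
  {ι : M → EuclideanSpace ℝ (Fin D)}

local notation "𝔼" => EuclideanSpace ℝ (Fin d)

/-- The inner product of gradients in the preferred chart, in an orthonormal frame. -/
lemma exists_inner_gradient_eq_sum (hι : IsIsometricEmbedding (d := d) ι) (x : M) :
    ∃ b : Fin d → 𝔼, ∀ f h : M → ℝ, MDifferentiable (𝓡 d) 𝓘(ℝ, ℝ) f →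
      MDifferentiable (𝓡 d) 𝓘(ℝ, ℝ) h →
      inner ℝ (riemannianGradient d f x) (riemannianGradient d h x) =
        ∑ k, fderiv ℝ (f ∘ (extChartAt (𝓡 d) x).symm) (extChartAt (𝓡 d) x x) (b k) *
          fderiv ℝ (h ∘ (extChartAt (𝓡 d) x).symm) (extChartAt (𝓡 d) x x) (b k) := by
  have hu := mem_extChartAt_target (I := 𝓡 d) x
  obtain ⟨T, hT⟩ := exists_isometric_precomp (injective_fderiv_chart hι hu)
  refine ⟨fun k => T (stdVec k), fun f h hf hh => ?_⟩
  have h1 := inner_gradient_eq_sum hι hu (B := (T : 𝔼 →L[ℝ] 𝔼)) hT (f := f) (h := h) (hf _) (hh _)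
  rw [extChartAt_to_inv] at h1
  exact h1

lemma differentiableAt_chart {f : M → ℝ} (hf : ContMDiff (𝓡 d) 𝓘(ℝ, ℝ) 1 f) (x : M) :
    DifferentiableAt ℝ (f ∘ (extChartAt (𝓡 d) x).symm) (extChartAt (𝓡 d) x x) :=
  (contDiffAt_comp_extChartAt_symm ENat.LEInfty.out hf (mem_extChartAt_target x)).differentiableAt
    one_ne_zero

lemma inner_gradient_mul (hι : IsIsometricEmbedding (d := d) ι) {f g h : M → ℝ}
    (hf : ContMDiff (𝓡 d) 𝓘(ℝ, ℝ) 1 f) (hg : ContMDiff (𝓡 d) 𝓘(ℝ, ℝ) 1 g)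
    (hh : ContMDiff (𝓡 d) 𝓘(ℝ, ℝ) 1 h) (x : M) :
    inner ℝ (riemannianGradient d (fun y => f y * g y) x) (riemannianGradient d h x) =
      f x * inner ℝ (riemannianGradient d g x) (riemannianGradient d h x) +
      g x * inner ℝ (riemannianGradient d f x) (riemannianGradient d h x) := by
  obtain ⟨b, hb⟩ := exists_inner_gradient_eq_sum hι x
  rw [hb (fun y => f y * g y) _ ((hf.mul hg).mdifferentiable one_ne_zero) (hh.mdifferentiable one_ne_zero),
    hb _ _ (hg.mdifferentiable one_ne_zero) (hh.mdifferentiable one_ne_zero),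
    hb _ _ (hf.mdifferentiable one_ne_zero) (hh.mdifferentiable one_ne_zero),
    Finset.mul_sum, Finset.mul_sum, ← Finset.sum_add_distrib]
  refine Finset.sum_congr rfl fun k _ => ?_
  have h1 : (fun y => f y * g y) ∘ (extChartAt (𝓡 d) x).symm =
      fun u => (f ∘ (extChartAt (𝓡 d) x).symm) u * (g ∘ (extChartAt (𝓡 d) x).symm) u := rfl
  rw [h1, fderiv_fun_mul (differentiableAt_chart hf x) (differentiableAt_chart hg x)]
  simp only [_root_.add_apply, _root_.smul_apply, smul_eq_mul, Function.comp_apply,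
    extChartAt_to_inv]
  ring

lemma inner_gradient_sub_const (hι : IsIsometricEmbedding (d := d) ι) {f h : M → ℝ}
    (hf : ContMDiff (𝓡 d) 𝓘(ℝ, ℝ) 1 f) (hh : ContMDiff (𝓡 d) 𝓘(ℝ, ℝ) 1 h) (c : ℝ) (x : M) :
    inner ℝ (riemannianGradient d (fun y => f y - c) x) (riemannianGradient d h x) =
      inner ℝ (riemannianGradient d f x) (riemannianGradient d h x) := by
  obtain ⟨b, hb⟩ := exists_inner_gradient_eq_sum hι x
  rw [hb (fun y => f y - c) _ ((hf.sub contMDiff_const).mdifferentiable one_ne_zero)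
    (hh.mdifferentiable one_ne_zero),
    hb _ _ (hf.mdifferentiable one_ne_zero) (hh.mdifferentiable one_ne_zero)]
  have h1 : (fun y => f y - c) ∘ (extChartAt (𝓡 d) x).symm =
      fun u => (f ∘ (extChartAt (𝓡 d) x).symm) u - c := rfl
  rw [h1, fderiv_sub_const]

lemma inner_gradient_const (hι : IsIsometricEmbedding (d := d) ι) {h : M → ℝ}
    (hh : ContMDiff (𝓡 d) 𝓘(ℝ, ℝ) 1 h) (c : ℝ) (x : M) :
    inner ℝ (riemannianGradient d (fun _ => c) x) (riemannianGradient d h x) = 0 := by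
  obtain ⟨b, hb⟩ := exists_inner_gradient_eq_sum hι x
  rw [hb _ _ ((contMDiff_const (n := 1)).mdifferentiable one_ne_zero)
    (hh.mdifferentiable one_ne_zero)]
  have h1 : (fun _ : M => c) ∘ (extChartAt (𝓡 d) x).symm = fun _ => c := rfl
  rw [h1]
  simp

lemma laplaceBeltrami_sub_const (f : M → ℝ) (c : ℝ) (x : M) :
    laplaceBeltrami d (fun y => f y - c) x = laplaceBeltrami d f x := by
  have h1 : (fun y => f y - c) ∘ (extChartAt (𝓡 d) x).symm =
      fun u => (f ∘ (extChartAt (𝓡 d) x).symm) u - c := rfl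
  simp only [laplaceBeltrami, h1, fderiv_sub_const]

/-- In radial coordinates `Δ` is `∑ ∂ᵢ²` plus a first-order term, and the coordinate frame at the
centre is orthonormal, so the rule is that of flat space. -/
lemma laplaceBeltrami_mul (hι : IsIsometricEmbedding (d := d) ι) {f g : M → ℝ}
    (hf : ContMDiff (𝓡 d) 𝓘(ℝ, ℝ) 2 f) (hg : ContMDiff (𝓡 d) 𝓘(ℝ, ℝ) 2 g) (x : M) :
    laplaceBeltrami d (fun y => f y * g y) x =
      f x * laplaceBeltrami d g x + g x * laplaceBeltrami d f x +
        2 * inner ℝ (riemannianGradient d f x) (riemannianGradient d g x) := by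
  obtain ⟨Φ, δ, C, hδ, -, hΦ⟩ := exists_radial_coordinates hι x (O := Set.univ) univ_mem
  have hu := mem_extChartAt_target (I := 𝓡 d) x
  have hxu : (extChartAt (𝓡 d) x).symm (extChartAt (𝓡 d) x x) = x := extChartAt_to_inv x
  have h := (hΦ _ (Metric.mem_ball_self hδ)).1.self_of_nhds
  set φ := extChartAt (𝓡 d) x with hφ
  set u := φ x with hu'
  have hΘ : ContDiffAt ℝ 5 (fun v => Φ (u, v)) 0 := h.contDiffAt_slice
  have h0 : (fun v => Φ (u, v)) 0 = u := h.apply_zero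
  have hr : ∀ᶠ v in 𝓝 (0 : 𝔼), ‖ι (φ.symm ((fun v => Φ (u, v)) v)) -
      ι (φ.symm ((fun v => Φ (u, v)) 0))‖ = ‖v‖ := by
    filter_upwards [h.norm_eq] with v hv
    rw [h.apply_zero, hv]
  set Θ : 𝔼 → 𝔼 := fun v => Φ (u, v) with hΘdef
  have hut : Θ 0 ∈ φ.target := by rw [h0]; exact hu
  have hLB : ∀ {k : M → ℝ}, ContMDiff (𝓡 d) 𝓘(ℝ, ℝ) 2 k →
      ∑ i, fderiv ℝ (fderiv ℝ ((k ∘ φ.symm) ∘ Θ)) 0 (stdVec i) (stdVec i) +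
      2 * ∑ i, fderiv ℝ (fun v => jac (fderiv ℝ ((ι ∘ φ.symm) ∘ Θ) v)) 0
        (stdVec i) * fderiv ℝ ((k ∘ φ.symm) ∘ Θ) 0 (stdVec i) = laplaceBeltrami d k x :=
    fun {k} hk => by
      have := laplaceBeltrami_of_radial hι (p := x) (hΘ.of_le (by norm_num)) hut hr hk
      rwa [h0, hxu] at this
  have hc : ∀ {k : M → ℝ}, ContMDiff (𝓡 d) 𝓘(ℝ, ℝ) 2 k → ContDiffAt ℝ 2 ((k ∘ φ.symm) ∘ Θ) 0 :=
    fun {k} hk => ContDiffAt.comp 0 (contDiffAt_comp_extChartAt_symm ENat.LEInfty.out hk hut)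
      (hΘ.of_le (by norm_num))
  have hval : ∀ k : M → ℝ, ((k ∘ φ.symm) ∘ Θ) 0 = k x := fun k => by
    simp only [Function.comp_apply, h0, hxu]
  have hmul : ((fun y => f y * g y) ∘ φ.symm) ∘ Θ =
      fun v => ((f ∘ φ.symm) ∘ Θ) v * ((g ∘ φ.symm) ∘ Θ) v := rfl
  have hgrad : inner ℝ (riemannianGradient d f x) (riemannianGradient d g x) =
      ∑ i, fderiv ℝ ((f ∘ φ.symm) ∘ Θ) 0 (stdVec i) * fderiv ℝ ((g ∘ φ.symm) ∘ Θ) 0 (stdVec i) := by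
    have hΘd : DifferentiableAt ℝ Θ 0 := hΘ.differentiableAt (by norm_num)
    have hch : ∀ {Y : Type} [NormedAddCommGroup Y] [NormedSpace ℝ Y] {k : M → Y},
        ContMDiff (𝓡 d) 𝓘(ℝ, Y) 1 k → ∀ v, fderiv ℝ ((k ∘ φ.symm) ∘ Θ) 0 v =
          fderiv ℝ (k ∘ φ.symm) u (fderiv ℝ Θ 0 v) := fun {Y} _ _ {k} hk v => by
      have hk' := (contDiffAt_comp_extChartAt_symm ENat.LEInfty.out hk hut).differentiableAt
        one_ne_zero
      rw [fderiv_comp 0 hk' hΘd, h0]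
      rfl
    have hB : ∀ v, ‖fderiv ℝ (ι ∘ φ.symm) u (fderiv ℝ Θ 0 v)‖ = ‖v‖ := fun v => by
      rw [← hch (hι.contMDiff.of_le ENat.LEInfty.out)]
      exact h.norm_fderiv hι v
    have h1 := inner_gradient_eq_sum hι hu hB (f := f) (h := g)
      (hf.mdifferentiable two_ne_zero _) (hg.mdifferentiable two_ne_zero _)
    rw [hxu] at h1
    rw [h1]
    refine Finset.sum_congr rfl fun i _ => ?_
    rw [hch (hf.of_le (by norm_num)), hch (hg.of_le (by norm_num))]
  rw [← hLB (k := fun y => f y * g y) (hf.mul hg), ← hLB hf, ← hLB hg, hgrad, hmul]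
  simp only [fderiv_fderiv_mul (hc hf) (hc hg), fderiv_fun_mul ((hc hf).differentiableAt two_ne_zero)
    ((hc hg).differentiableAt two_ne_zero), hval, _root_.add_apply, _root_.smul_apply, smul_eq_mul,
    mul_add, Finset.mul_sum, ← Finset.sum_add_distrib]
  exact Finset.sum_congr rfl fun i _ => by ring

end ProductRules

/-! ### The bias bound: local form and vanishing drift. -/

section BiasBound

attribute [local instance 2000] chartedSpaceSelf

/-- The error of the denominator enters multiplied by `m`. In the application both are of order `ε`,
so the leading term of the denominator suffices for an error of order `ε²`. -/
lemma abs_div_sub_div_le {N₁ N₂ a m T R E b : ℝ} (hb : 0 < b) (h₁ : |N₁ - m| ≤ R)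
    (h₂ : |N₂ - a| ≤ E) (hE : E ≤ b ^ 2 / 2) (ha : b ^ 2 ≤ a) (hm : |m| ≤ T) :
    |N₁ / N₂ - m / a| ≤ 2 * R / b ^ 2 + 2 * T * E / b ^ 4 := by
  have hb2 : 0 < b ^ 2 := by positivity
  have hN : b ^ 2 / 2 ≤ N₂ := by linarith [(abs_le.1 h₂).1]
  have hN0 : 0 < N₂ := by linarith
  have ha0 : 0 < a := by linarith
  have hT : 0 ≤ T := (abs_nonneg _).trans hm
  have hR : 0 ≤ R := (abs_nonneg _).trans h₁
  have hE0 : 0 ≤ E := (abs_nonneg _).trans h₂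
  have h : N₁ / N₂ - m / a = (N₁ - m) / N₂ + -(m * (N₂ - a)) / (N₂ * a) := by
    field_simp
    ring
  rw [h]
  refine (abs_add_le _ _).trans (add_le_add ?_ ?_)
  · rw [abs_div, abs_of_pos hN0]
    calc |N₁ - m| / N₂ ≤ R / (b ^ 2 / 2) := by gcongr
      _ = 2 * R / b ^ 2 := by field_simp
  · rw [abs_div, abs_neg, abs_mul, abs_of_pos (mul_pos hN0 ha0)]
    calc |m| * |N₂ - a| / (N₂ * a) ≤ T * E / (b ^ 2 / 2 * b ^ 2) := by gcongr
      _ = 2 * T * E / b ^ 4 := by field_simp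

variable {d D : ℕ} {M : Type*} [TopologicalSpace M] [ChartedSpace (EuclideanSpace ℝ (Fin d)) M]
  [IsManifold (𝓡 d) ∞ M] [RiemannianBundle (fun x : M => TangentSpace (𝓡 d) x)]
  {ι : M → EuclideanSpace ℝ (Fin D)} [MeasurableSpace M] [BorelSpace M] [CompactSpace M]

lemma IsKernelFunction.measurable_scaled {K : ℝ → ℝ} (hK : IsKernelFunction d K)
    (hι : Continuous ι) (s : ℝ) (hs : 0 ≤ s) [SecondCountableTopology M] :
    Measurable fun w : M × M => K (‖ι w.1 - ι w.2‖ / s) :=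
  (hK.continuous_comp (by fun_prop) fun w : M × M => by positivity :
    Continuous fun w : M × M => K (‖ι w.1 - ι w.2‖ / s)).measurable

/-- The second-order coefficient of the double average of `(f - f(x)) pX`, relative to the
leading coefficient of the double average of `pX`. -/
lemma bias_coefficient_eq (hι : IsIsometricEmbedding (d := d) ι) {pX pY f : M → ℝ}
    (hpX : ContMDiff (𝓡 d) 𝓘(ℝ, ℝ) 4 pX) (hpY : ContMDiff (𝓡 d) 𝓘(ℝ, ℝ) 4 pY)
    (hf : ContMDiff (𝓡 d) 𝓘(ℝ, ℝ) 4 f) {x : M} (hX : 0 < pX x) (hY : 0 < pY x) (μ : ℝ)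
    (hd : 1 ≤ d) :
    μ / (2 * d) * (laplaceBeltrami d (fun y => (f y - f x) * pX y * pY y) x +
      pY x * laplaceBeltrami d (fun y => (f y - f x) * pX y) x) / (pX x * pY x) =
    μ / d * inner ℝ ((2 / pX x) • riemannianGradient d pX x +
      (1 / pY x) • riemannianGradient d pY x) (riemannianGradient d f x) +
      μ / d * laplaceBeltrami d f x := by
  have hd0 : (d : ℝ) ≠ 0 := by exact_mod_cast (by omega : d ≠ 0)
  have hfx : ContMDiff (𝓡 d) 𝓘(ℝ, ℝ) 4 (fun y => f y - f x) := hf.sub contMDiff_const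
  have hXY : ContMDiff (𝓡 d) 𝓘(ℝ, ℝ) 4 (fun y => pX y * pY y) := hpX.mul hpY
  have h1 : (fun y => (f y - f x) * pX y * pY y) = fun y => (f y - f x) * (pX y * pY y) :=
    funext fun y => mul_assoc _ _ _
  have h2 := laplaceBeltrami_mul hι (f := fun y => f y - f x) (g := fun y => pX y * pY y)
    (hfx.of_le (by norm_num)) (hXY.of_le (by norm_num)) x
  have h3 := laplaceBeltrami_mul hι (f := fun y => f y - f x) (g := pX)
    (hfx.of_le (by norm_num)) (hpX.of_le (by norm_num)) x
  have h4 := inner_gradient_mul hι (f := pX) (g := pY) (h := f) (hpX.of_le (by norm_num))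
    (hpY.of_le (by norm_num)) (hf.of_le (by norm_num)) x
  -- `f - f x` vanishes at `x`, which removes the Laplacian of the other factor.
  rw [laplaceBeltrami_sub_const, inner_gradient_sub_const hι (hf.of_le (by norm_num))
    (hXY.of_le (by norm_num)), sub_self, zero_mul, zero_add, real_inner_comm, h4] at h2
  rw [laplaceBeltrami_sub_const, inner_gradient_sub_const hι (hf.of_le (by norm_num))
    (hpX.of_le (by norm_num)), sub_self, zero_mul, zero_add, real_inner_comm] at h3
  rw [h1, h2, h3, inner_add_left, real_inner_smul_left, real_inner_smul_left]
  field_simp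
  ring

/-- The bias expansion near a given point. -/
lemma exists_local_bias_bound (hd : 1 ≤ d) (hι : IsIsometricEmbedding (d := d) ι) {K : ℝ → ℝ}
    (hK : IsKernelFunction d K) {b : ℝ} (B : ℝ) (hb : 0 < b) (p : M) :
    ∃ C ε₀ : ℝ, 0 ≤ C ∧ 0 < ε₀ ∧ ∀ᶠ x in 𝓝 p, ∀ pX pY : M → ℝ,
      ContMDiff (𝓡 d) 𝓘(ℝ, ℝ) 4 pX → ContMDiff (𝓡 d) 𝓘(ℝ, ℝ) 4 pY →
      (∀ x, b ≤ pX x) → (∀ x, b ≤ pY x) → CkNormLE d ι 4 pX B → CkNormLE d ι 4 pY B →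
      ∀ f : M → ℝ, ContMDiff (𝓡 d) 𝓘(ℝ, ℝ) 4 f → ∀ A : ℝ, CkNormLE d ι 4 f A →
      ∀ ε : ℝ, 0 < ε → ε ≤ ε₀ →
        |landmarkOperator (riemannianVolume d M) ι K pX pY ε f x - f x
          - (ε * kernelMoment d K 1 2 0 / d *
              inner ℝ ((2 / pX x) • riemannianGradient d pX x +
                (1 / pY x) • riemannianGradient d pY x) (riemannianGradient d f x)
            + ε * kernelMoment d K 1 2 0 / d * laplaceBeltrami d f x)| ≤ C * A * ε ^ 2 := by
  -- For negative `B` no density satisfies the norm bound.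
  rcases lt_or_ge B 0 with hB | hB
  · refine ⟨0, 1, le_rfl, one_pos, Eventually.of_forall fun x pX pY _ _ _ _ hXB => ?_⟩
    exact absurd (hXB.nonneg x) (not_le.2 hB)
  have hfin := isFiniteMeasure_riemannianVolume (d := d) hι
  have hsc : SecondCountableTopology M := hι.isEmbedding.secondCountableTopology
  obtain ⟨C₁, hC₁, hev⟩ := exists_ckAt_chart hι p 4
  obtain ⟨O, hO, hck⟩ := eventually_iff_exists_mem.1 hev
  obtain ⟨C₂, hC₂, hloc⟩ := exists_local_expansion hd hι hK p hO
  obtain ⟨κ, hκ0, hκ⟩ := hK.exists_le_div_pow 0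
  set μ := kernelMoment d K 1 2 0 with hμ
  set m₀ := |μ| / (2 * d) with hm₀
  have hm₀0 : 0 ≤ m₀ := by positivity
  -- `C₁ + 1` lets one number bound both the density and its derivatives in the chart; `G₁ A` does
  -- the same for `(f - f x) pX`.
  set Q := (C₁ + 1) * B with hQ
  have hQ0 : 0 ≤ Q := by positivity
  set G₁ := 2 ^ 4 * (C₁ + 1) * Q with hG₁
  have hG₁0 : 0 ≤ G₁ := by positivity
  -- `E₀ ε` bounds the deviation of the normalized denominator from `pX pY`; the choice of `ε₀`
  -- keeps it below `b² / 2`, half of the least value of `pX pY` allowed.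
  set E₀ := C₂ * (Q * Q) * (m₀ + 1) with hE₀
  have hE₀0 : 0 ≤ E₀ := by positivity
  refine ⟨2 * (C₂ * (G₁ * Q)) / b ^ 2 + 2 * (m₀ * (C₂ * (G₁ * Q))) * E₀ / b ^ 4,
    min 1 (b ^ 2 / (2 * (E₀ + 1))), by positivity, by positivity, ?_⟩
  filter_upwards [hloc] with x hx pX pY hpX hpY hbX hbY hXB hYB f hf A hfA ε hε hεle
  have hA0 : 0 ≤ A := hfA.nonneg x
  have hfA' : ∀ y, |f y| ≤ A := hfA [] (Nat.zero_le _)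
  have hXB' : ∀ y, |pX y| ≤ B := hXB [] (Nat.zero_le _)
  have hYB' : ∀ y, |pY y| ≤ B := hYB [] (Nat.zero_le _)
  have hBQ : B ≤ Q := le_mul_of_one_le_left hB (by linarith)
  have hX0 : 0 < pX x := hb.trans_le (hbX x)
  have hY0 : 0 < pY x := hb.trans_le (hbY x)
  have hε1 : ε ≤ 1 := hεle.trans (min_le_left _ _)
  have hεE : E₀ * ε ≤ b ^ 2 / 2 := by
    have h1 : ε ≤ b ^ 2 / (2 * (E₀ + 1)) := hεle.trans (min_le_right _ _)
    rw [le_div_iff₀ (by positivity)] at h1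
    linarith
  set s := √ε with hs
  have hs0 : 0 < s := Real.sqrt_pos.2 hε
  have hs2 : s ^ 2 = ε := Real.sq_sqrt hε.le
  have hs4 : s ^ 4 = ε ^ 2 := by rw [← hs2]; ring
  -- the two double averages
  have hXck : ∀ w ∈ O, CkAt 4 (pX ∘ (extChartAt (𝓡 d) p).symm) Q w := fun w hw =>
    (hck w hw pX B hpX hXB).mono (by rw [hQ]; gcongr; linarith)
  have hYck : ∀ w ∈ O, CkAt 4 (pY ∘ (extChartAt (𝓡 d) p).symm) Q w := fun w hw =>
    (hck w hw pY B hpY hYB).mono (by rw [hQ]; gcongr; linarith)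
  have hgc : ContMDiff (𝓡 d) 𝓘(ℝ, ℝ) 4 (fun y => (f y - f x) * pX y) :=
    (hf.sub contMDiff_const).mul hpX
  have hgck : ∀ w ∈ O, CkAt 4 ((fun y => (f y - f x) * pX y) ∘ (extChartAt (𝓡 d) p).symm)
      (G₁ * A) w := fun w hw => by
    have h1 := (hck w hw f A hf hfA).sub_const (f x)
    have h2 : C₁ * A + ‖f x‖ ≤ (C₁ + 1) * A := by
      have := hfA' x
      rw [Real.norm_eq_abs]
      linarith
    refine ((h1.mono h2).mul (hXck w hw)).mono (le_of_eq ?_)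
    rw [hG₁]
    ring
  have hgG : ∀ y, |(f y - f x) * pX y| ≤ G₁ * A := fun y => by
    rw [abs_mul]
    have h1 : |f y - f x| ≤ 2 * A := by
      have := (abs_sub (f y) (f x)).trans (add_le_add (hfA' y) (hfA' x))
      linarith
    calc |f y - f x| * |pX y| ≤ 2 * A * Q := by
          gcongr
          exact (hXB' y).trans hBQ
      _ ≤ 2 ^ 4 * (C₁ + 1) * (A * Q) := by
          rw [mul_assoc]
          exact mul_le_mul_of_nonneg_right (by linarith) (by positivity)
      _ = G₁ * A := by rw [hG₁]; ring
  obtain ⟨S₁, τ₁, hτ₁, hτ₁b, hN₁⟩ := hx (fun y => (f y - f x) * pX y) pY (G₁ * A) Q hgc hpY hgck hYck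
    hgG (fun y => (hYB' y).trans hBQ)
  obtain ⟨S₂, τ₂, -, hτ₂b, hN₂⟩ := hx pX pY Q Q hpX hpY hXck hYck
    (fun y => (hXB' y).trans hBQ) (fun y => (hYB' y).trans hBQ)
  have hN₁' := hN₁ s hs0
  have hN₂' := hN₂ s hs0
  -- `(f - f x) pX` vanishes at `x`, so the leading term and the curvature term `S₁` drop out of the
  -- numerator.
  simp only [sub_self, zero_mul, mul_zero, zero_add] at hN₁' hτ₁
  rw [hs2, hs4] at hN₁' hN₂'
  set N₁ := (s ^ (2 * d))⁻¹ * doubleAverage (riemannianVolume d M) ι (fun t => K (t / s)) pY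
    (fun y => (f y - f x) * pX y) x with hN₁def
  set N₂ := (s ^ (2 * d))⁻¹ * doubleAverage (riemannianVolume d M) ι (fun t => K (t / s)) pY pX x
    with hN₂def
  have hcoef : |ε * μ / (2 * d)| = ε * m₀ := by
    rw [hm₀, abs_div, abs_mul, abs_of_pos hε, abs_of_nonneg (by positivity : (0 : ℝ) ≤ 2 * d)]
    ring
  have hm : |ε * μ / (2 * d) * τ₁| ≤ ε * m₀ * (C₂ * (G₁ * A * Q)) := by
    rw [abs_mul, hcoef]
    gcongr
  have hE : |N₂ - pX x * pY x| ≤ E₀ * ε := by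
    have h1 : |ε * μ / (2 * d) * τ₂| ≤ ε * m₀ * (C₂ * (Q * Q)) := by
      rw [abs_mul, hcoef]
      gcongr
    have h2 : N₂ - pX x * pY x = (N₂ - (pX x * pY x + ε * μ / (2 * d) * τ₂)) +
        ε * μ / (2 * d) * τ₂ := by ring
    rw [h2]
    have h3 : ε ^ 2 ≤ ε := pow_le_of_le_one hε.le hε1 two_ne_zero
    calc _ ≤ C₂ * (Q * Q) * ε ^ 2 + ε * m₀ * (C₂ * (Q * Q)) :=
          (abs_add_le _ _).trans (add_le_add hN₂' h1)
      _ ≤ C₂ * (Q * Q) * ε + ε * m₀ * (C₂ * (Q * Q)) := by gcongr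
      _ = E₀ * ε := by rw [hE₀]; ring
  have ha : b ^ 2 ≤ pX x * pY x := by
    rw [sq]
    exact mul_le_mul (hbX x) (hbY x) hb.le hX0.le
  have hmain := abs_div_sub_div_le hb hN₁' hE hεE ha hm
  -- identification of both sides
  have hpow : (s ^ (2 * d))⁻¹ ≠ 0 := by positivity
  have hN₂0 : N₂ ≠ 0 := by
    have h1 := (abs_le.1 hE).1
    have h2 : 0 < b ^ 2 := by positivity
    have : 0 < N₂ := by linarith
    exact this.ne'
  have hDne : doubleAverage (riemannianVolume d M) ι (fun t => K (t / s)) pY pX x ≠ 0 := fun h => by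
    rw [hN₂def, h, mul_zero] at hN₂0
    exact hN₂0 rfl
  have hR := hK.measurable_scaled hι.contMDiff.continuous s hs0.le
  have hRκ : ∀ t, 0 ≤ t → |K (t / s)| ≤ κ := fun t ht => by
    have ht' : 0 ≤ t / s := by positivity
    rw [abs_of_nonneg (hK.nonneg _ ht')]
    simpa using hκ _ ht'
  -- The normalization `s^(-2d)` cancels in the quotient.
  have hop : landmarkOperator (riemannianVolume d M) ι K pX pY ε f x - f x = N₁ / N₂ := by
    rw [landmarkOperator_sub_eq hR hpY.continuous.measurable hf.continuous.measurable
      hpX.continuous.measurable hRκ hYB' hfA' hXB' x hDne, hN₁def, hN₂def,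
      mul_div_mul_left _ _ hpow]
  have hco := bias_coefficient_eq hι hpX hpY hf hX0 hY0 (ε * μ) hd
  rw [← hτ₁] at hco
  rw [hop, ← hco]
  refine hmain.trans (le_of_eq ?_)
  ring

/-- The drift vanishes when the landmark density is proportional to `pX⁻²`. -/
lemma inner_gradient_eq_zero_of_eq_div_sq (hι : IsIsometricEmbedding (d := d) ι) {pX pY f : M → ℝ}
    (hpX : ContMDiff (𝓡 d) 𝓘(ℝ, ℝ) 4 pX) (hpY : ContMDiff (𝓡 d) 𝓘(ℝ, ℝ) 4 pY)
    (hf : ContMDiff (𝓡 d) 𝓘(ℝ, ℝ) 4 f) (hX : ∀ x, 0 < pX x) (hY : ∀ x, 0 < pY x) {c : ℝ}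
    (hc : ∀ x, pY x = c / pX x ^ 2) (x : M) :
    inner ℝ ((2 / pX x) • riemannianGradient d pX x + (1 / pY x) • riemannianGradient d pY x)
      (riemannianGradient d f x) = 0 := by
  have hX1 := hpX.of_le (show (1 : WithTop ℕ∞) ≤ 4 by norm_num)
  have hY1 := hpY.of_le (show (1 : WithTop ℕ∞) ≤ 4 by norm_num)
  have hf1 := hf.of_le (show (1 : WithTop ℕ∞) ≤ 4 by norm_num)
  have hX0 := (hX x).ne'
  have hY0 := (hY x).ne'
  have hconst : (fun y => pY y * (pX y * pX y)) = fun _ => c := funext fun y => by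
    have := (hX y).ne'
    rw [hc y]
    field_simp
  -- The gradient of the constant `pY pX²`, expanded by the product rule, is the drift up to a
  -- nonzero factor.
  have h1 := inner_gradient_mul hι (f := pY) (g := fun y => pX y * pX y) (h := f) hY1 (hX1.mul hX1)
    hf1 x
  rw [hconst, inner_gradient_const hι hf1, inner_gradient_mul hι hX1 hX1 hf1] at h1
  rw [inner_add_left, real_inner_smul_left, real_inner_smul_left]
  set α := inner ℝ (riemannianGradient d pX x) (riemannianGradient d f x)
  set β := inner ℝ (riemannianGradient d pY x) (riemannianGradient d f x)
  have h2 : pX x * (2 * pY x * α + pX x * β) = 0 := by linear_combination -h1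
  have h3 := (mul_eq_zero.1 h2).resolve_left hX0
  field_simp
  linear_combination h3

end BiasBound

end RoselandProof

/-! ### From local to global bounds by compactness. -/

theorem theorem3p1 {d D : ℕ} (hd : 1 ≤ d)
    {M : Type*} [TopologicalSpace M] [CompactSpace M]
    [ChartedSpace (EuclideanSpace ℝ (Fin d)) M] [IsManifold (𝓡 d) ∞ M]
    [RiemannianBundle (fun x : M => TangentSpace (𝓡 d) x)]
    [IsContMDiffRiemannianBundle (𝓡 d) ∞ (EuclideanSpace ℝ (Fin d))
      (fun x : M => TangentSpace (𝓡 d) x)]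
    [MeasurableSpace M] [BorelSpace M]
    (ι : M → EuclideanSpace ℝ (Fin D)) (hι : IsIsometricEmbedding (d := d) ι)
    (K : ℝ → ℝ) (hK : IsKernelFunction d K)
    -- the error constant depends on the densities only through these bounds
    (b B : ℝ) (hb : 0 < b) :
    ∃ C ε₀ : ℝ, 0 < ε₀ ∧
      ∀ pX pY : M → ℝ, IsC4Density d pX → IsC4Density d pY →
        (∀ x, b ≤ pX x) → (∀ x, b ≤ pY x) → CkNormLE d ι 4 pX B → CkNormLE d ι 4 pY B →
      ∀ f : M → ℝ, ContMDiff (𝓡 d) 𝓘(ℝ, ℝ) 4 f → ∀ A : ℝ, CkNormLE d ι 4 f A →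
        (∀ x : M, ∀ ε : ℝ, 0 < ε → ε ≤ ε₀ →
          |landmarkOperator (riemannianVolume d M) ι K pX pY ε f x - f x
            - (ε * kernelMoment d K 1 2 0 / d *
                inner ℝ
                  ((2 / pX x) • riemannianGradient d pX x + (1 / pY x) • riemannianGradient d pY x)
                  (riemannianGradient d f x)
              + ε * kernelMoment d K 1 2 0 / d * laplaceBeltrami d f x)|
            ≤ C * A * ε ^ 2) ∧
        ((∃ c : ℝ, ∀ x, pY x = c / pX x ^ 2) →
          ∀ x : M, ∀ ε : ℝ, 0 < ε → ε ≤ ε₀ →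
            |landmarkOperator (riemannianVolume d M) ι K pX pY ε f x - f x
              - ε * kernelMoment d K 1 2 0 / d * laplaceBeltrami d f x| ≤ C * A * ε ^ 2) := by
  suffices h : ∃ C ε₀ : ℝ, 0 ≤ C ∧ 0 < ε₀ ∧ ∀ x ∈ (Set.univ : Set M), ∀ pX pY : M → ℝ,
      ContMDiff (𝓡 d) 𝓘(ℝ, ℝ) 4 pX → ContMDiff (𝓡 d) 𝓘(ℝ, ℝ) 4 pY →
      (∀ x, b ≤ pX x) → (∀ x, b ≤ pY x) → CkNormLE d ι 4 pX B → CkNormLE d ι 4 pY B →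
      ∀ f : M → ℝ, ContMDiff (𝓡 d) 𝓘(ℝ, ℝ) 4 f → ∀ A : ℝ, CkNormLE d ι 4 f A →
      ∀ ε : ℝ, 0 < ε → ε ≤ ε₀ →
        |landmarkOperator (riemannianVolume d M) ι K pX pY ε f x - f x
          - (ε * kernelMoment d K 1 2 0 / d *
              inner ℝ ((2 / pX x) • riemannianGradient d pX x +
                (1 / pY x) • riemannianGradient d pY x) (riemannianGradient d f x)
            + ε * kernelMoment d K 1 2 0 / d * laplaceBeltrami d f x)| ≤ C * A * ε ^ 2 by
    obtain ⟨C, ε₀, -, hε₀, h⟩ := h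
    refine ⟨C, ε₀, hε₀, fun pX pY hX hY hbX hbY hXB hYB f hf A hA => ⟨fun x ε hε hεle =>
      h x (Set.mem_univ x) pX pY hX.contMDiff hY.contMDiff hbX hbY hXB hYB f hf A hA ε hε hεle, ?_⟩⟩
    rintro ⟨c, hc⟩ x ε hε hεle
    have h1 := h x (Set.mem_univ x) pX pY hX.contMDiff hY.contMDiff hbX hbY hXB hYB f hf A hA ε hε
      hεle
    rwa [inner_gradient_eq_zero_of_eq_div_sq hι hX.contMDiff hY.contMDiff hf hX.pos hY.pos hc x,
      mul_zero, zero_add] at h1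
  -- The bound with centres confined to `S` passes to subsets and to unions of two sets, and holds
  -- on a neighbourhood of each point; compactness extends it to `M`.
  refine isCompact_univ.induction_on (p := fun S : Set M => ∃ C ε₀ : ℝ, 0 ≤ C ∧ 0 < ε₀ ∧ ∀ x ∈ S,
      ∀ pX pY : M → ℝ, ContMDiff (𝓡 d) 𝓘(ℝ, ℝ) 4 pX → ContMDiff (𝓡 d) 𝓘(ℝ, ℝ) 4 pY →
      (∀ x, b ≤ pX x) → (∀ x, b ≤ pY x) → CkNormLE d ι 4 pX B → CkNormLE d ι 4 pY B →
      ∀ f : M → ℝ, ContMDiff (𝓡 d) 𝓘(ℝ, ℝ) 4 f → ∀ A : ℝ, CkNormLE d ι 4 f A →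
      ∀ ε : ℝ, 0 < ε → ε ≤ ε₀ →
        |landmarkOperator (riemannianVolume d M) ι K pX pY ε f x - f x
          - (ε * kernelMoment d K 1 2 0 / d *
              inner ℝ ((2 / pX x) • riemannianGradient d pX x +
                (1 / pY x) • riemannianGradient d pY x) (riemannianGradient d f x)
            + ε * kernelMoment d K 1 2 0 / d * laplaceBeltrami d f x)| ≤ C * A * ε ^ 2) ?_ ?_ ?_ ?_
  · exact ⟨0, 1, le_rfl, one_pos, fun x hx => absurd hx (Set.notMem_empty x)⟩
  · rintro S T hST ⟨C, ε₀, hC, hε₀, h⟩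
    exact ⟨C, ε₀, hC, hε₀, fun x hx => h x (hST hx)⟩
  · rintro S T ⟨C, ε₀, hC, hε₀, h⟩ ⟨C', ε₀', hC', hε₀', h'⟩
    refine ⟨C + C', min ε₀ ε₀', add_nonneg hC hC', lt_min hε₀ hε₀', ?_⟩
    rintro x (hx | hx) pX pY hX hY hbX hbY hXB hYB f hf A hA ε hε hεle
    · refine (h x hx pX pY hX hY hbX hbY hXB hYB f hf A hA ε hε
        (hεle.trans (min_le_left _ _))).trans ?_
      have := hA.nonneg x
      gcongr
      exact le_add_of_nonneg_right hC'
    · refine (h' x hx pX pY hX hY hbX hbY hXB hYB f hf A hA ε hε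
        (hεle.trans (min_le_right _ _))).trans ?_
      have := hA.nonneg x
      gcongr
      exact le_add_of_nonneg_left hC
  · intro p _
    obtain ⟨C, ε₀, hC, hε₀, h⟩ := exists_local_bias_bound hd hι hK B hb p
    obtain ⟨t, ht, h⟩ := Filter.eventually_iff_exists_mem.1 h
    exact ⟨t, mem_nhdsWithin_of_mem_nhds ht, C, ε₀, hC, hε₀, h⟩
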